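/- **Notation.** For $g:\mathbb{R}\to\mathbb{R}_{\ge 0}$ and a real matrix (or vector) $M$ let $\|M\|_g=\sum_{i,j} g(M_{i,j})$. $M_i$ is the $i$-th column of $M$, and $A_S$ is the matrix of the columns of $A$ with index in $S$. * $g$ satisfies the $\mathrm{ati}$-approximate triangle inequality for $t$ terms if $g(\sum_{i=1}^t x_i)\le \mathrm{ati}\cdot\sum_{i=1}^t g(x_i)$ for all $x_1,\dots,x_t\in\mathbb{R}$. * $g$ is $\mathrm{mon}$-monotone, for a number $\mathrm{mon}\ge 1$, if $g(x)\le \mathrm{mon}\cdot g(y)$ whenever $|x|\le|y|$. * $g$ has the $(\mathrm{reg},T)$-regression property for sizes $(n,d,m)$, with failure exponent $c>0$, if there is a randomized algorithm that takes at most $T$ steps and, on any input $D\in\mathbb{R}^{n\times d}$, $B\in\mathbb{R}^{n\times m}$, outputs $X'\in\mathbb{R}^{d\times m}$ and $v\in\mathbb{R}^m$ such that, with probability at least $1-(nm)^{-c}$, for all $i\in[m]$ $$\|DX'_i-B_i\|_g\le \mathrm{reg}\cdot \mathrm{OPT}_i,\qquad \mathrm{OPT}_i\le v_i\le \mathrm{reg}\cdot\mathrm{OPT}_i,\qquad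 \mathrm{OPT}_i=\inf_{x\in\mathbb{R}^d}\|Dx-B_i\|_g .$$ The model of computation is a randomized real random access machine (unit-cost addition, subtraction, comparison and indirect addressing of natural numbers; addition, subtraction, multiplication and comparison of real numbers; reading of entries of the input matrix; uniformly random natural numbers from $\{0,\dots,b\}$). It may call a given regression algorithm on matrices $A_P,A_Q$ specified by lists $P,Q$ of column indices of the input matrix $A$; a call is charged with $T$ steps, and the calls use independent randomness. **Theorem.** For every $c>0$ there are a program of this machine and constants $C,e$, depending only on $c$, such that the following holds for all $k\ge 1$, $n\ge 2$ and $A\in\mathbb{R}^{n\times n}$. Let $k'=2k+1$, and let $g:\mathbb{R}\to\mathbb{R}_{\ge0}$ satisfy the $\mathrm{ati}$-approximate triangle inequality for $k'$ terms, be $\mathrm{mon}$-monotone, and have the $(\mathrm{reg},T)$-regression property for sizes $(n,k',n)$ with failure exponent $c$. Let $\mathrm{OPT}=\inf\{\|A'-A\|_g : A'\in\mathbb{R}^{n\times n},\ \mathrm{rank}(A')\le k\}$. On input $(n,k,A)$, and with calls to the regression algorithm of $g$, the program always halts within $C\,(n+T)\,(\log n)^{e}$ steps, that is, in time $\widetilde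 O(n+T)$, and outputs a set $S\subseteq[n]$ with $|S|\le C\,k\log n$; with probability at least $0.99$ there is an $X\in\mathbb{R}^{|S|\times n}$ with $$\|A_SX-A\|_g\le \mathrm{ati}\cdot\mathrm{mon}\cdot\mathrm{reg}\cdot C\,k\log(k+1)\cdot\mathrm{OPT}.$$ -/

import Mathlib

open scoped BigOperators Matrix

noncomputable section

namespace LossLowRank

/-! ### Loss functions -/

/-- `‖v‖_g = ∑ i, g (v i)` for a vector `v`. -/
def vecLoss {ι : Type*} [Fintype ι] (g : ℝ → ℝ) (v : ι → ℝ) : ℝ :=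
  ∑ i, g (v i)

/-- `‖M‖_g = ∑ i, ∑ j, g (M i j)` for a matrix `M`. -/
def matLoss {ι κ : Type*} [Fintype ι] [Fintype κ] (g : ℝ → ℝ) (M : Matrix ι κ ℝ) : ℝ :=
  ∑ i, ∑ j, g (M i j)

/-- The `ati`-approximate triangle inequality for sums of `t` real numbers. -/
def ApproxTriangle (g : ℝ → ℝ) (t : ℕ) (ati : ℝ) : Prop :=
  ∀ x : Fin t → ℝ, g (∑ i, x i) ≤ ati * ∑ i, g (x i)

/-- The `mon`-monotone property, for a parameter `mon ≥ 1`. -/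
def ApproxMonotone (g : ℝ → ℝ) (mon : ℝ) : Prop :=
  1 ≤ mon ∧ ∀ x y : ℝ, |x| ≤ |y| → g x ≤ mon * g y

/-- The optimal cost of approximating `A` by a matrix of rank at most `k`.  For `g ≥ 0` this is the
infimum of a nonempty set of reals that is bounded below by `0`. -/
def optRank {n m : ℕ} (g : ℝ → ℝ) (A : Matrix (Fin n) (Fin m) ℝ) (k : ℕ) : ℝ :=
  ⨅ B : {B : Matrix (Fin n) (Fin m) ℝ // B.rank ≤ k}, matLoss g (B.1 - A)

/-- The optimal cost of the regression problem `min_x ‖D x - b‖_g`. -/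
def optReg {n d : ℕ} (g : ℝ → ℝ) (D : Matrix (Fin n) (Fin d) ℝ) (b : Fin n → ℝ) : ℝ :=
  ⨅ x : Fin d → ℝ, vecLoss g (D *ᵥ x - b)

/-- The submatrix `A_S` of the columns of `A` with index in `S`. -/
def colsOf {n m : ℕ} (A : Matrix (Fin n) (Fin m) ℝ) (S : Finset (Fin m)) :
    Matrix (Fin n) S ℝ :=
  A.submatrix id Subtype.val

/-! ### Regression algorithms -/

/-- A randomized algorithm for regression with design matrices of size `n × d` and `m` right-hand
sides: for each input, the law of its output (the solutions, as the columns of a `d × m` matrix, and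
the `m` estimated costs), together with the number of steps that one run is charged with. -/
structure RegressionAlg (n d m : ℕ) where
  law : Matrix (Fin n) (Fin d) ℝ → Matrix (Fin n) (Fin m) ℝ →
    PMF (Matrix (Fin d) (Fin m) ℝ × (Fin m → ℝ))
  time : ℕ

/-- `(X, v)` is a correct answer, up to the factor `reg`, for the regression of the columns of `B`
on the columns of `D`. -/
def RegressionCorrect {n d m : ℕ} (g : ℝ → ℝ) (reg : ℝ) (D : Matrix (Fin n) (Fin d) ℝ)
    (B : Matrix (Fin n) (Fin m) ℝ) (o : Matrix (Fin d) (Fin m) ℝ × (Fin m → ℝ)) : Prop :=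
  ∀ i : Fin m,
    vecLoss g (D *ᵥ o.1.col i - B.col i) ≤ reg * optReg g D (B.col i) ∧
    optReg g D (B.col i) ≤ o.2 i ∧ o.2 i ≤ reg * optReg g D (B.col i)

/-- On every input the answer is correct with probability at least `1 - 1 / (n m) ^ c`. -/
def RegressionAlg.Solves {n d m : ℕ} (R : RegressionAlg n d m) (g : ℝ → ℝ) (reg c : ℝ) : Prop :=
  ∀ (D : Matrix (Fin n) (Fin d) ℝ) (B : Matrix (Fin n) (Fin m) ℝ),
    ENNReal.ofReal (1 - 1 / ((n : ℝ) * (m : ℝ)) ^ c) ≤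
      (R.law D B).toOuterMeasure {o | RegressionCorrect g reg D B o}

/-! ### The machine model

A randomized real random access machine, programmed in a structured language.  It has registers and
arrays (each named by a natural number) holding natural numbers, and registers and arrays holding
real numbers; natural numbers may be added, subtracted (truncated) and compared, real numbers may be
added, subtracted, multiplied and compared.  It may draw uniformly random natural numbers, read the
entries of the input matrix, and call a regression algorithm on lists of columns of that matrix. -/

/-- A state of the machine.  The field `time` is the clock; programs cannot read it. -/
structure State where
  nreg : ℕ → ℕ
  rreg : ℕ → ℝ
  narr : ℕ → ℕ → ℕ
  rarr : ℕ → ℕ → ℝ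
  time : ℕ

/-- Advance the clock. -/
def State.tick (s : State) (t : ℕ) : State := { s with time := s.time + t }

def State.setN (s : State) (x v : ℕ) : State :=
  { s with nreg := Function.update s.nreg x v }

def State.setR (s : State) (x : ℕ) (v : ℝ) : State :=
  { s with rreg := Function.update s.rreg x v }

def State.putN (s : State) (a i v : ℕ) : State :=
  { s with narr := Function.update s.narr a (Function.update (s.narr a) i v) }

def State.putR (s : State) (a i : ℕ) (v : ℝ) : State :=
  { s with rarr := Function.update s.rarr a (Function.update (s.rarr a) i v) }

/-- Expressions for natural numbers. -/
inductive NExp where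
  | const (c : ℕ)
  | reg (x : ℕ)
  | get (a : ℕ) (i : NExp)
  | add (e f : NExp)
  | sub (e f : NExp)

def NExp.eval (s : State) : NExp → ℕ
  | .const c => c
  | .reg x => s.nreg x
  | .get a i => s.narr a (i.eval s)
  | .add e f => e.eval s + f.eval s
  | .sub e f => e.eval s - f.eval s

/-- The number of operations in an expression. -/
def NExp.cost : NExp → ℕ
  | .const _ => 1
  | .reg _ => 1
  | .get _ i => i.cost + 1
  | .add e f => e.cost + f.cost + 1
  | .sub e f => e.cost + f.cost + 1

/-- The entry of `A` at position `(i, j)`, and `0` out of range. -/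
def entryAt {n : ℕ} (A : Matrix (Fin n) (Fin n) ℝ) (i j : ℕ) : ℝ :=
  if h : i < n ∧ j < n then A ⟨i, h.1⟩ ⟨j, h.2⟩ else 0

/-- Expressions for real numbers; `entry i j` reads the input matrix. -/
inductive RExp where
  | zero
  | one
  | reg (x : ℕ)
  | get (a : ℕ) (i : NExp)
  | entry (i j : NExp)
  | add (e f : RExp)
  | sub (e f : RExp)
  | mul (e f : RExp)

def RExp.eval {n : ℕ} (A : Matrix (Fin n) (Fin n) ℝ) (s : State) : RExp → ℝ
  | .zero => 0
  | .one => 1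
  | .reg x => s.rreg x
  | .get a i => s.rarr a (i.eval s)
  | .entry i j => entryAt A (i.eval s) (j.eval s)
  | .add e f => e.eval A s + f.eval A s
  | .sub e f => e.eval A s - f.eval A s
  | .mul e f => e.eval A s * f.eval A s

/-- The number of operations in an expression. -/
def RExp.cost : RExp → ℕ
  | .zero => 1
  | .one => 1
  | .reg _ => 1
  | .get _ i => i.cost + 1
  | .entry i j => i.cost + j.cost + 1
  | .add e f => e.cost + f.cost + 1
  | .sub e f => e.cost + f.cost + 1
  | .mul e f => e.cost + f.cost + 1

/-- Tests: `e ≤ f` for natural numbers and for real numbers. -/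
inductive Test where
  | nle (e f : NExp)
  | rle (e f : RExp)

def Test.Holds {n : ℕ} (A : Matrix (Fin n) (Fin n) ℝ) (s : State) : Test → Prop
  | .nle e f => e.eval s ≤ f.eval s
  | .rle e f => e.eval A s ≤ f.eval A s

def Test.cost : Test → ℕ
  | .nle e f => e.cost + f.cost + 1
  | .rle e f => e.cost + f.cost + 1

/-- Programs. -/
inductive Prog where
  | skip
  | seq (p q : Prog)
  /-- write a natural number to a register -/
  | setN (x : ℕ) (e : NExp)
  /-- write a real number to a register -/
  | setR (x : ℕ) (e : RExp)
  /-- write a natural number to position `i` of array `a` -/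
  | putN (a : ℕ) (i e : NExp)
  /-- write a real number to position `i` of array `a` -/
  | putR (a : ℕ) (i : NExp) (e : RExp)
  /-- write a uniformly random element of `{0, …, e}` to a register -/
  | rand (x : ℕ) (e : NExp)
  /-- call the regression algorithm on the columns of the input matrix listed in the arrays `P`
  (design matrix) and `Q` (right-hand sides); solutions and estimated costs are written to the
  real arrays `X` (row by row) and `V` -/
  | regress (P Q X V : ℕ)
  | ite (b : Test) (p q : Prog)
  | while (b : Test) (p : Prog)

/-- The uniform distribution on `{0, …, b}`. -/
def uniformUpTo (b : ℕ) : PMF ℕ :=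
  PMF.uniformOfFinset (Finset.range (b + 1)) ⟨0, Finset.mem_range.2 (Nat.succ_pos b)⟩

/-- The matrix whose columns are the columns of `A` listed in the first `d` positions of `L`. -/
def listedCols {n : ℕ} (A : Matrix (Fin n) (Fin n) ℝ) (d : ℕ) (L : ℕ → ℕ) :
    Matrix (Fin n) (Fin d) ℝ :=
  Matrix.of fun i j => entryAt A i (L j)

/-- Write a matrix row by row into the first `d * m` positions of an array. -/
def writeMat {d m : ℕ} (X : Matrix (Fin d) (Fin m) ℝ) (old : ℕ → ℝ) : ℕ → ℝ := fun a =>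
  if h : a < d * m then
    X (finProdFinEquiv.symm ⟨a, h⟩).1 (finProdFinEquiv.symm ⟨a, h⟩).2
  else old a

/-- Write a vector into the first `m` positions of an array. -/
def writeVec {m : ℕ} (v : Fin m → ℝ) (old : ℕ → ℝ) : ℕ → ℝ := fun a =>
  if h : a < m then v ⟨a, h⟩ else old a

/-- Store the answer of a regression call. -/
def State.storeAnswer {d m : ℕ} (s : State) (X V : ℕ)
    (o : Matrix (Fin d) (Fin m) ℝ × (Fin m → ℝ)) : State :=
  let r := Function.update s.rarr X (writeMat o.1 (s.rarr X))
  { s with rarr := Function.update r V (writeVec o.2 (r V)) }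

/-- Sequential composition of probabilistic computations that may run out of fuel (`none`). -/
def andThen (μ : PMF (Option State)) (f : State → PMF (Option State)) : PMF (Option State) :=
  μ.bind fun o => o.elim (PMF.pure none) f

open Classical in
/-- At most `fuel` evaluations of the test of a loop. -/
def runLoop {n : ℕ} (A : Matrix (Fin n) (Fin n) ℝ) (b : Test)
    (body : State → PMF (Option State)) : ℕ → State → PMF (Option State)
  | 0, _ => PMF.pure none
  | fuel + 1, s =>
    if b.Holds A s then andThen (body (s.tick b.cost)) (runLoop A b body fuel)
    else PMF.pure (some (s.tick b.cost))

open Classical in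
/-- The law of the final state of a program started in a given state, on input matrix `A` and with
access to the regression algorithm `R`.  Every operation takes one step, and a call of `R` takes
`R.time` further steps.  The result is `none` if some loop evaluates its test more than `fuel` times;
if `none` does not occur then the law does not change when `fuel` is increased. -/
def run {n d m : ℕ} (A : Matrix (Fin n) (Fin n) ℝ) (R : RegressionAlg n d m) (fuel : ℕ) :
    Prog → State → PMF (Option State)
  | .skip, s => PMF.pure (some (s.tick 1))
  | .seq p q, s => andThen (run A R fuel p s) (run A R fuel q)
  | .setN x e, s => PMF.pure (some ((s.setN x (e.eval s)).tick (e.cost + 1)))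
  | .setR x e, s => PMF.pure (some ((s.setR x (e.eval A s)).tick (e.cost + 1)))
  | .putN a i e, s =>
    PMF.pure (some ((s.putN a (i.eval s) (e.eval s)).tick (i.cost + e.cost + 1)))
  | .putR a i e, s =>
    PMF.pure (some ((s.putR a (i.eval s) (e.eval A s)).tick (i.cost + e.cost + 1)))
  | .rand x e, s =>
    (uniformUpTo (e.eval s)).map fun j => some ((s.setN x j).tick (e.cost + 1))
  | .regress P Q X V, s =>
    (R.law (listedCols A d (s.narr P)) (listedCols A m (s.narr Q))).map fun o =>
      some ((s.storeAnswer X V o).tick (R.time + 1))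
  | .ite b p q, s =>
    if b.Holds A s then run A R fuel p (s.tick b.cost) else run A R fuel q (s.tick b.cost)
  | .while b p, s => runLoop A b (run A R fuel p) fuel s

/-- The initial state: `n` and `k` are in the registers `0` and `1`, everything else is `0`. -/
def initState (n k : ℕ) : State where
  nreg := fun x => if x = 0 then n else if x = 1 then k else 0
  rreg := fun _ => 0
  narr := fun _ _ => 0
  rarr := fun _ _ => 0
  time := 0

/-- The set of column indices that a program outputs: its elements are listed in array `0`, and the
length of the list is in register `0`. -/
def outputSet (n : ℕ) (s : State) : Finset (Fin n) :=
  (Finset.univ : Finset (Fin n)).filter fun j => (j : ℕ) ∈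
    (Finset.range (s.nreg 0)).image (s.narr 0)

end LossLowRank

end

/-! Columns are removed in rounds. With F the set of surviving columns, a trial samples 2k columns
of F with replacement, regresses all columns on them, draws a pivot from F, and proposes to remove
the columns of F whose estimated cost is at most that of the pivot. A round follows the smallest
threshold, over O(log n) trials, that removes at least |F|/20 columns. Hence there are O(log n)
rounds, and nothing has to be sorted.

One trial. Fix B of rank at most k with nearly optimal loss. Sample and pivot form a uniform
(2k+1)-tuple. A subfamily of maximal determinant and Cramer's rule show that at most k members of a
tuple of columns of B are not combinations of the others with coefficients in [-1,1]
(`exists_card_le_boundedComb`), so by exchangeability the pivot is exceptional with probability at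
most 1/2 (`card_not_boundedComb_le`). Otherwise the same coefficients, applied to the columns of A,
leave a residual that is a bounded combination of 2k+1 columns of B - A, and its cost is at most
ati·mon times the sum of their losses (`colCost_le_of_boundedComb`). With probability at least 4/5
the tuple avoids the |F|/q largest losses, q = 10(2k+1), and its losses sum to at most ten times the
mean formed with the other columns (`card_bad_tuple_le`). The pivot lies in the cheapest twentieth
of F with probability at most 1/20. So a trial whose regression is correct fails with probability at
most 3/4.

Summation. With m = |F|, the columns removed in a good round cost O(k) times the sum of the sorted
losses with ranks from m/q to m/q + m. Since m decreases geometrically, a given loss lies in only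
O(log k) of these windows (`sum_tails_le`). Leaving out the largest losses is thus what produces log
k in place of log n.

Probabilities and worst-case bounds are handled together by expectations of potentials with values
in [0,⊤]: a violated invariant or a lack of fuel has potential ⊤, a bad output has potential 1. A
bound of 1/100 on the expectation then gives both the sure bounds and the success probability. -/

noncomputable section

namespace LossLowRank

open scoped ENNReal

/-! ### Expected values of potentials under the law of a program -/

/-- The expected value of `φ` in the final state; running out of fuel counts as `⊤`. -/
def expect (μ : PMF (Option State)) (φ : State → ℝ≥0∞) : ℝ≥0∞ :=
  ∑' o, μ o * o.elim ⊤ φ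

theorem expect_mono (μ : PMF (Option State)) {φ ψ : State → ℝ≥0∞} (h : ∀ s, φ s ≤ ψ s) :
    expect μ φ ≤ expect μ ψ := by
  refine ENNReal.tsum_le_tsum fun o => mul_le_mul_right ?_ _
  cases o with
  | none => exact le_rfl
  | some s => exact h s

theorem expect_pure (s : State) (φ : State → ℝ≥0∞) :
    expect (PMF.pure (some s)) φ = φ s := by
  unfold expect
  rw [tsum_eq_single (some s)]
  · simp [PMF.pure_apply]
  · intro o ho
    simp [PMF.pure_apply, ho]

theorem expect_map {α : Type*} (ν : PMF α) (f : α → State) (φ : State → ℝ≥0∞) :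
    expect (ν.map fun a => some (f a)) φ = ∑' a, ν a * φ (f a) := by
  classical
  unfold expect
  simp only [PMF.map_apply, ← ENNReal.tsum_mul_right]
  rw [ENNReal.tsum_comm]
  refine tsum_congr fun a => ?_
  rw [tsum_eq_single (some (f a))]
  · simp
  · intro o ho
    simp [ho]

theorem expect_uniform (b : ℕ) (f : ℕ → State) (φ : State → ℝ≥0∞) :
    expect ((uniformUpTo b).map fun a => some (f a)) φ
      = (∑ j ∈ Finset.range (b + 1), φ (f j)) / ((b + 1 : ℕ) : ℝ≥0∞) := by
  rw [expect_map, tsum_eq_sum (s := Finset.range (b + 1)), ENNReal.div_eq_inv_mul, Finset.mul_sum]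
  · refine Finset.sum_congr rfl fun j hj => ?_
    have h : uniformUpTo b j = _ :=
      PMF.uniformOfFinset_apply_of_mem ⟨0, Finset.mem_range.2 (Nat.succ_pos b)⟩ hj
    rw [h, Finset.card_range]
  · intro j hj
    have h : uniformUpTo b j = 0 :=
      PMF.uniformOfFinset_apply_of_notMem ⟨0, Finset.mem_range.2 (Nat.succ_pos b)⟩ hj
    rw [h, zero_mul]

theorem expect_andThen (μ : PMF (Option State)) (f : State → PMF (Option State))
    (φ : State → ℝ≥0∞) :
    expect (andThen μ f) φ = expect μ fun s => expect (f s) φ := by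
  unfold expect andThen
  simp only [PMF.bind_apply, ← ENNReal.tsum_mul_right]
  rw [ENNReal.tsum_comm]
  refine tsum_congr fun o => ?_
  cases o with
  | none =>
    simp only [Option.elim_none, mul_assoc, ENNReal.tsum_mul_left]
    congr 1
    rw [tsum_eq_single none]
    · simp
    · intro o ho
      simp [PMF.pure_apply, ho]
  | some s => simp only [Option.elim_some, mul_assoc, ENNReal.tsum_mul_left]

/-- Every final state satisfies `Q`. -/
def Surely (μ : PMF (Option State)) (Q : State → Prop) : Prop :=
  ∀ (φ : State → ℝ≥0∞) (e : ℝ≥0∞), (∀ s, Q s → φ s ≤ e) → expect μ φ ≤ e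

theorem Surely.mono {μ : PMF (Option State)} {Q Q' : State → Prop} (h : Surely μ Q)
    (hQ : ∀ s, Q s → Q' s) : Surely μ Q' :=
  fun φ e hφ => h φ e fun s hs => hφ s (hQ s hs)

theorem surely_pure {s : State} {Q : State → Prop} (h : Q s) :
    Surely (PMF.pure (some s)) Q := fun φ e hφ => by
  rw [expect_pure]
  exact hφ s h

theorem Surely.andThen {μ : PMF (Option State)} {f : State → PMF (Option State)}
    {P Q : State → Prop} (h : Surely μ P) (hf : ∀ s, P s → Surely (f s) Q) :
    Surely (LossLowRank.andThen μ f) Q := fun φ e hφ => by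
  rw [expect_andThen]
  exact h _ _ fun s hs => hf s hs φ e hφ

theorem expect_andThen_le {μ : PMF (Option State)} {f : State → PMF (Option State)}
    {P : State → Prop} {φ : State → ℝ≥0∞} {e : ℝ≥0∞} (h : Surely μ P)
    (hf : ∀ s, P s → expect (f s) φ ≤ e) : expect (andThen μ f) φ ≤ e := by
  rw [expect_andThen]
  exact h _ _ hf

open Classical in
/-- The potential `φ`, or `⊤` where `I` fails. -/
def guarded (I : State → Prop) (φ : State → ℝ≥0∞) (s : State) : ℝ≥0∞ :=
  if I s then φ s else ⊤

theorem guarded_of {I : State → Prop} {φ : State → ℝ≥0∞} {s : State} (h : I s) :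
    guarded I φ s = φ s := if_pos h

/-- The rule for loops: `I` is an invariant, `N` bounds the number of iterations, and the expected
potential does not increase. -/
theorem expect_runLoop_le {n : ℕ} {A : Matrix (Fin n) (Fin n) ℝ} {b : Test}
    {body : State → PMF (Option State)} {φ : State → ℝ≥0∞} (N : ℕ) (I : ℕ → State → Prop)
    (pot : ℕ → State → ℝ≥0∞)
    (hexit : ∀ j s, I j s → ¬ b.Holds A s → φ (s.tick b.cost) ≤ pot j s)
    (hstep : ∀ j s, I j s → b.Holds A s →
      j < N ∧ expect (body (s.tick b.cost)) (guarded (I (j + 1)) (pot (j + 1))) ≤ pot j s) :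
    ∀ (fuel j : ℕ) (s : State), N < fuel + j → I j s → 0 < fuel →
      expect (runLoop A b body fuel s) φ ≤ pot j s := by
  intro fuel
  induction fuel with
  | zero => intro j s _ _ h; exact absurd h (lt_irrefl 0)
  | succ fuel ih =>
    intro j s hN hI _
    rw [runLoop]
    split_ifs with hb
    · obtain ⟨hj, hle⟩ := hstep j s hI hb
      rw [expect_andThen]
      -- Where the invariant fails after the body the guarded potential is ⊤, so only states that
      -- satisfy it matter.
      refine (expect_mono _ fun s' => ?_).trans hle
      by_cases hI' : I (j + 1) s'
      · rw [guarded_of hI']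
        exact ih (j + 1) s' (by omega) hI' (by omega)
      · rw [guarded, if_neg hI']
        exact le_top
    · rw [expect_pure]
      exact hexit j s hI hb

theorem surely_runLoop {n : ℕ} {A : Matrix (Fin n) (Fin n) ℝ} {b : Test}
    {body : State → PMF (Option State)} {Q : State → Prop} (N : ℕ) (I : ℕ → State → Prop)
    (hexit : ∀ j s, I j s → ¬ b.Holds A s → Q (s.tick b.cost))
    (hstep : ∀ j s, I j s → b.Holds A s →
      j < N ∧ Surely (body (s.tick b.cost)) (I (j + 1)))
    {fuel : ℕ} {s : State} (hN : N < fuel) (hI : I 0 s) :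
    Surely (runLoop A b body fuel s) Q := fun φ e hφ =>
  expect_runLoop_le N I (fun _ _ => e) (fun j s hI hb => hφ _ (hexit j s hI hb))
    (fun j s hI hb => ⟨(hstep j s hI hb).1, (hstep j s hI hb).2 _ _ fun s' hs' => by
      rw [guarded_of hs']⟩) fuel 0 s (by omega) hI (by omega)

/-- A bound on an expected potential gives safety on the support and a bound on the probability of
failure. -/
theorem support_of_expect_guarded_ne_top {μ : PMF (Option State)} {I : State → Prop}
    {φ : State → ℝ≥0∞} (h : expect μ (guarded I φ) ≠ ⊤) :
    ∀ o ∈ μ.support, ∃ s, o = some s ∧ I s := by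
  intro o ho
  have hne := ENNReal.ne_top_of_tsum_ne_top h o
  have hμ : μ o ≠ 0 := (PMF.mem_support_iff _ _).1 ho
  cases o with
  | none => exact absurd (ENNReal.mul_top hμ) hne
  | some s =>
    refine ⟨s, rfl, ?_⟩
    by_contra hI
    apply hne
    simp [guarded, hI, ENNReal.mul_top hμ]

theorem PMF.toOuterMeasure_add_compl {α : Type*} (μ : PMF α) (S : Set α) :
    μ.toOuterMeasure S + μ.toOuterMeasure Sᶜ = 1 := by
  rw [PMF.toOuterMeasure_apply, PMF.toOuterMeasure_apply, ← ENNReal.tsum_add, ← μ.tsum_coe]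
  refine tsum_congr fun a => ?_
  rw [← Pi.add_apply, Set.indicator_self_add_compl]

/-- Markov's inequality: the potential is at least 1 on the complement of `S`, where `none` counts
as ⊤. -/
theorem le_toOuterMeasure_of_expect_le {μ : PMF (Option State)} {φ : State → ℝ≥0∞}
    {S : Set (Option State)} {δ : ℝ} (hδ : 0 ≤ δ) (h : expect μ φ ≤ ENNReal.ofReal δ)
    (hS : ∀ s, some s ∉ S → 1 ≤ φ s) : ENNReal.ofReal (1 - δ) ≤ μ.toOuterMeasure S := by
  have hc : μ.toOuterMeasure Sᶜ ≤ ENNReal.ofReal δ := by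
    refine le_trans ?_ h
    rw [PMF.toOuterMeasure_apply]
    refine ENNReal.tsum_le_tsum fun o => ?_
    by_cases ho : o ∈ S
    · simp [ho]
    · rw [Set.indicator_of_mem (by exact ho)]
      cases o with
      | none =>
        by_cases h0 : μ none = 0
        · simp [h0]
        · simp [ENNReal.mul_top h0]
      | some s => simpa using mul_le_mul_right (hS s ho) (μ (some s))
  rw [ENNReal.ofReal_sub _ hδ, ENNReal.ofReal_one, tsub_le_iff_right,
    ← PMF.toOuterMeasure_add_compl μ S]
  gcongr

theorem RegressionAlg.Solves.incorrect_le {n d m : ℕ} {R : RegressionAlg n d m} {g : ℝ → ℝ}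
    {reg c : ℝ} (hR : R.Solves g reg c) (D : Matrix (Fin n) (Fin d) ℝ)
    (B : Matrix (Fin n) (Fin m) ℝ) :
    (R.law D B).toOuterMeasure {o | RegressionCorrect g reg D B o}ᶜ
      ≤ ENNReal.ofReal (1 / ((n : ℝ) * (m : ℝ)) ^ c) := by
  have h0 : (0 : ℝ) ≤ 1 / ((n : ℝ) * (m : ℝ)) ^ c := by positivity
  have h1 := hR D B
  have h2 := PMF.toOuterMeasure_add_compl (R.law D B) {o | RegressionCorrect g reg D B o}
  rw [ENNReal.ofReal_sub _ h0, ENNReal.ofReal_one, ← h2, tsub_le_iff_right] at h1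
  refine (ENNReal.add_le_add_iff_left ?_).1 h1
  exact ne_top_of_le_ne_top ENNReal.one_ne_top (h2 ▸ le_self_add)

/-! ### Bounded linear combinations -/

/-- `a t` is a linear combination of the other members of the family, with coefficients in
`[-1, 1]`. -/
def BoundedComb {ι V : Type*} [Fintype ι] [AddCommGroup V] [Module ℝ V] (a : ι → V) (t : ι) :
    Prop :=
  ∃ x : ι → ℝ, (∀ j, |x j| ≤ 1) ∧ x t = 0 ∧ a t = ∑ j, x j • a j

/-- A family whose span has dimension at most `k` has at most `k` members that are not bounded
combinations of the others: the members of a subfamily of maximal determinant. -/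
theorem exists_card_le_boundedComb {ι V : Type*} [Fintype ι] [DecidableEq ι] [AddCommGroup V]
    [Module ℝ V] (a : ι → V) {k : ℕ}
    (hk : Module.finrank ℝ (Submodule.span ℝ (Set.range a)) ≤ k) :
    ∃ Q : Finset ι, Q.card ≤ k ∧ ∀ t ∉ Q, BoundedComb a t := by
  classical
  set W := Submodule.span ℝ (Set.range a) with hW
  have : FiniteDimensional ℝ W := FiniteDimensional.span_of_finite ℝ (Set.finite_range a)
  set d := Module.finrank ℝ W with hd
  let a' : ι → W := fun i => ⟨a i, Submodule.subset_span ⟨i, rfl⟩⟩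
  let e : Module.Basis (Fin d) ℝ W := Module.finBasis ℝ W
  obtain ⟨f, hf, -, hfli⟩ := Submodule.exists_fun_fin_finrank_span_eq ℝ (Set.range a)
  choose b₀ hb₀ using hf
  have hli₀ : LinearIndependent ℝ (a' ∘ b₀) := by
    refine LinearIndependent.of_comp W.subtype ?_
    have : ⇑W.subtype ∘ a' ∘ b₀ = f := funext hb₀
    rw [this]
    exact hfli
  have hdet₀ : e.det (a' ∘ b₀) ≠ 0 := by
    have := (e.is_basis_iff_det (v := a' ∘ b₀)).1
      ⟨hli₀, hli₀.span_eq_top_of_card_eq_finrank' (Fintype.card_fin _)⟩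
    exact this.ne_zero
  have : Nonempty (Fin d → ι) := ⟨b₀⟩
  -- The maximal determinant is nonzero because the members `b₀` form a basis.
  obtain ⟨b, hb⟩ := Finite.exists_max fun b : Fin d → ι => |e.det (a' ∘ b)|
  have hdet : e.det (a' ∘ b) ≠ 0 := by
    intro h
    have := hb b₀
    rw [h, abs_zero] at this
    exact hdet₀ (abs_nonpos_iff.1 this)
  obtain ⟨hli, hsp⟩ := (e.is_basis_iff_det (v := a' ∘ b)).2 (isUnit_iff_ne_zero.2 hdet)
  let e' := Module.Basis.mk hli hsp.ge
  refine ⟨Finset.univ.image b, (Finset.card_image_le.trans (by simp)).trans hk, fun t ht => ?_⟩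
  have htb : ∀ i, b i ≠ t := fun i h => ht (h ▸ Finset.mem_image_of_mem b (Finset.mem_univ i))
  -- Cramer's rule: this coordinate is the quotient of the determinant with its i-th vector replaced
  -- by `a t` and the maximal determinant.
  have hcoord : ∀ i, |e'.coord i (a' t)| ≤ 1 := by
    intro i
    have h := congrArg (fun l => l (a' t)) (e.det_smul_mk_coord_eq_det_update hli hsp.ge i)
    simp only [LinearMap.smul_apply, smul_eq_mul, MultilinearMap.toLinearMap_apply] at h
    have hupd : Function.update (a' ∘ b) i (a' t) = a' ∘ Function.update b i t := by
      ext j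
      by_cases hj : j = i
      · subst hj; simp
      · simp [Function.update_of_ne hj]
    rw [hupd] at h
    have hle := hb (Function.update b i t)
    have h' : |e.det (a' ∘ b)| * |e'.coord i (a' t)| ≤ |e.det (a' ∘ b)| * 1 := by
      rw [← abs_mul, mul_one]
      exact (congrArg abs h).le.trans hle
    exact le_of_mul_le_mul_left h' (abs_pos.2 hdet)
  have hsum : a t = ∑ i, e'.coord i (a' t) • a (b i) := by
    have h := congrArg (W.subtype) (e'.sum_repr (a' t))
    rw [map_sum] at h
    rw [show a t = W.subtype (a' t) from rfl, ← h]
    refine Finset.sum_congr rfl fun i _ => ?_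
    rw [map_smul]
    simp [e', a']
  have hbinj : Function.Injective b := fun i j hij =>
    hli.injective (by simp [hij])
  refine ⟨fun j => if h : ∃ i, b i = j then e'.coord h.choose (a' t) else 0, ?_, ?_, ?_⟩
  · intro j
    dsimp only
    split_ifs
    · exact hcoord _
    · simp
  · exact dif_neg fun ⟨i, hi⟩ => htb i hi
  · rw [hsum]
    refine Finset.sum_of_injOn b hbinj.injOn (fun _ _ => by simp) ?_ ?_
    · intro j _ hj
      dsimp only
      rw [dif_neg, zero_smul]
      rintro ⟨i, hi⟩
      exact hj ⟨i, by simp, hi⟩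
    · intro i _
      have h : ∃ i', b i' = b i := ⟨i, rfl⟩
      dsimp only
      rw [dif_pos h, hbinj h.choose_spec]

/-- Permuting the members of a family. -/
theorem boundedComb_comp_perm {ι V : Type*} [Fintype ι] [AddCommGroup V] [Module ℝ V]
    (a : ι → V) (σ : Equiv.Perm ι) (t : ι) :
    BoundedComb (a ∘ σ) t ↔ BoundedComb a (σ t) := by
  constructor
  · rintro ⟨x, hx, hxt, h⟩
    refine ⟨x ∘ σ.symm, fun j => hx _, by simpa using hxt, ?_⟩
    rw [show a (σ t) = (a ∘ σ) t from rfl, h]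
    exact Fintype.sum_equiv σ _ _ fun j => by simp
  · rintro ⟨x, hx, hxt, h⟩
    refine ⟨x ∘ σ, fun j => hx _, by simpa using hxt, ?_⟩
    rw [show (a ∘ σ) t = a (σ t) from rfl, h]
    exact (Fintype.sum_equiv σ _ _ fun j => by simp).symm

open Classical in
/-- In a random `(2k + 1)`-tuple of vectors from a `k`-dimensional family, the last vector is, with
probability at least one half, a bounded combination of the others. -/
theorem card_not_boundedComb_le {α V : Type*} [AddCommGroup V] [Module ℝ V]
    (a : α → V) (F : Finset α) {k : ℕ}
    (hk : ∀ z : Fin (2 * k + 1) → α,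
      Module.finrank ℝ (Submodule.span ℝ (Set.range (a ∘ z))) ≤ k) :
    2 * ((Fintype.piFinset fun _ : Fin (2 * k + 1) => F).filter
      fun z => ¬ BoundedComb (a ∘ z) (Fin.last (2 * k))).card ≤ F.card ^ (2 * k + 1) := by
  set Z := Fintype.piFinset fun _ : Fin (2 * k + 1) => F with hZ
  have hcard : Z.card = F.card ^ (2 * k + 1) := by simp [hZ]
  -- Exchangeability: swapping position t with the last one is a bijection of the tuples.
  have hsymm : ∀ t, (Z.filter fun z => ¬ BoundedComb (a ∘ z) t).card
      = (Z.filter fun z => ¬ BoundedComb (a ∘ z) (Fin.last (2 * k))).card := by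
    intro t
    let σ : Equiv.Perm (Fin (2 * k + 1)) := Equiv.swap t (Fin.last (2 * k))
    refine Finset.card_bij' (fun z _ => z ∘ σ) (fun z _ => z ∘ σ) ?_ ?_ ?_ ?_
    · intro z hz
      simp only [Finset.mem_filter, hZ, Fintype.mem_piFinset] at hz ⊢
      refine ⟨fun i => hz.1 _, ?_⟩
      rw [← Function.comp_assoc, boundedComb_comp_perm]
      simpa [σ] using hz.2
    · intro z hz
      simp only [Finset.mem_filter, hZ, Fintype.mem_piFinset] at hz ⊢
      refine ⟨fun i => hz.1 _, ?_⟩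
      rw [← Function.comp_assoc, boundedComb_comp_perm]
      simpa [σ] using hz.2
    · intro z _; ext i; simp [σ]
    · intro z _; ext i; simp [σ]
  -- Double counting of pairs of a tuple and an exceptional position, of which each tuple has at
  -- most k; by symmetry the left side is 2k+1 times the count for the last position.
  have hle : ∑ t, (Z.filter fun z => ¬ BoundedComb (a ∘ z) t).card ≤ Z.card * k := by
    simp only [Finset.card_filter]
    rw [Finset.sum_comm]
    refine Finset.sum_le_card_nsmul _ _ _ fun z _ => ?_
    rw [← Finset.card_filter]
    obtain ⟨Q, hQ, hQ'⟩ := exists_card_le_boundedComb (a ∘ z) (hk z)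
    refine (Finset.card_le_card fun t ht => ?_).trans hQ
    by_contra htQ
    exact (Finset.mem_filter.1 ht).2 (hQ' t htQ)
  simp only [hsymm, Finset.sum_const, Finset.card_univ, Fintype.card_fin, smul_eq_mul] at hle
  rw [← hcard]
  by_contra! hlt
  nlinarith

/-! ### Random tuples of columns -/

open Classical in
/-- The event that the last column of a tuple is a bounded combination of the others and that the
weight of the tuple is at most ten times the average of the weight above rank `t`. -/
theorem card_bad_tuple_le {α V : Type*} [DecidableEq α] [AddCommGroup V] [Module ℝ V]
    (a : α → V) (F : Finset α) {k : ℕ}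
    (hk : ∀ z : Fin (2 * k + 1) → α,
      Module.finrank ℝ (Submodule.span ℝ (Set.range (a ∘ z))) ≤ k)
    (w : α → ℝ) (hw : ∀ l, 0 ≤ w l) (H : Finset α)
    (hH : 10 * ((2 * k + 1) * (F.filter (· ∈ H)).card) ≤ F.card) :
    10 * ((Fintype.piFinset fun _ : Fin (2 * k + 1) => F).filter
      fun z => ¬ (BoundedComb (a ∘ z) (Fin.last (2 * k)) ∧
        F.card * ∑ j, w (z j) ≤ 10 * (2 * k + 1) * ∑ l ∈ F with l ∉ H, w l)).card
      ≤ 7 * F.card ^ (2 * k + 1) := by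
  set Z := Fintype.piFinset fun _ : Fin (2 * k + 1) => F with hZ
  set m := F.card with hm
  set tail := ∑ l ∈ F with l ∉ H, w l with htail
  have htail0 : 0 ≤ tail := Finset.sum_nonneg fun l _ => hw l
  have h1 := card_not_boundedComb_le a F hk
  rw [← hZ, ← hm] at h1
  -- Union bound over the 2k+1 positions, each of which hits `H` with probability |F ∩ H|/m.
  have h2 : 10 * (Z.filter fun z => ∃ j, z j ∈ H).card ≤ m ^ (2 * k + 1) := by
    have hle : (Z.filter fun z => ∃ j, z j ∈ H).card
        ≤ ∑ j : Fin (2 * k + 1), ∑ z ∈ Z, (if z j ∈ H then 1 else 0) := by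
      rw [Finset.sum_comm, Finset.card_filter]
      refine Finset.sum_le_sum fun z _ => ?_
      split_ifs with h
      · obtain ⟨j, hj⟩ := h
        refine le_trans (by simp [hj]) (Finset.single_le_sum
          (f := fun j => if z j ∈ H then 1 else 0) (fun _ _ => Nat.zero_le _) (Finset.mem_univ j))
      · exact Nat.zero_le _
    have heq : ∀ j : Fin (2 * k + 1), ∑ z ∈ Z, (if z j ∈ H then 1 else 0)
        = m ^ (2 * k) * (F.filter (· ∈ H)).card := by
      intro j
      rw [hZ, Fintype.sum_piFinset_apply (fun l => if l ∈ H then 1 else 0) F j]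
      simp only [Fintype.card_fin, add_tsub_cancel_right, smul_eq_mul, Finset.card_filter, hm]
    simp only [heq, Finset.sum_const, Finset.card_univ, Fintype.card_fin, smul_eq_mul] at hle
    calc _ ≤ 10 * ((2 * k + 1) * (m ^ (2 * k) * (F.filter (· ∈ H)).card)) := by omega
      _ = m ^ (2 * k) * (10 * ((2 * k + 1) * (F.filter (· ∈ H)).card)) := by ring
      _ ≤ m ^ (2 * k) * m := Nat.mul_le_mul_left _ hH
      _ = _ := (pow_succ _ _).symm
  -- Markov's inequality for the weight set to 0 on `H`, whose mean over a tuple is (2k+1)·tail/m.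
  have h3 : 10 * (Z.filter fun z => (∀ j, z j ∉ H) ∧
      10 * (2 * k + 1) * tail < m * ∑ j, w (z j)).card ≤ m ^ (2 * k + 1) := by
    set Y := Z.filter fun z => (∀ j, z j ∉ H) ∧ 10 * (2 * k + 1) * tail < m * ∑ j, w (z j)
      with hY
    let w' : α → ℝ := fun l => if l ∉ H then w l else 0
    have hw' : ∀ l, 0 ≤ w' l := fun l => by dsimp only [w']; split_ifs <;> simp [hw l]
    have hsum : ∑ z ∈ Z, ∑ j, w' (z j) = (2 * k + 1) * (m ^ (2 * k) * tail) := by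
      rw [Finset.sum_comm]
      have : ∀ j : Fin (2 * k + 1), ∑ z ∈ Z, w' (z j) = m ^ (2 * k) * tail := by
        intro j
        rw [hZ, Fintype.sum_piFinset_apply w' F j, htail, Finset.sum_filter]
        simp [w', hm]
      simp [this]
    have hYw : ∀ z ∈ Y, ∑ j, w (z j) = ∑ j, w' (z j) := by
      intro z hz
      refine Finset.sum_congr rfl fun j _ => ?_
      simp [w', (Finset.mem_filter.1 hz).2.1 j]
    -- Markov's inequality divides by the mean. If the tail is 0, every tuple that avoids `H` has
    -- weight 0 and the strict inequality is impossible.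
    rcases htail0.eq_or_lt with h0 | h0
    · have : Y = ∅ := by
        refine Finset.eq_empty_of_forall_notMem fun z hz => ?_
        have hz2 := (Finset.mem_filter.1 hz).2.2
        have hsz : ∑ j, w' (z j) ≤ ∑ z ∈ Z, ∑ j, w' (z j) :=
          Finset.single_le_sum (f := fun z => ∑ j, w' (z j))
            (fun z _ => Finset.sum_nonneg fun j _ => hw' _) (Finset.mem_filter.1 hz).1
        rw [hsum, ← h0, mul_zero, mul_zero, ← hYw z hz] at hsz
        rw [← h0, mul_zero] at hz2
        exact absurd hz2 (not_lt.2 (mul_nonpos_of_nonneg_of_nonpos (Nat.cast_nonneg _) hsz))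
      simp [this]
    · have hle : (Y.card : ℝ) * (10 * (2 * k + 1) * tail)
          ≤ m * ((2 * k + 1) * (m ^ (2 * k) * tail)) := by
        rw [← hsum, ← nsmul_eq_mul]
        have hmul : (m : ℝ) * ∑ z ∈ Z, ∑ j, w' (z j) = ∑ z ∈ Z, m * ∑ j, w' (z j) :=
          Finset.mul_sum _ _ _
        rw [hmul]
        refine (Finset.card_nsmul_le_sum Y (fun z => m * ∑ j, w' (z j)) _ fun z hz => ?_).trans
          (Finset.sum_le_sum_of_subset_of_nonneg (Finset.filter_subset _ _) fun z _ _ =>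
            mul_nonneg (Nat.cast_nonneg _) (Finset.sum_nonneg fun j _ => hw' _))
        rw [← hYw z hz]
        exact (Finset.mem_filter.1 hz).2.2.le
      have hpos : (0 : ℝ) < (2 * k + 1) * tail := by positivity
      have : (10 * (Y.card : ℝ)) * ((2 * k + 1) * tail) ≤ m ^ (2 * k + 1) * ((2 * k + 1) * tail) := by
        rw [pow_succ]; linarith
      exact_mod_cast le_of_mul_le_mul_right this hpos
  have hsub : (Z.filter fun z => ¬ (BoundedComb (a ∘ z) (Fin.last (2 * k)) ∧
        m * ∑ j, w (z j) ≤ 10 * (2 * k + 1) * tail))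
      ⊆ (Z.filter fun z => ¬ BoundedComb (a ∘ z) (Fin.last (2 * k))) ∪
        ((Z.filter fun z => ∃ j, z j ∈ H) ∪
        (Z.filter fun z => (∀ j, z j ∉ H) ∧ 10 * (2 * k + 1) * tail < m * ∑ j, w (z j))) := by
    intro z hz
    simp only [Finset.mem_union, Finset.mem_filter] at hz ⊢
    by_cases hc : BoundedComb (a ∘ z) (Fin.last (2 * k))
    · by_cases hj : ∃ j, z j ∈ H
      · exact Or.inr (Or.inl ⟨hz.1, hj⟩)
      · exact Or.inr (Or.inr ⟨hz.1, not_exists.1 hj, not_le.1 fun h => hz.2 ⟨hc, h⟩⟩)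
    · exact Or.inl ⟨hz.1, hc⟩
  -- The three events have probabilities at most 1/2, 1/10 and 1/10.
  have h4 := (Finset.card_le_card hsub).trans ((Finset.card_union_le _ _).trans
    (Nat.add_le_add_left (Finset.card_union_le _ _) _))
  omega

/-- Few elements have a value of low rank. -/
theorem card_low_rank_le {α : Type*} (F : Finset α) (v : α → ℝ) :
    20 * (F.filter fun l => 19 * F.card < 20 * (F.filter fun l' => v l < v l').card).card
      ≤ F.card := by
  set Z := F.filter fun l => 19 * F.card < 20 * (F.filter fun l' => v l < v l').card with hZ
  rcases Z.eq_empty_or_nonempty with h | h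
  · simp [h]
  -- All of Z lies weakly below its largest member, and membership of that element in Z says that
  -- fewer than |F|/20 elements do.
  · obtain ⟨l, hl, hmax⟩ := Z.exists_max_image v h
    have h1 := (Finset.mem_filter.1 hl).2
    have h2 : Z.card ≤ (F.filter fun l' => ¬ v l < v l').card :=
      Finset.card_le_card fun l' hl' =>
        Finset.mem_filter.2 ⟨(Finset.mem_filter.1 hl').1, not_lt.2 (hmax l' hl')⟩
    have h3 := Finset.card_filter_add_card_filter_not (s := F) fun l' => v l < v l'
    omega

/-! ### Tails of the sorted column losses -/

/-- Exchange argument: members of `G` outside the window lie at or beyond t + m, where f is at most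
f (t + m); at least as many places of the window are unused, and there f is at least f (t + m). -/
theorem sum_le_sum_Ico_of_antitone {f : ℕ → ℝ} (hf : Antitone f) (hf0 : ∀ i, 0 ≤ f i)
    {G : Finset ℕ} {t m : ℕ} (hG : ∀ i ∈ G, t ≤ i) (hm : G.card ≤ m) :
    ∑ i ∈ G, f i ≤ ∑ i ∈ Finset.Ico t (t + m), f i := by
  set I := Finset.Ico t (t + m) with hI
  have h1 : ∑ i ∈ G \ I, f i ≤ (G \ I).card • f (t + m) := by
    refine Finset.sum_le_card_nsmul _ _ _ fun i hi => hf ?_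
    rw [Finset.mem_sdiff, hI, Finset.mem_Ico] at hi
    have := hG i hi.1
    omega
  have h2 : (I \ G).card • f (t + m) ≤ ∑ i ∈ I \ G, f i := by
    refine Finset.card_nsmul_le_sum _ _ _ fun i hi => hf ?_
    rw [Finset.mem_sdiff, hI, Finset.mem_Ico] at hi
    omega
  have h3 : (G \ I).card ≤ (I \ G).card := by
    have ha := Finset.card_sdiff_add_card_inter G I
    have hb := Finset.card_sdiff_add_card_inter I G
    rw [Finset.inter_comm] at hb
    have hc : I.card = m := by simp [hI]
    omega
  have h4 : (G \ I).card • f (t + m) ≤ (I \ G).card • f (t + m) :=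
    nsmul_le_nsmul_left (hf0 _) h3
  have h5 := Finset.sum_inter_add_sum_sdiff G I f
  have h6 := Finset.sum_inter_add_sum_sdiff I G f
  rw [Finset.inter_comm] at h6
  linarith

/-- In a geometrically decreasing sequence few terms lie in a given range. -/
theorem card_geometric_le {m : ℕ → ℕ} {R N a q : ℕ} (hm : ∀ r, r + 1 < R → 20 * m (r + 1) ≤ 19 * m r)
    (hN : 2 * q * 19 ^ N ≤ 20 ^ N) :
    ((Finset.range R).filter fun r => a ≤ 2 * m r ∧ m r < q * a).card ≤ N := by
  set Z := (Finset.range R).filter fun r => a ≤ 2 * m r ∧ m r < q * a with hZ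
  rcases Z.eq_empty_or_nonempty with h | h
  · simp [h]
  obtain ⟨r₀, hr₀, hmin⟩ := Z.exists_min_image id h
  have hdec : ∀ i, r₀ + i < R → 20 ^ i * m (r₀ + i) ≤ 19 ^ i * m r₀ := by
    intro i
    induction i with
    | zero => simp
    | succ i ih =>
      intro hi
      have h1 := ih (by omega)
      have h2 := hm (r₀ + i) (by omega)
      rw [← add_assoc]
      calc 20 ^ (i + 1) * m (r₀ + i + 1) = 20 ^ i * (20 * m (r₀ + i + 1)) := by ring
        _ ≤ 20 ^ i * (19 * m (r₀ + i)) := Nat.mul_le_mul_left _ h2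
        _ = 19 * (20 ^ i * m (r₀ + i)) := by ring
        _ ≤ 19 * (19 ^ i * m r₀) := Nat.mul_le_mul_left _ h1
        _ = _ := by ring
  -- At the first index of Z the size is below q a; N steps shrink it by the factor 2q, to below
  -- a/2, so Z fits into N consecutive indices.
  have hsub : Z ⊆ Finset.Ico r₀ (r₀ + N) := by
    intro r hr
    have hle : r₀ ≤ r := hmin r hr
    obtain ⟨hrR, hra, -⟩ := Finset.mem_filter.1 hr
    obtain ⟨-, -, hrq⟩ := Finset.mem_filter.1 hr₀
    rw [Finset.mem_Ico]
    refine ⟨hle, ?_⟩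
    by_contra! hge
    obtain ⟨i, rfl⟩ := Nat.exists_eq_add_of_le hle
    obtain ⟨p, rfl⟩ := Nat.exists_eq_add_of_le (show N ≤ i by omega)
    have h1 := hdec (N + p) (Finset.mem_range.1 hrR)
    have h2 : 2 * q * 19 ^ (N + p) ≤ 20 ^ (N + p) := by
      rw [pow_add, pow_add, ← mul_assoc]
      exact Nat.mul_le_mul hN (Nat.pow_le_pow_left (by norm_num) p)
    have h3 : 20 ^ (N + p) * a < 20 ^ (N + p) * a := by
      calc 20 ^ (N + p) * a ≤ 20 ^ (N + p) * (2 * m (r₀ + (N + p))) := Nat.mul_le_mul_left _ hra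
        _ = 2 * (20 ^ (N + p) * m (r₀ + (N + p))) := by ring
        _ ≤ 2 * (19 ^ (N + p) * m r₀) := Nat.mul_le_mul_left _ h1
        _ < 2 * (19 ^ (N + p) * (q * a)) := by
            have : 0 < 19 ^ (N + p) := by positivity
            have := Nat.mul_lt_mul_of_pos_left hrq this
            omega
        _ = (2 * q * 19 ^ (N + p)) * a := by ring
        _ ≤ 20 ^ (N + p) * a := Nat.mul_le_mul_right _ h2
    exact lt_irrefl _ h3
  simpa using Finset.card_le_card hsub

/-- The sum of the values of rank at least `m / q` among the first `2 m`, over a geometrically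
decreasing sequence of sizes `m`. -/
theorem sum_tails_le {f : ℕ → ℝ} {n : ℕ} (hf0 : ∀ i, 0 ≤ f i) (hfn : ∀ i, n ≤ i → f i = 0)
    {m : ℕ → ℕ} {R N q : ℕ} (hm : ∀ r, r + 1 < R → 20 * m (r + 1) ≤ 19 * m r) (hq : 0 < q)
    (hN : 2 * q * 19 ^ N ≤ 20 ^ N) :
    ∑ r ∈ Finset.range R, ∑ i ∈ Finset.Ico (m r / q) (m r / q + m r), f i
      ≤ N * ∑ i ∈ Finset.range n, f i := by
  -- An index i of the r-th window satisfies the condition of `card_geometric_le` with a = i + 1.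
  -- Indices from n on are dropped because f vanishes there.
  have h1 : ∀ r, ∑ i ∈ Finset.Ico (m r / q) (m r / q + m r), f i
      ≤ ∑ i ∈ Finset.range n, if i + 1 ≤ 2 * m r ∧ m r < q * (i + 1) then f i else 0 := by
    intro r
    rw [← Finset.sum_filter, ← Finset.sum_filter_ne_zero]
    refine Finset.sum_le_sum_of_subset_of_nonneg (fun i hi => ?_) fun i _ _ => hf0 i
    obtain ⟨hi, hne⟩ := Finset.mem_filter.1 hi
    rw [Finset.mem_Ico] at hi
    rw [Finset.mem_filter, Finset.mem_range]
    refine ⟨not_le.1 fun h => hne (hfn i h), ?_, ?_⟩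
    · have := Nat.div_le_self (m r) q
      omega
    · rw [mul_comm]
      exact (Nat.div_lt_iff_lt_mul hq).1 (by omega)
  refine (Finset.sum_le_sum fun r _ => h1 r).trans ?_
  rw [Finset.sum_comm, Finset.mul_sum]
  refine Finset.sum_le_sum fun i _ => ?_
  rw [← Finset.sum_filter, Finset.sum_const, nsmul_eq_mul]
  exact mul_le_mul_of_nonneg_right
    (Nat.cast_le.2 (card_geometric_le hm hN)) (hf0 i)

/-- The values of a nonnegative function on `Fin n` in decreasing order. -/
theorem exists_sorted_values {n : ℕ} (w : Fin n → ℝ) (hw : ∀ l, 0 ≤ w l) :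
    ∃ (rk : Fin n → ℕ) (f : ℕ → ℝ), Function.Injective rk ∧ Antitone f ∧ (∀ i, 0 ≤ f i) ∧
      (∀ i, n ≤ i → f i = 0) ∧ (∀ l, f (rk l) = w l) ∧ ∑ i ∈ Finset.range n, f i = ∑ l, w l := by
  let σ := Tuple.sort fun l => - w l
  have hσ : Monotone ((fun l => - w l) ∘ σ) := Tuple.monotone_sort _
  let f : ℕ → ℝ := fun i => if h : i < n then w (σ ⟨i, h⟩) else 0
  refine ⟨fun l => (σ.symm l).val, f, fun l l' h => σ.symm.injective (Fin.ext h), ?_, ?_, ?_, ?_, ?_⟩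
  · intro i j hij
    dsimp only [f]
    by_cases hj : j < n
    · rw [dif_pos hj, dif_pos (hij.trans_lt hj)]
      have := hσ (show (⟨i, hij.trans_lt hj⟩ : Fin n) ≤ ⟨j, hj⟩ from hij)
      simpa using this
    · rw [dif_neg hj]
      split_ifs
      exacts [hw _, le_rfl]
  · intro i
    dsimp only [f]
    split_ifs
    exacts [hw _, le_rfl]
  · intro i hi
    exact dif_neg (not_lt.2 hi)
  · intro l
    simp [f]
  · rw [Finset.sum_range, ← Equiv.sum_comp σ w]
    exact Finset.sum_congr rfl fun i _ => by simp [f]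

/-! ### Straight-line code -/

theorem andThen_pure (s : State) (f : State → PMF (Option State)) :
    andThen (PMF.pure (some s)) f = f s := by
  simp [andThen, PMF.pure_bind]

/-- The multiple `c * e` of an expression. -/
def NExp.times : ℕ → NExp → NExp
  | 0, _ => .const 0
  | c + 1, e => .add (NExp.times c e) e

theorem NExp.eval_times (s : State) (c : ℕ) (e : NExp) : (NExp.times c e).eval s = c * e.eval s := by
  induction c with
  | zero => simp [NExp.times, NExp.eval]
  | succ c ih => simp [NExp.times, NExp.eval, ih, add_mul]

theorem NExp.cost_times (c : ℕ) (e : NExp) : (NExp.times c e).cost = c * (e.cost + 1) + 1 := by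
  induction c with
  | zero => simp [NExp.times, NExp.cost]
  | succ c ih => simp only [NExp.times, NExp.cost, ih]; ring

/-! ### Lists of indices -/

/-- The first `m` entries of an array list the finite set `F` without repetition. -/
def Lists (arr : ℕ → ℕ) (m : ℕ) (F : Finset ℕ) : Prop :=
  Set.InjOn arr (Finset.range m) ∧ (Finset.range m).image arr = F

theorem Lists.card {arr : ℕ → ℕ} {m : ℕ} {F : Finset ℕ} (h : Lists arr m F) : F.card = m := by
  rw [← h.2, Finset.card_image_of_injOn h.1, Finset.card_range]

theorem Lists.sum {M : Type*} [AddCommMonoid M] {arr : ℕ → ℕ} {m : ℕ} {F : Finset ℕ}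
    (h : Lists arr m F) (f : ℕ → M) : ∑ i ∈ Finset.range m, f (arr i) = ∑ l ∈ F, f l := by
  rw [← h.2, Finset.sum_image h.1]

theorem Lists.mem {arr : ℕ → ℕ} {m : ℕ} {F : Finset ℕ} (h : Lists arr m F) {i : ℕ} (hi : i < m) :
    arr i ∈ F := by
  rw [← h.2]
  exact Finset.mem_image_of_mem _ (Finset.mem_range.2 hi)

theorem Lists.congr {arr arr' : ℕ → ℕ} {m : ℕ} {F : Finset ℕ} (h : Lists arr m F)
    (h' : ∀ i < m, arr' i = arr i) : Lists arr' m F := by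
  constructor
  · intro i hi j hj hij
    rw [h' i (by simpa using hi), h' j (by simpa using hj)] at hij
    exact h.1 hi hj hij
  · rw [← h.2]
    exact Finset.image_congr fun i hi => h' i (by simpa using hi)

theorem Lists.snoc {arr : ℕ → ℕ} {m : ℕ} {F : Finset ℕ} (h : Lists arr m F) {l : ℕ} (hl : l ∉ F) :
    Lists (Function.update arr m l) (m + 1) (insert l F) := by
  have hne : ∀ i < m, arr i ≠ l := fun i hi e => hl (e ▸ h.mem hi)
  constructor
  · intro i hi j hj hij
    simp only [Finset.coe_range, Set.mem_Iio] at hi hj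
    rcases Nat.lt_succ_iff_lt_or_eq.1 hi with hi | rfl <;>
    rcases Nat.lt_succ_iff_lt_or_eq.1 hj with hj | rfl
    · rw [Function.update_of_ne hi.ne, Function.update_of_ne hj.ne] at hij
      exact h.1 (by simpa using hi) (by simpa using hj) hij
    · rw [Function.update_of_ne hi.ne, Function.update_self] at hij
      exact absurd hij (hne i hi)
    · rw [Function.update_of_ne hj.ne, Function.update_self] at hij
      exact absurd hij.symm (hne j hj)
    · rfl
  · rw [Finset.range_add_one, Finset.image_insert, Function.update_self, ← h.2]
    congr 1
    exact Finset.image_congr fun i hi => Function.update_of_ne (by simp at hi; omega) _ _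

/-! ### Filling an array -/

/-- Write the values of `val`, which may refer to the counter in register `8`, to consecutive
positions of an array; the registers `o` and `len` hold the first position and the length. -/
def fillProg (dst o len : ℕ) (val : NExp) : Prog :=
  .seq (.setN 8 (.const 0))
    (.while (.nle (.add (.reg 8) (.const 1)) (.reg len))
      (.seq (.putN dst (.add (.reg o) (.reg 8)) val) (.setN 8 (.add (.reg 8) (.const 1)))))

section

variable {n d m' : ℕ} (A : Matrix (Fin n) (Fin n) ℝ) (R : RegressionAlg n d m')

/-- By `hv`, the value written may depend only on the counter and on arrays other than `dst`; hence
the writes do not disturb later values. -/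
theorem surely_fillProg {dst o len : ℕ} {val : NExp} {fuel : ℕ} (s : State) (ho : o ≠ 8)
    (hlen : len ≠ 8) (v : ℕ → ℕ)
    (hv : ∀ s' : State, (∀ a, a ≠ dst → s'.narr a = s.narr a) → val.eval s' = v (s'.nreg 8))
    (hfuel : s.nreg len < fuel) :
    Surely (run A R fuel (fillProg dst o len val) s) fun s' =>
      (∀ x, x ≠ 8 → s'.nreg x = s.nreg x) ∧ s'.rreg = s.rreg ∧ s'.rarr = s.rarr ∧
      (∀ a, a ≠ dst → s'.narr a = s.narr a) ∧
      (∀ a < s.nreg len, s'.narr dst (s.nreg o + a) = v a) ∧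
      (∀ a, a < s.nreg o ∨ s.nreg o + s.nreg len ≤ a → s'.narr dst a = s.narr dst a) ∧
      s'.time ≤ s.time + 7 + (13 + val.cost) * s.nreg len := by
  rw [fillProg, run, run, andThen_pure, run]
  refine surely_runLoop (s.nreg len) (fun j s' =>
    s'.nreg 8 = j ∧ j ≤ s.nreg len ∧ (∀ x, x ≠ 8 → s'.nreg x = s.nreg x) ∧
      s'.rreg = s.rreg ∧ s'.rarr = s.rarr ∧
      (∀ a, a ≠ dst → s'.narr a = s.narr a) ∧
      (∀ a < j, s'.narr dst (s.nreg o + a) = v a) ∧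
      (∀ a, a < s.nreg o ∨ s.nreg o + j ≤ a → s'.narr dst a = s.narr dst a) ∧
      s'.time ≤ s.time + 2 + (13 + val.cost) * j) ?_ ?_ hfuel ?_
  · rintro j s' ⟨h8, hj, hn, hr, hra, hna, hd, hd', ht⟩ hb
    simp only [Test.Holds, NExp.eval, h8, hn len hlen] at hb
    obtain rfl : j = s.nreg len := by omega
    refine ⟨hn, hr, hra, hna, hd, hd', ?_⟩
    simp only [State.tick, Test.cost, NExp.cost]
    omega
  · rintro j s' ⟨h8, hj, hn, hr, hra, hna, hd, hd', ht⟩ hb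
    simp only [Test.Holds, NExp.eval, h8, hn len hlen] at hb
    refine ⟨by omega, ?_⟩
    simp only [run, andThen_pure]
    have hval : val.eval (s'.tick (Test.nle (.add (.reg 8) (.const 1)) (.reg len)).cost) = v j :=
      (hv (s'.tick _) hna).trans (congrArg v h8)
    refine surely_pure ⟨?_, by omega, ?_, hr, hra, ?_, ?_, ?_, ?_⟩
    · simp [State.tick, State.setN, State.putN, NExp.eval, h8]
    · intro x hx
      simp [State.tick, State.setN, State.putN, Function.update_of_ne hx, hn x hx]
    · intro a ha
      simp [State.tick, State.setN, State.putN, Function.update_of_ne ha, hna a ha]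
    · intro a ha
      rw [hval]
      simp only [State.tick, State.setN, State.putN, NExp.eval, Function.update_self, h8, hn o ho]
      rcases Nat.lt_succ_iff_lt_or_eq.1 ha with ha | rfl
      · rw [Function.update_of_ne (by omega), hd a ha]
      · rw [Function.update_self]
    · intro a ha
      simp only [State.tick, State.setN, State.putN, NExp.eval, Function.update_self, h8, hn o ho]
      rw [Function.update_of_ne (by omega), hd' a (by omega)]
    · simp only [State.tick, State.setN, State.putN, NExp.cost, Test.cost]
      rw [Nat.mul_succ]
      omega
  · refine ⟨?_, Nat.zero_le _, ?_, rfl, rfl, fun _ _ => rfl, fun a ha => absurd ha (Nat.not_lt_zero a),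
      fun _ _ => rfl, ?_⟩
    · simp [State.tick, State.setN, NExp.eval]
    · intro x hx
      simp [State.tick, State.setN, Function.update_of_ne hx]
    · simp [State.tick, State.setN, NExp.cost]

/-! ### Sampling with replacement -/

/-- The average of `Ψ` over the arrays obtained by writing independent uniform samples of `F` to the
`r` positions that start at `i`. -/
def sampleAverage (F : Finset ℕ) (Ψ : (ℕ → ℕ) → ℝ≥0∞) : ℕ → ℕ → (ℕ → ℕ) → ℝ≥0∞
  | 0, _, P => Ψ P
  | r + 1, i, P =>
    (∑ l ∈ F, sampleAverage F Ψ r (i + 1) (Function.update P i l)) / (F.card : ℝ≥0∞)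

/-- Overwrite the `r` positions of an array that start at `i`. -/
def overlay {r : ℕ} (i : ℕ) (u : Fin r → ℕ) (P : ℕ → ℕ) : ℕ → ℕ := fun a =>
  if h : i ≤ a ∧ a < i + r then u ⟨a - i, by omega⟩ else P a

theorem overlay_cons {r : ℕ} (i l : ℕ) (u : Fin r → ℕ) (P : ℕ → ℕ) :
    overlay i (Fin.cons l u : Fin (r + 1) → ℕ) P = overlay (i + 1) u (Function.update P i l) := by
  funext a
  unfold overlay
  by_cases h1 : i + 1 ≤ a ∧ a < i + 1 + r
  · rw [dif_pos h1, dif_pos (by omega)]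
    have : (⟨a - i, by omega⟩ : Fin (r + 1)) = Fin.succ ⟨a - (i + 1), by omega⟩ :=
      Fin.ext (by simp; omega)
    rw [this, Fin.cons_succ]
  · rw [dif_neg h1]
    by_cases h2 : a = i
    · subst h2
      rw [dif_pos (by omega), Function.update_self]
      have : (⟨a - a, by omega⟩ : Fin (r + 1)) = 0 := Fin.ext (by simp)
      rw [this, Fin.cons_zero]
    · rw [dif_neg (by omega), Function.update_of_ne h2]

/-- Successive averages become one average over all tuples, so that the counting lemmas for tuples
apply. -/
theorem sampleAverage_eq (F : Finset ℕ) (Ψ : (ℕ → ℕ) → ℝ≥0∞) (r i : ℕ) (P : ℕ → ℕ) :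
    sampleAverage F Ψ r i P
      = (∑ u ∈ Fintype.piFinset fun _ : Fin r => F, Ψ (overlay i u P)) / (F.card : ℝ≥0∞) ^ r := by
  induction r generalizing i P with
  | zero =>
    have h : ∀ u : Fin 0 → ℕ, overlay i u P = P := fun u => by
      funext a
      exact dif_neg (by omega)
    simp [sampleAverage, h]
  | succ r ih =>
    have h : ∑ u ∈ Fintype.piFinset fun _ : Fin (r + 1) => F, Ψ (overlay i u P)
        = ∑ l ∈ F, ∑ u ∈ Fintype.piFinset fun _ : Fin r => F,
            Ψ (overlay (i + 1) u (Function.update P i l)) := by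
      rw [← Finset.sum_product' F (Fintype.piFinset fun _ : Fin r => F)
        fun l u => Ψ (overlay (i + 1) u (Function.update P i l))]
      symm
      refine Finset.sum_bij' (fun p _ => (Fin.cons p.1 p.2 : Fin (r + 1) → ℕ))
        (fun u _ => (u 0, Fin.tail u)) ?_ ?_ ?_ ?_ ?_
      · rintro ⟨l, u⟩ hp
        simp only [Finset.mem_product, Fintype.mem_piFinset] at hp ⊢
        exact Fin.cases hp.1 hp.2
      · intro u hu
        simp only [Finset.mem_product, Fintype.mem_piFinset] at hu ⊢
        exact ⟨hu 0, fun j => hu _⟩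
      · rintro ⟨l, u⟩ _
        simp
      · intro u _
        simp
      · rintro ⟨l, u⟩ _
        rw [overlay_cons]
    rw [sampleAverage, h]
    simp only [ih, ENNReal.div_eq_inv_mul, ← Finset.mul_sum, ← mul_assoc]
    congr 1
    rw [pow_succ', ENNReal.mul_inv (Or.inr (by finiteness)) (Or.inl (by finiteness))]

/-- Write to the array `3` as many independent uniform samples of the list in the array `1` as
register `13` says. -/
def sampleProg : Prog :=
  .seq (.setN 8 (.const 0))
    (.while (.nle (.add (.reg 8) (.const 1)) (.reg 13))
      (.seq (.rand 9 (.sub (.reg 5) (.const 1)))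
        (.seq (.putN 3 (.reg 8) (.get 1 (.reg 9))) (.setN 8 (.add (.reg 8) (.const 1))))))

theorem expect_sampleProg_le {fuel : ℕ} (s : State) {F : Finset ℕ} (hF : Lists (s.narr 1) (s.nreg 5) F)
    (hm : 1 ≤ s.nreg 5) (hfuel : s.nreg 13 < fuel) (Ψ : (ℕ → ℕ) → ℝ≥0∞) (φ : State → ℝ≥0∞)
    (hφ : ∀ s' : State, (∀ x, x ≠ 8 → x ≠ 9 → s'.nreg x = s.nreg x) → s'.rreg = s.rreg →
      s'.rarr = s.rarr → (∀ a, a ≠ 3 → s'.narr a = s.narr a) →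
      s'.time ≤ s.time + 7 + 18 * s.nreg 13 → φ s' ≤ Ψ (s'.narr 3)) :
    expect (run A R fuel sampleProg s) φ
      ≤ (∑ u ∈ Fintype.piFinset fun _ : Fin (s.nreg 13) => F, Ψ (overlay 0 u (s.narr 3)))
        / (F.card : ℝ≥0∞) ^ s.nreg 13 := by
  rw [sampleProg, run, run, andThen_pure, run, ← sampleAverage_eq]
  refine (expect_runLoop_le (s.nreg 13) (fun j s' =>
    s'.nreg 8 = j ∧ j ≤ s.nreg 13 ∧ (∀ x, x ≠ 8 → x ≠ 9 → s'.nreg x = s.nreg x) ∧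
      s'.rreg = s.rreg ∧ s'.rarr = s.rarr ∧ (∀ a, a ≠ 3 → s'.narr a = s.narr a) ∧
      s'.time ≤ s.time + 2 + 18 * j)
    (fun j s' => sampleAverage F Ψ (s.nreg 13 - j) j (s'.narr 3)) ?_ ?_ fuel 0 _ hfuel ?_
    (by omega)).trans (le_of_eq rfl)
  · rintro j s' ⟨h8, hj, hn, hr, hra, hna, ht⟩ hb
    simp only [Test.Holds, NExp.eval, h8, hn 13 (by decide) (by decide)] at hb
    obtain rfl : j = s.nreg 13 := by omega
    rw [Nat.sub_self, sampleAverage]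
    refine hφ _ hn hr hra hna ?_
    simp only [State.tick, Test.cost, NExp.cost]
    omega
  · rintro j s' ⟨h8, hj, hn, hr, hra, hna, ht⟩ hb
    simp only [Test.Holds, NExp.eval, h8, hn 13 (by decide) (by decide)] at hb
    refine ⟨by omega, ?_⟩
    obtain ⟨r, hr'⟩ : ∃ r, s.nreg 13 - j = r + 1 := ⟨s.nreg 13 - j - 1, by omega⟩
    simp only [run, andThen_pure]
    rw [expect_andThen, expect_uniform, hr', sampleAverage]
    have h5 : (NExp.sub (.reg 5) (.const 1)).eval
        (s'.tick (Test.nle (.add (.reg 8) (.const 1)) (.reg 13)).cost) + 1 = s.nreg 5 := by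
      simp only [NExp.eval, State.tick, hn 5 (by decide) (by decide)]
      omega
    rw [h5, hF.card, ← hF.sum]
    refine ENNReal.div_le_div_right (Finset.sum_le_sum fun x _ => ?_) _
    rw [expect_pure, guarded_of]
    · rw [show s.nreg 13 - (j + 1) = r by omega]
      simp [State.tick, State.setN, State.putN, NExp.eval, h8, hna 1 (by decide)]
    · refine ⟨?_, by omega, ?_, hr, hra, ?_, ?_⟩
      · simp [State.tick, State.setN, State.putN, NExp.eval, h8]
      · intro x h8 h9
        simp [State.tick, State.setN, State.putN, h8, h9, hn x h8 h9]
      · intro a ha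
        simp [State.tick, State.setN, State.putN, ha, hna a ha]
      · simp only [State.tick, State.setN, State.putN, NExp.cost, Test.cost]
        omega
  · refine ⟨?_, Nat.zero_le _, ?_, rfl, rfl, fun _ _ => rfl, ?_⟩
    · simp [State.tick, State.setN, NExp.eval]
    · intro x h8 h9
      simp [State.tick, State.setN, h8]
    · simp [State.tick, State.setN, NExp.cost]

/-! ### Selecting the columns of high cost -/

/-- List in the array `4` the members of the list in the array `1` whose value in the real array `1`
exceeds the real register `2`. -/
def filterProg : Prog :=
  .seq (.setN 10 (.const 0)) (.seq (.setN 8 (.const 0))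
    (.while (.nle (.add (.reg 8) (.const 1)) (.reg 5))
      (.seq
        (.ite (.rle (.get 1 (.get 1 (.reg 8))) (.reg 2)) .skip
          (.seq (.putN 4 (.reg 10) (.get 1 (.reg 8))) (.setN 10 (.add (.reg 10) (.const 1)))))
        (.setN 8 (.add (.reg 8) (.const 1))))))

theorem surely_filterProg {fuel : ℕ} (s : State) {F : Finset ℕ}
    (hF : Lists (s.narr 1) (s.nreg 5) F) (hfuel : s.nreg 5 < fuel) :
    Surely (run A R fuel filterProg s) fun s' =>
      (∀ x, x ≠ 8 → x ≠ 10 → s'.nreg x = s.nreg x) ∧ s'.rreg = s.rreg ∧ s'.rarr = s.rarr ∧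
      (∀ a, a ≠ 4 → s'.narr a = s.narr a) ∧
      Lists (s'.narr 4) (s'.nreg 10) (F.filter fun l => s.rreg 2 < s.rarr 1 l) ∧
      s'.time ≤ s.time + 9 + 24 * s.nreg 5 := by
  rw [filterProg]
  simp only [run, andThen_pure]
  refine surely_runLoop (s.nreg 5) (fun j s' =>
    s'.nreg 8 = j ∧ j ≤ s.nreg 5 ∧ (∀ x, x ≠ 8 → x ≠ 10 → s'.nreg x = s.nreg x) ∧
      s'.rreg = s.rreg ∧ s'.rarr = s.rarr ∧ (∀ a, a ≠ 4 → s'.narr a = s.narr a) ∧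
      Lists (s'.narr 4) (s'.nreg 10)
        (((Finset.range j).image (s.narr 1)).filter fun l => s.rreg 2 < s.rarr 1 l) ∧
      s'.time ≤ s.time + 4 + 24 * j) ?_ ?_ hfuel ?_
  · rintro j s' ⟨h8, hj, hn, hr, hra, hna, hl, ht⟩ hb
    simp only [Test.Holds, NExp.eval, h8, hn 5 (by decide) (by decide)] at hb
    obtain rfl : j = s.nreg 5 := by omega
    rw [hF.2] at hl
    refine ⟨hn, hr, hra, hna, hl, ?_⟩
    simp only [State.tick, Test.cost, NExp.cost]
    omega
  · rintro j s' ⟨h8, hj, hn, hr, hra, hna, hl, ht⟩ hb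
    simp only [Test.Holds, NExp.eval, h8, hn 5 (by decide) (by decide)] at hb
    refine ⟨by omega, ?_⟩
    have hins : (Finset.range (j + 1)).image (s.narr 1)
        = insert (s.narr 1 j) ((Finset.range j).image (s.narr 1)) := by
      rw [Finset.range_add_one, Finset.image_insert]
    split_ifs with hc
    · simp only [Test.Holds, RExp.eval, NExp.eval, State.tick, h8, hr, hra,
        hna 1 (by decide)] at hc
      rw [andThen_pure]
      refine surely_pure ⟨?_, by omega, ?_, hr, hra, hna, ?_, ?_⟩
      · simp [State.tick, State.setN, NExp.eval, h8]
      · intro x h8 h10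
        simp [State.tick, State.setN, h8, hn x h8 h10]
      · rw [hins, Finset.filter_insert, if_neg (not_lt.2 hc)]
        simpa [State.tick, State.setN] using hl
      · simp only [State.tick, State.setN, NExp.cost, RExp.cost, Test.cost]
        omega
    · simp only [Test.Holds, RExp.eval, NExp.eval, State.tick, h8, hr, hra,
        hna 1 (by decide)] at hc
      rw [andThen_pure]
      refine surely_pure ⟨?_, by omega, ?_, hr, hra, ?_, ?_, ?_⟩
      · simp [State.tick, State.setN, State.putN, NExp.eval, h8]
      · intro x h8 h10
        simp [State.tick, State.setN, State.putN, h8, h10, hn x h8 h10]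
      · intro a ha
        simp [State.tick, State.setN, State.putN, ha, hna a ha]
      · rw [hins, Finset.filter_insert, if_pos (not_le.1 hc)]
        suffices h : Lists (Function.update (s'.narr 4) (s'.nreg 10) (s.narr 1 j)) (s'.nreg 10 + 1)
            (insert (s.narr 1 j)
              (((Finset.range j).image (s.narr 1)).filter fun l => s.rreg 2 < s.rarr 1 l)) by
          simpa [State.tick, State.setN, State.putN, NExp.eval, h8, hna 1 (by decide)] using h
        refine hl.snoc fun hmem => ?_
        obtain ⟨i, hi, hij⟩ := Finset.mem_image.1 (Finset.mem_filter.1 hmem).1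
        have hi' := Finset.mem_range.1 hi
        have := hF.1 (by simp; omega) (by simp; omega) hij
        omega
      · simp only [State.tick, State.setN, State.putN, NExp.cost, RExp.cost, Test.cost]
        omega
  · refine ⟨?_, Nat.zero_le _, ?_, rfl, rfl, fun _ _ => rfl, ?_, ?_⟩
    · simp [State.tick, State.setN, NExp.eval]
    · intro x h8 h10
      simp [State.tick, State.setN, h8, h10]
    · simp [State.tick, State.setN, NExp.eval, Lists]
    · simp [State.tick, State.setN, NExp.cost]

end

/-! ### One trial -/

/-- Keep the list in the array `4` and the sample in the array `3` if they are the best so far. -/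
def acceptProg : Prog :=
  .ite (.nle (NExp.times 20 (.reg 10)) (NExp.times 19 (.reg 5)))
    (.ite (.rle (.mul (.reg 0) (.reg 2)) (.mul (.reg 0) (.reg 1)))
      (.seq (.setR 0 .one) (.seq (.setR 1 (.reg 2)) (.seq (.setN 11 (.reg 10))
        (.seq (fillProg 5 12 10 (.get 4 (.reg 8))) (fillProg 0 6 2 (.get 3 (.reg 8)))))))
      .skip)
    .skip

/-- Sample a design matrix, solve the regression problems, choose a random threshold among the
costs, and remove the columns whose costs do not exceed it. -/
def trialProg : Prog :=
  .seq sampleProg (.seq (.regress 3 2 0 1) (.seq (.rand 9 (.sub (.reg 5) (.const 1)))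
    (.seq (.setR 2 (.get 1 (.get 1 (.reg 9)))) (.seq filterProg
      (.seq acceptProg (.setN 7 (.add (.reg 7) (.const 1))))))))

/-- The test whether a list of `m₂` out of `m` columns, obtained with threshold `τ`, is to be kept,
when `ρ = 1` and `best` record an earlier threshold, or `ρ = 0`. -/
def Accepts (m₂ m : ℕ) (ρ τ best : ℝ) : Prop :=
  20 * m₂ ≤ 19 * m ∧ ρ * τ ≤ ρ * best

section

variable {n d m' : ℕ} (A : Matrix (Fin n) (Fin n) ℝ) (R : RegressionAlg n d m')

theorem surely_acceptProg {fuel : ℕ} (s : State) (h12 : s.nreg 12 = 0)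
    (h10 : s.nreg 10 < fuel) (h2 : s.nreg 2 < fuel) :
    Surely (run A R fuel acceptProg s) fun s' =>
      (∀ x, x ≠ 8 → x ≠ 11 → s'.nreg x = s.nreg x) ∧
      (∀ a, a ≠ 0 → a ≠ 5 → s'.narr a = s.narr a) ∧
      s'.time ≤ s.time + 108 + 15 * s.nreg 10 + 15 * s.nreg 2 ∧
      ((Accepts (s.nreg 10) (s.nreg 5) (s.rreg 0) (s.rreg 2) (s.rreg 1) ∧
        s'.rreg 0 = 1 ∧ s'.rreg 1 = s.rreg 2 ∧ s'.nreg 11 = s.nreg 10 ∧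
        (∀ a < s.nreg 10, s'.narr 5 a = s.narr 4 a) ∧
        (∀ a < s.nreg 2, s'.narr 0 (s.nreg 6 + a) = s.narr 3 a) ∧
        (∀ a, a < s.nreg 6 ∨ s.nreg 6 + s.nreg 2 ≤ a → s'.narr 0 a = s.narr 0 a)) ∨
      (¬ Accepts (s.nreg 10) (s.nreg 5) (s.rreg 0) (s.rreg 2) (s.rreg 1) ∧
        s'.rreg 0 = s.rreg 0 ∧ s'.rreg 1 = s.rreg 1 ∧ s'.nreg 11 = s.nreg 11 ∧
        s'.narr 5 = s.narr 5 ∧ s'.narr 0 = s.narr 0)) := by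
  rw [acceptProg, run]
  split_ifs with hb
  · simp only [Test.Holds, NExp.eval_times, NExp.eval] at hb
    rw [run]
    split_ifs with hc
    · simp only [Test.Holds, RExp.eval, State.tick] at hc
      simp only [run, andThen_pure]
      refine (surely_fillProg A R _ (by decide) (by decide) (s.narr 4) ?_ ?_).andThen ?_
      · intro s' hs'
        simp only [NExp.eval, hs' 4 (by decide)]
        rfl
      · simpa [State.tick, State.setN, State.setR] using h10
      rintro s₁ ⟨hn₁, hr₁, -, ha₁, hd₁, -, ht₁⟩
      refine (surely_fillProg A R _ (by decide) (by decide) (s.narr 3) ?_ ?_).mono ?_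
      · intro s' hs'
        simp only [NExp.eval, hs' 3 (by decide), ha₁ 3 (by decide)]
        rfl
      · rw [hn₁ 2 (by decide)]
        simpa [State.tick, State.setN, State.setR] using h2
      rintro s₂ ⟨hn₂, hr₂, -, ha₂, hd₂, hd₂', ht₂⟩
      simp only [NExp.cost, NExp.cost_times, RExp.cost, Test.cost, State.tick, State.setN,
        State.setR, NExp.eval, RExp.eval] at *
      have e6 := hn₁ 6 (by decide)
      have e2 := hn₁ 2 (by decide)
      norm_num [Function.update_apply] at e6 e2 ht₁ hd₁
      rw [e6, e2] at hd₂ hd₂'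
      rw [e2] at ht₂
      refine ⟨fun x h8 h11 => ?_, fun a h0 h5 => ?_, by omega, Or.inl ⟨⟨hb, hc⟩, ?_, ?_, ?_, ?_,
        hd₂, fun a ha => ?_⟩⟩
      · rw [hn₂ x h8, hn₁ x h8]
        simp [h11]
      · rw [ha₂ a h0, ha₁ a h5]
      · rw [hr₂, hr₁]
        simp
      · rw [hr₂, hr₁]
        simp
      · rw [hn₂ 11 (by decide), hn₁ 11 (by decide)]
        simp
      · intro a ha
        rw [ha₂ 5 (by decide), ← hd₁ a ha, h12, zero_add]
      · rw [hd₂' a ha, ha₁ 0 (by decide)]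
    · simp only [Test.Holds, RExp.eval, State.tick] at hc
      rw [run]
      refine surely_pure ⟨fun _ _ _ => rfl, fun _ _ _ => rfl, ?_,
        Or.inr ⟨fun h => hc h.2, rfl, rfl, rfl, rfl, rfl⟩⟩
      simp only [NExp.cost, NExp.cost_times, RExp.cost, Test.cost, State.tick]
      omega
  · simp only [Test.Holds, NExp.eval_times, NExp.eval] at hb
    rw [run]
    refine surely_pure ⟨fun _ _ _ => rfl, fun _ _ _ => rfl, ?_,
      Or.inr ⟨fun h => hb h.1, rfl, rfl, rfl, rfl, rfl⟩⟩
    simp only [NExp.cost, NExp.cost_times, Test.cost, State.tick]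
    omega

/-- The effect of a trial in which the design matrix consists of the columns listed in `P`, the
estimated costs are `v`, and `l` is the pivot. -/
structure TrialPost (n T k : ℕ) (F : Finset ℕ) (P : ℕ → ℕ) (v : ℕ → ℝ) (l : ℕ) (s s' : State) :
    Prop where
  frame : ∀ x, x ≠ 7 → x ≠ 8 → x ≠ 9 → x ≠ 10 → x ≠ 11 → s'.nreg x = s.nreg x
  counter : s'.nreg 7 = s.nreg 7 + 1
  columns : s'.narr 1 = s.narr 1
  targets : s'.narr 2 = s.narr 2
  sample : s'.narr 3 = P
  time : s'.time ≤ s.time + 300 * (n + T)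
  outcome :
    (Accepts (F.filter fun i => v l < v i).card F.card (s.rreg 0) (v l) (s.rreg 1) ∧
      s'.rreg 0 = 1 ∧ s'.rreg 1 = v l ∧
      Lists (s'.narr 5) (s'.nreg 11) (F.filter fun i => v l < v i) ∧
      (∀ a < 2 * k + 1, s'.narr 0 (s.nreg 6 + a) = P a) ∧
      (∀ a, a < s.nreg 6 ∨ s.nreg 6 + (2 * k + 1) ≤ a → s'.narr 0 a = s.narr 0 a)) ∨
    (¬ Accepts (F.filter fun i => v l < v i).card F.card (s.rreg 0) (v l) (s.rreg 1) ∧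
      s'.rreg 0 = s.rreg 0 ∧ s'.rreg 1 = s.rreg 1 ∧ s'.nreg 11 = s.nreg 11 ∧
      s'.narr 5 = s.narr 5 ∧ s'.narr 0 = s.narr 0)

/-- Sample, regression answer and pivot are averaged in this order, the pivot independently of the
other two. Only 2k of the 2k+1 design columns are sampled; the last place of the list keeps its old
entry and serves as filler. -/
theorem expect_trialProg_le {k : ℕ} (R : RegressionAlg n (2 * k + 1) n) {fuel : ℕ} (s : State)
    {F : Finset ℕ} (hF : Lists (s.narr 1) (s.nreg 5) F) (hFn : F ⊆ Finset.range n)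
    (hm : 1 ≤ s.nreg 5) (h2 : s.nreg 2 = 2 * k + 1) (h12 : s.nreg 12 = 0)
    (h13 : s.nreg 13 = 2 * k) (hkn : k < n) (hfuel : 2 * n + 1 < fuel) (φ : State → ℝ≥0∞)
    (Φ : (Fin (2 * k) → ℕ) → Matrix (Fin (2 * k + 1)) (Fin n) ℝ × (Fin n → ℝ) → ℕ → ℝ≥0∞)
    (hφ : ∀ u ∈ Fintype.piFinset fun _ : Fin (2 * k) => F, ∀ o, ∀ l ∈ F, ∀ s',
      TrialPost n R.time k F (overlay 0 u (s.narr 3)) (writeVec o.2 fun _ => 0) l s s' →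
        φ s' ≤ Φ u o l) :
    expect (run A R fuel trialProg s) φ
      ≤ (∑ u ∈ Fintype.piFinset fun _ : Fin (2 * k) => F,
          ∑' o, R.law (listedCols A (2 * k + 1) (overlay 0 u (s.narr 3)))
            (listedCols A n (s.narr 2)) o * ((∑ l ∈ F, Φ u o l) / (F.card : ℝ≥0∞)))
        / (F.card : ℝ≥0∞) ^ (2 * k) := by
  classical
  have hmn : s.nreg 5 ≤ n := by
    rw [← hF.card]
    simpa using Finset.card_le_card hFn
  rw [trialProg, run, expect_andThen]
  let Good : State → Prop := fun s₁ => (∀ x, x ≠ 8 → x ≠ 9 → s₁.nreg x = s.nreg x) ∧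
    s₁.rreg = s.rreg ∧ s₁.rarr = s.rarr ∧ (∀ a, a ≠ 3 → s₁.narr a = s.narr a) ∧
    s₁.time ≤ s.time + 7 + 18 * s.nreg 13
  generalize hχ : (fun s₁ => expect (run A R fuel _ s₁) φ) = χ
  -- The rest of the trial depends on the whole state, whereas the bound for sampling admits only
  -- functions of array 3; hence the supremum over all states in the frame with that array.
  refine (expect_sampleProg_le A R s hF hm (by omega)
    (fun P => ⨆ (s₁ : State) (_ : Good s₁ ∧ s₁.narr 3 = P), χ s₁) χ ?_).trans ?_
  · intro s₁ hn hr hra hna ht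
    exact le_iSup₂_of_le s₁ ⟨⟨hn, hr, hra, hna, ht⟩, rfl⟩ le_rfl
  rw [h13]
  refine ENNReal.div_le_div_right (Finset.sum_le_sum fun u hu => iSup₂_le ?_) _
  rintro s₁ ⟨⟨hn₁, hr₁, -, ha₁, ht₁⟩, hP⟩
  rw [← hχ]
  beta_reduce
  rw [run, run, expect_andThen, expect_map, hP, ha₁ 2 (by decide)]
  refine ENNReal.tsum_le_tsum fun o => mul_le_mul_right ?_ _
  rw [run, run, expect_andThen, expect_uniform]
  have h5 : (NExp.sub (.reg 5) (.const 1)).eval ((s₁.storeAnswer 0 1 o).tick (R.time + 1)) + 1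
      = s.nreg 5 := by
    simp only [NExp.eval, State.tick, State.storeAnswer, hn₁ 5 (by decide) (by decide)]
    omega
  rw [h5, hF.card, ← hF.sum]
  refine ENNReal.div_le_div_right (Finset.sum_le_sum fun x hx => ?_) _
  have hxF : s.narr 1 x ∈ F := hF.mem (Finset.mem_range.1 hx)
  rw [run, run, andThen_pure, run]
  set s₂ := State.tick (State.setR (State.tick (State.setN _ 9 x) _) 2 _) _ with hs₂
  have hn₂ : ∀ y, y ≠ 8 → y ≠ 9 → s₂.nreg y = s.nreg y := fun y h8 h9 => by
    simp [hs₂, State.tick, State.setN, State.setR, State.storeAnswer, h9, hn₁ y h8 h9]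
  have ha₂ : ∀ a, a ≠ 3 → s₂.narr a = s.narr a := ha₁
  have hv₂ : ∀ l ∈ F, s₂.rarr 1 l = writeVec o.2 (fun _ => 0) l := fun l hl => by
    have hln : l < n := Finset.mem_range.1 (hFn hl)
    simp [hs₂, State.tick, State.setN, State.setR, State.storeAnswer, writeVec, hln]
  have hr₂ : s₂.rreg 2 = writeVec o.2 (fun _ => 0) (s.narr 1 x) := by
    rw [← hv₂ _ hxF]
    simp [hs₂, State.tick, State.setN, State.setR, State.storeAnswer, RExp.eval, NExp.eval,
      ha₁ 1 (by decide)]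
  have hr₂' : ∀ y, y ≠ 2 → s₂.rreg y = s.rreg y := fun y hy => by
    simp [hs₂, State.tick, State.setN, State.setR, State.storeAnswer, hy, hr₁]
  have ht₂ : s₂.time ≤ s.time + 16 + 18 * (2 * k) + R.time := by
    simp only [hs₂, State.tick, State.setN, State.setR, State.storeAnswer, RExp.cost, NExp.cost]
    omega
  have hP₂ : s₂.narr 3 = overlay 0 u (s.narr 3) := hP
  clear_value s₂
  have hfilter : (F.filter fun l => s₂.rreg 2 < s₂.rarr 1 l) = F.filter fun l =>
      writeVec o.2 (fun _ => 0) (s.narr 1 x) < writeVec o.2 (fun _ => 0) l := by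
    refine Finset.filter_congr fun l hl => ?_
    rw [hr₂, hv₂ l hl]
  have hF₂ : Lists (s₂.narr 1) (s₂.nreg 5) F := by
    rwa [ha₂ 1 (by decide), hn₂ 5 (by decide) (by decide)]
  refine expect_andThen_le (surely_filterProg A R s₂ hF₂ ?_) ?_
  · rw [hn₂ 5 (by decide) (by decide)]
    omega
  rintro s₃ ⟨hn₃, hr₃, -, ha₃, hl₃, ht₃⟩
  rw [hfilter] at hl₃
  have h10 : s₃.nreg 10 ≤ n := by
    rw [← hl₃.card]
    exact (Finset.card_filter_le _ _).trans (hF.card ▸ hmn)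
  have e2 : s₃.nreg 2 = 2 * k + 1 := by
    rw [hn₃ 2 (by decide) (by decide), hn₂ 2 (by decide) (by decide), h2]
  have e5 : s₃.nreg 5 = s.nreg 5 := by
    rw [hn₃ 5 (by decide) (by decide), hn₂ 5 (by decide) (by decide)]
  have e6 : s₃.nreg 6 = s.nreg 6 := by
    rw [hn₃ 6 (by decide) (by decide), hn₂ 6 (by decide) (by decide)]
  have e11 : s₃.nreg 11 = s.nreg 11 := by
    rw [hn₃ 11 (by decide) (by decide), hn₂ 11 (by decide) (by decide)]
  rw [run]
  refine expect_andThen_le (surely_acceptProg A R s₃ ?_ (by omega) (by omega)) ?_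
  · rw [hn₃ 12 (by decide) (by decide), hn₂ 12 (by decide) (by decide), h12]
  rintro s₄ ⟨hn₄, ha₄, ht₄, hout⟩
  rw [run, expect_pure]
  refine hφ u hu o _ hxF _ ?_
  rw [hr₃, hr₂, hr₂' 0 (by decide), hr₂' 1 (by decide), e2, e5, e6, e11,
    ha₃ 3 (by decide), hP₂, ha₃ 5 (by decide), ha₂ 5 (by decide), ha₃ 0 (by decide),
    ha₂ 0 (by decide), ← hF.card, ← hl₃.card] at hout
  have e5' := hn₂ 5 (by decide) (by decide)
  refine ⟨?_, ?_, ?_, ?_, ?_, ?_, ?_⟩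
  · intro y h7 h8 h9 h10 h11
    simp [State.tick, State.setN, h7, hn₄ y h8 h11, hn₃ y h8 h10, hn₂ y h8 h9]
  · simp [State.tick, State.setN, NExp.eval, hn₄ 7 (by decide) (by decide),
      hn₃ 7 (by decide) (by decide), hn₂ 7 (by decide) (by decide)]
  · exact (ha₄ 1 (by decide) (by decide)).trans ((ha₃ 1 (by decide)).trans (ha₂ 1 (by decide)))
  · exact (ha₄ 2 (by decide) (by decide)).trans ((ha₃ 2 (by decide)).trans (ha₂ 2 (by decide)))
  · exact (ha₄ 3 (by decide) (by decide)).trans ((ha₃ 3 (by decide)).trans hP₂)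
  · simp only [State.tick, State.setN, NExp.cost]
    omega
  · rcases hout with ⟨hacc, h0, h1, h11, h5, hS, hS'⟩ | ⟨hacc, h0, h1, h11, h5, hS⟩
    · refine Or.inl ⟨hacc, h0, h1, ?_, hS, hS'⟩
      have : Lists (s₄.narr 5) (F.filter fun l =>
          writeVec o.2 (fun _ => 0) (s.narr 1 x) < writeVec o.2 (fun _ => 0) l).card _ :=
        (hl₃.card.symm ▸ hl₃).congr h5
      simpa [State.tick, State.setN, h11] using this
    · refine Or.inr ⟨hacc, h0, h1, ?_, h5, hS⟩
      simpa [State.tick, State.setN] using h11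

end

/-! ### The probability that a trial fails -/

-- The potential after a trial is a base value `a`, increased by `b` for an incorrect answer and by
-- `q` for a bad sample-pivot pair or a pivot of low rank. The last two have probabilities at most
-- 7/10 and 1/20, which add up to 3/4.
open Classical in
theorem average_trial_le {Ω : Type*} {N : ℕ} {F : Finset ℕ} (hF : F.Nonempty)
    (law : (Fin N → ℕ) → PMF Ω) (v : Ω → ℕ → ℝ) (Inc : (Fin N → ℕ) → Set Ω)
    (Bad : (Fin N → ℕ) → ℕ → Prop) (a b q η : ℝ≥0∞)
    (hInc : ∀ u, (law u).toOuterMeasure (Inc u) ≤ η)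
    (hBad : 10 * ∑ u ∈ Fintype.piFinset fun _ : Fin N => F, (F.filter (Bad u)).card
      ≤ 7 * F.card ^ (N + 1)) :
    (∑ u ∈ Fintype.piFinset fun _ : Fin N => F,
      ∑' o, law u o * ((∑ l ∈ F, (a + (if o ∈ Inc u then b else 0) + (if Bad u l then q else 0) +
        (if 19 * F.card < 20 * (F.filter fun i => v o l < v o i).card then q else 0)))
          / (F.card : ℝ≥0∞))) / (F.card : ℝ≥0∞) ^ N ≤ a + b * η + q * (3 / 4) := by
  set m : ℝ≥0∞ := (F.card : ℝ≥0∞) with hm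
  have hm0 : m ≠ 0 := by simpa [hm] using hF.ne_empty
  have hmt : m ≠ ⊤ := by simp [hm]
  have hpow0 : m ^ N ≠ 0 := pow_ne_zero _ hm0
  have hpowt : m ^ N ≠ ⊤ := by finiteness
  set Z := Fintype.piFinset fun _ : Fin N => F with hZ
  have hcardZ : (Z.card : ℝ≥0∞) = m ^ N := by simp [hZ, hm]
  have h20 : (20 : ℝ≥0∞)⁻¹ * 20 = 1 := ENNReal.inv_mul_cancel (by norm_num) (by norm_num)
  have h10 : (10 : ℝ≥0∞)⁻¹ * 10 = 1 := ENNReal.inv_mul_cancel (by norm_num) (by norm_num)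
  have hinner : ∀ u o, (∑ l ∈ F, (a + (if o ∈ Inc u then b else 0) + (if Bad u l then q else 0) +
        (if 19 * F.card < 20 * (F.filter fun i => v o l < v o i).card then q else 0))) / m
      ≤ (a + q * 20⁻¹ + q * ((F.filter (Bad u)).card / m)) + (if o ∈ Inc u then b else 0) := by
    intro u o
    refine ENNReal.div_le_of_le_mul ?_
    have hlow : (((F.filter fun l => 19 * F.card < 20 * (F.filter fun i => v o l < v o i).card).card
        : ℕ) : ℝ≥0∞) ≤ 20⁻¹ * m := by
      have h := card_low_rank_le F (v o)
      have h' : (20 : ℝ≥0∞) * ((F.filter fun l =>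
          19 * F.card < 20 * (F.filter fun i => v o l < v o i).card).card : ℕ) ≤ m := by
        rw [hm]
        exact_mod_cast h
      calc _ = 20⁻¹ * 20 * (((F.filter fun l =>
          19 * F.card < 20 * (F.filter fun i => v o l < v o i).card).card : ℕ) : ℝ≥0∞) := by
            rw [h20, one_mul]
        _ ≤ _ := by rw [mul_assoc]; gcongr
    simp only [Finset.sum_add_distrib, Finset.sum_const, nsmul_eq_mul, ← Finset.sum_filter]
    have hdiv : ((F.filter (Bad u)).card : ℝ≥0∞) / m * m = (F.filter (Bad u)).card :=
      ENNReal.div_mul_cancel hm0 hmt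
    calc _ ≤ m * a + m * (if o ∈ Inc u then b else 0) + (F.filter (Bad u)).card * q
          + 20⁻¹ * m * q := by gcongr
      _ = (a + q * 20⁻¹) * m + q * ((F.filter (Bad u)).card : ℝ≥0∞)
          + (if o ∈ Inc u then b else 0) * m := by ring
      _ = _ := by
        conv_lhs => rw [← hdiv]
        ring
  have hmid : ∀ u, ∑' o, law u o * ((∑ l ∈ F, (a + (if o ∈ Inc u then b else 0) +
        (if Bad u l then q else 0) +
        (if 19 * F.card < 20 * (F.filter fun i => v o l < v o i).card then q else 0))) / m)
      ≤ (a + q * 20⁻¹ + b * η) + q * ((F.filter (Bad u)).card / m) := by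
    intro u
    calc _ ≤ ∑' o, (law u o * (a + q * 20⁻¹ + q * ((F.filter (Bad u)).card / m))
          + (Inc u).indicator (law u) o * b) := by
          refine ENNReal.tsum_le_tsum fun o => ?_
          refine (mul_le_mul_right (hinner u o) _).trans (le_of_eq ?_)
          rw [mul_add]
          congr 1
          by_cases ho : o ∈ Inc u <;> simp [ho]
      _ = (a + q * 20⁻¹ + q * ((F.filter (Bad u)).card / m))
          + (law u).toOuterMeasure (Inc u) * b := by
          rw [ENNReal.tsum_add, ENNReal.tsum_mul_right, ENNReal.tsum_mul_right, (law u).tsum_coe,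
            one_mul, PMF.toOuterMeasure_apply]
      _ ≤ (a + q * 20⁻¹ + q * ((F.filter (Bad u)).card / m)) + η * b := by
          gcongr
          exact hInc u
      _ = _ := by ring
  refine (ENNReal.div_le_div_right (Finset.sum_le_sum fun u _ => hmid u) _).trans ?_
  refine ENNReal.div_le_of_le_mul ?_
  have hsum : (∑ u ∈ Z, ((F.filter (Bad u)).card : ℝ≥0∞)) / m ≤ 7 * 10⁻¹ * m ^ N := by
    refine ENNReal.div_le_of_le_mul ?_
    have h : (10 : ℝ≥0∞) * ∑ u ∈ Z, ((F.filter (Bad u)).card : ℝ≥0∞) ≤ 7 * m ^ (N + 1) := by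
      rw [hm]
      exact_mod_cast hBad
    calc _ = 10⁻¹ * 10 * ∑ u ∈ Z, ((F.filter (Bad u)).card : ℝ≥0∞) := by rw [h10, one_mul]
      _ ≤ 10⁻¹ * (7 * m ^ (N + 1)) := by rw [mul_assoc]; gcongr
      _ = _ := by ring
  rw [Finset.sum_add_distrib, Finset.sum_const, nsmul_eq_mul, hcardZ, ← Finset.mul_sum]
  simp only [ENNReal.div_eq_inv_mul, ← Finset.mul_sum] at hsum ⊢
  have h34 : (20 : ℝ≥0∞)⁻¹ + 7 * 10⁻¹ = 4⁻¹ * 3 := by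
    rw [← ENNReal.toReal_eq_toReal_iff' (by finiteness) (by finiteness)]
    rw [ENNReal.toReal_add (by finiteness) (by finiteness)]
    simp only [ENNReal.toReal_mul, ENNReal.toReal_inv, ENNReal.toReal_ofNat]
    norm_num
  calc _ ≤ m ^ N * (a + q * 20⁻¹ + b * η) + q * (7 * 10⁻¹ * m ^ N) := by gcongr
    _ = (a + b * η + q * (20⁻¹ + 7 * 10⁻¹)) * m ^ N := by ring
    _ = _ := by rw [h34]

/-! ### One round -/

/-- Repeat the trial, then go on with the best list of remaining columns. -/
def roundProg : Prog :=
  .seq (.setN 7 (.const 0)) (.seq (.setN 11 (.const 0)) (.seq (.setR 0 .zero)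
    (.seq (.while (.nle (.add (.reg 7) (.const 1)) (.reg 4)) trialProg)
      (.seq (fillProg 1 12 11 (.get 5 (.reg 8)))
        (.seq (.setN 5 (.reg 11)) (.setN 6 (.add (.reg 6) (.reg 2))))))))

/-- The state at the beginning of a round in which the columns of `F` remain. -/
structure Ready (n k L : ℕ) (F : Finset ℕ) (s : State) : Prop where
  size : s.nreg 2 = 2 * k + 1
  trials : s.nreg 4 = L
  zero : s.nreg 12 = 0
  samples : s.nreg 13 = 2 * k
  columns : Lists (s.narr 1) (s.nreg 5) F
  subset : F ⊆ Finset.range n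
  targets : ∀ a < n, s.narr 2 a = a
  sample_lt : ∀ a, s.narr 3 a < n
  output_lt : ∀ a, s.narr 0 a < n

/-- The cost of the best approximation of column `l` in the span of the `d` columns listed in `P`. -/
def colCost {n : ℕ} (g : ℝ → ℝ) (A : Matrix (Fin n) (Fin n) ℝ) (d : ℕ) (P : ℕ → ℕ) (l : ℕ) : ℝ :=
  optReg g (listedCols A d P) fun i => entryAt A i l

theorem listedCols_congr {n d : ℕ} (A : Matrix (Fin n) (Fin n) ℝ) {P P' : ℕ → ℕ}
    (h : ∀ a < d, P a = P' a) : listedCols A d P = listedCols A d P' := by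
  ext i j
  simp [listedCols, h j j.2]

theorem colCost_congr {n d : ℕ} (g : ℝ → ℝ) (A : Matrix (Fin n) (Fin n) ℝ) {P P' : ℕ → ℕ}
    (h : ∀ a < d, P a = P' a) (l : ℕ) : colCost g A d P l = colCost g A d P' l := by
  rw [colCost, colCost, listedCols_congr A h]

theorem RegressionCorrect.bounds {n d : ℕ} {g : ℝ → ℝ} {reg : ℝ} {A : Matrix (Fin n) (Fin n) ℝ}
    {P Q : ℕ → ℕ} {o : Matrix (Fin d) (Fin n) ℝ × (Fin n → ℝ)}
    (h : RegressionCorrect g reg (listedCols A d P) (listedCols A n Q) o)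
    (hQ : ∀ a < n, Q a = a) {l : ℕ} (hl : l < n) :
    colCost g A d P l ≤ writeVec o.2 (fun _ => 0) l ∧
      writeVec o.2 (fun _ => 0) l ≤ reg * colCost g A d P l := by
  have hcol : (listedCols A n Q).col ⟨l, hl⟩ = fun i : Fin n => entryAt A i l := by
    ext i
    simp [listedCols, Matrix.col, hQ l hl]
  have h1 := (h ⟨l, hl⟩).2
  rw [hcol] at h1
  simpa [writeVec, hl, colCost] using h1

/-- The state after a round that began in state `s` with columns `F`, and leaves columns `F'`. -/
structure RoundPost (n k L T : ℕ) (F : Finset ℕ) (s : State) (F' : Finset ℕ) (s' : State) :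
    Prop where
  ready : Ready n k L F' s'
  subset : F' ⊆ F
  card : 20 * F'.card ≤ 19 * F.card
  offset : s'.nreg 6 = s.nreg 6 + (2 * k + 1)
  output : ∀ a < s.nreg 6, s'.narr 0 a = s.narr 0 a
  time : s'.time ≤ s.time + 400 * (L + 1) * (n + T)

/-- The invariant of the trials of a round. -/
structure TrialInv (n k L T : ℕ) (F : Finset ℕ) (s₀ : State) (j : ℕ) (s : State) : Prop where
  ready : Ready n k L F s
  size_eq : s.nreg 5 = s₀.nreg 5
  offset : s.nreg 6 = s₀.nreg 6
  output : ∀ a < s₀.nreg 6, s.narr 0 a = s₀.narr 0 a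
  counter : s.nreg 7 = j
  le : j ≤ L
  time : s.time ≤ s₀.time + 10 + j * (310 * (n + T))
  kept : ∃ F', Lists (s.narr 5) (s.nreg 11) F' ∧ F' ⊆ F ∧ 20 * F'.card ≤ 19 * F.card
  flag : s.rreg 0 = 0 ∨ s.rreg 0 = 1

/-- The list that is kept approximates the removed columns within the recorded threshold. -/
def KeptCorrect {n : ℕ} (g : ℝ → ℝ) (A : Matrix (Fin n) (Fin n) ℝ) (d : ℕ) (F : Finset ℕ)
    (s : State) : Prop :=
  s.rreg 0 = 1 → ∀ F', Lists (s.narr 5) (s.nreg 11) F' → ∀ l ∈ F, l ∉ F' →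
    colCost g A d (fun a => s.narr 0 (s.nreg 6 + a)) l ≤ s.rreg 1

theorem Lists.unique {arr : ℕ → ℕ} {m : ℕ} {F F' : Finset ℕ} (h : Lists arr m F)
    (h' : Lists arr m F') : F = F' := h.2.symm.trans h'.2

section

variable {n : ℕ} (A : Matrix (Fin n) (Fin n) ℝ)

theorem overlay_lt {r i : ℕ} {u : Fin r → ℕ} {P : ℕ → ℕ} {n : ℕ} (hu : ∀ j, u j < n)
    (hP : ∀ a, P a < n) (a : ℕ) : overlay i u P a < n := by
  unfold overlay
  split_ifs
  exacts [hu _, hP a]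

/-- No correctness of the regression enters: sizes, index ranges and the clock are under control for
every answer. The 5 is the cost of the loop test. -/
theorem TrialPost.trialInv {k L T : ℕ} {F : Finset ℕ} {s₀ s₁ s s' : State} {j : ℕ}
    (hI : TrialInv n k L T F s₀ j s₁) (hs : s = s₁.tick 5) (hj : j < L)
    {u : Fin (2 * k) → ℕ} (hu : u ∈ Fintype.piFinset fun _ : Fin (2 * k) => F)
    {v : ℕ → ℝ} {l : ℕ} (hn : 0 < n)
    (h : TrialPost n T k F (overlay 0 u (s.narr 3)) v l s s') : TrialInv n k L T F s₀ (j + 1) s' := by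
  subst hs
  have hP : ∀ a, overlay 0 u (s₁.narr 3) a < n := overlay_lt
    (fun i => Finset.mem_range.1 (hI.ready.subset (Fintype.mem_piFinset.1 hu i)))
    hI.ready.sample_lt
  have e2 := (h.frame 2 (by decide) (by decide) (by decide) (by decide) (by decide))
  have e4 := (h.frame 4 (by decide) (by decide) (by decide) (by decide) (by decide))
  have e5 := (h.frame 5 (by decide) (by decide) (by decide) (by decide) (by decide))
  have e6 := (h.frame 6 (by decide) (by decide) (by decide) (by decide) (by decide))
  have e12 := (h.frame 12 (by decide) (by decide) (by decide) (by decide) (by decide))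
  have e13 := (h.frame 13 (by decide) (by decide) (by decide) (by decide) (by decide))
  have ho := h.outcome
  have hsm := h.sample
  simp only [State.tick] at e2 e4 e5 e6 e12 e13 ho hsm
  have hout : ∀ a, s'.narr 0 a < n := by
    intro a
    rcases ho with ⟨-, -, -, -, hS, hS'⟩ | ⟨-, -, -, -, -, hS⟩
    · by_cases ha : a < s₁.nreg 6 ∨ s₁.nreg 6 + (2 * k + 1) ≤ a
      · rw [hS' a ha]
        exact hI.ready.output_lt a
      · have := hS (a - s₁.nreg 6) (by omega)
        rw [show s₁.nreg 6 + (a - s₁.nreg 6) = a by omega] at this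
        rw [this]
        exact hP _
    · rw [hS]
      exact hI.ready.output_lt a
  have ht := h.time
  have hc := h.counter
  simp only [State.tick] at ht hc
  refine ⟨⟨e2.trans hI.ready.size, e4.trans hI.ready.trials, e12.trans hI.ready.zero,
    e13.trans hI.ready.samples, ?_, hI.ready.subset, ?_, ?_, hout⟩, e5.trans hI.size_eq,
    e6.trans hI.offset, ?_, ?_, hj, ?_, ?_, ?_⟩
  · rw [h.columns, e5]
    exact hI.ready.columns
  · rw [h.targets]
    exact hI.ready.targets
  · rw [hsm]
    exact hP
  · intro a ha
    rw [← hI.output a ha]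
    rcases ho with ⟨-, -, -, -, -, hS'⟩ | ⟨-, -, -, -, -, hS⟩
    · exact hS' a (Or.inl (hI.offset ▸ ha))
    · rw [hS]
  · rw [hc, hI.counter]
  · have := hI.time
    rw [add_mul]
    omega
  · rcases ho with ⟨hacc, -, -, hl, -, -⟩ | ⟨-, -, -, h11, h5, -⟩
    · exact ⟨_, hl, Finset.filter_subset _ _, hacc.1⟩
    · rw [h11, h5]
      exact hI.kept
  · rcases ho with ⟨-, h0, -⟩ | ⟨-, h0, -⟩
    · exact Or.inr h0
    · rw [h0]
      exact hI.flag

/-- A removed column has estimated cost at most the threshold, and a correct estimate bounds the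
true cost from above. -/
theorem TrialPost.keptCorrect {k T : ℕ} {F : Finset ℕ} {s s' : State} {g : ℝ → ℝ} {reg : ℝ}
    {P : ℕ → ℕ} {o : Matrix (Fin (2 * k + 1)) (Fin n) ℝ × (Fin n → ℝ)} {l : ℕ}
    (h : TrialPost n T k F P (writeVec o.2 fun _ => 0) l s s') (hFn : F ⊆ Finset.range n)
    (hQ : ∀ a < n, s.narr 2 a = a)
    (ho : RegressionCorrect g reg (listedCols A (2 * k + 1) P) (listedCols A n (s.narr 2)) o)
    (hc : KeptCorrect g A (2 * k + 1) F s) : KeptCorrect g A (2 * k + 1) F s' := by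
  have e6 := (h.frame 6 (by decide) (by decide) (by decide) (by decide) (by decide))
  rcases h.outcome with ⟨-, -, h1, hl, hS, -⟩ | ⟨-, h0, h1, h11, h5, hS⟩
  · intro _ F' hF' i hi hiF'
    rw [h1, e6, colCost_congr g A hS]
    have hi2 : ¬ writeVec o.2 (fun _ => 0) l < writeVec o.2 (fun _ => 0) i := fun hlt =>
      hiF' (hl.unique hF' ▸ Finset.mem_filter.2 ⟨hi, hlt⟩)
    exact (ho.bounds hQ (Finset.mem_range.1 (hFn hi))).1.trans (not_lt.1 hi2)
  · rw [KeptCorrect, h0, h1, h11, h5, e6, hS]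
    exact hc

/-- Once a threshold is recorded it can only decrease. -/
theorem TrialPost.found {k T : ℕ} {F : Finset ℕ} {s s' : State} {τ : ℝ}
    {P : ℕ → ℕ} {v : ℕ → ℝ} {l : ℕ} (h : TrialPost n T k F P v l s s')
    (hf : s.rreg 0 = 1 ∧ s.rreg 1 ≤ τ) : s'.rreg 0 = 1 ∧ s'.rreg 1 ≤ τ := by
  rcases h.outcome with ⟨hacc, h0, h1, -⟩ | ⟨-, h0, h1, -⟩
  · refine ⟨h0, ?_⟩
    have := hacc.2
    rw [hf.1, one_mul, one_mul] at this
    rw [h1]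
    exact this.trans hf.2
  · rw [h0, h1]
    exact hf

/-- A pivot of sufficient rank is rejected only when a smaller threshold is already recorded. -/
theorem TrialPost.new_found {k T : ℕ} {F : Finset ℕ} {s s' : State} {τ : ℝ}
    {P : ℕ → ℕ} {v : ℕ → ℝ} {l : ℕ} (h : TrialPost n T k F P v l s s')
    (hflag : s.rreg 0 = 0 ∨ s.rreg 0 = 1)
    (hrank : ¬ 19 * F.card < 20 * (F.filter fun i => v l < v i).card) (hτ : v l ≤ τ) :
    s'.rreg 0 = 1 ∧ s'.rreg 1 ≤ τ := by
  rcases h.outcome with ⟨-, h0, h1, -⟩ | ⟨hacc, h0, h1, -⟩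
  · exact ⟨h0, h1 ▸ hτ⟩
  · have : ¬ s.rreg 0 * v l ≤ s.rreg 0 * s.rreg 1 := fun h' => hacc ⟨not_lt.1 hrank, h'⟩
    rcases hflag with hz | hz
    · simp [hz] at this
    · rw [hz, one_mul, one_mul, not_le] at this
      rw [h0, h1]
      exact ⟨hz, this.le.trans hτ⟩

end

/-! ### The failure potential of the trials and of a round -/

section

variable {n : ℕ} (A : Matrix (Fin n) (Fin n) ℝ)

open Classical in
/-- The probability that the trials still to be made fail. -/
def trialPotential (g : ℝ → ℝ) (d L : ℕ) (F : Finset ℕ) (τ : ℝ) (η α : ℝ≥0∞) (j : ℕ) (s : State) :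
    ℝ≥0∞ :=
  α + (L - j : ℕ) * η + if KeptCorrect g A d F s then
    if s.rreg 0 = 1 ∧ s.rreg 1 ≤ τ then 0 else (3 / 4) ^ (L - j) else 1

theorem three_quarters_pow_le_one (i : ℕ) : (3 / 4 : ℝ≥0∞) ^ i ≤ 1 :=
  pow_le_one' (ENNReal.div_le_of_le_mul (by norm_num)) i

theorem trialPotential_le (g : ℝ → ℝ) (d L : ℕ) (F : Finset ℕ) (τ : ℝ) (η α : ℝ≥0∞) (j : ℕ)
    (s : State) : trialPotential A g d L F τ η α j s ≤ α + (L - j : ℕ) * η + 1 := by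
  unfold trialPotential
  gcongr
  split_ifs
  exacts [zero_le_one, three_quarters_pow_le_one _, le_rfl]

theorem trialPotential_le_of_keptCorrect {g : ℝ → ℝ} {d L : ℕ} {F : Finset ℕ} {τ : ℝ}
    {η α : ℝ≥0∞} {j : ℕ} {s : State} (h : KeptCorrect g A d F s) :
    trialPotential A g d L F τ η α j s ≤ α + (L - j : ℕ) * η + (3 / 4) ^ (L - j) := by
  unfold trialPotential
  rw [if_pos h]
  gcongr
  split_ifs
  exacts [zero_le, le_rfl]

theorem trialPotential_of_found {g : ℝ → ℝ} {d L : ℕ} {F : Finset ℕ} {τ : ℝ}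
    {η α : ℝ≥0∞} {j : ℕ} {s : State} (h : KeptCorrect g A d F s)
    (hf : s.rreg 0 = 1 ∧ s.rreg 1 ≤ τ) :
    trialPotential A g d L F τ η α j s = α + (L - j : ℕ) * η := by
  unfold trialPotential
  rw [if_pos h, if_pos hf, add_zero]

-- Each trial pays η for the risk of an incorrect answer, and the probability that no threshold
-- within τ has been found drops by the factor 3/4. An earlier incorrect acceptance already has
-- potential 1, so nothing more can be lost.
open Classical in
theorem expect_trialProg_step {k L : ℕ} (R : RegressionAlg n (2 * k + 1) n) {g : ℝ → ℝ} {reg : ℝ}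
    {η : ℝ≥0∞} (hη : ∀ D B, (R.law D B).toOuterMeasure {o | RegressionCorrect g reg D B o}ᶜ ≤ η)
    {fuel : ℕ} {s₀ s : State} {F : Finset ℕ} {j : ℕ}
    (hI : TrialInv n k L R.time F s₀ j s) (hj : j < L) (hF : F.Nonempty)
    (hkn : k < n) (hfuel : 2 * n + 1 < fuel) {τ : ℝ} (Bad : (Fin (2 * k) → ℕ) → ℕ → Prop)
    (hτ : ∀ u ∈ Fintype.piFinset fun _ : Fin (2 * k) => F, ∀ l ∈ F, ¬ Bad u l →
      ∀ P, reg * colCost g A (2 * k + 1) (overlay 0 u P) l ≤ τ)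
    (hBad : 10 * ∑ u ∈ Fintype.piFinset fun _ : Fin (2 * k) => F, (F.filter (Bad u)).card
      ≤ 7 * F.card ^ (2 * k + 1)) (α : ℝ≥0∞) :
    expect (run A R fuel trialProg (s.tick 5))
      (guarded (TrialInv n k L R.time F s₀ (j + 1))
        (trialPotential A g (2 * k + 1) L F τ η α (j + 1)))
      ≤ trialPotential A g (2 * k + 1) L F τ η α j s := by
  set a : ℝ≥0∞ := α + (L - (j + 1) : ℕ) * η with ha
  have hLj : L - j = L - (j + 1) + 1 := by omega
  have haη : α + (L - j : ℕ) * η = a + η := by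
    rw [ha, hLj]
    push_cast
    ring
  have hm : 1 ≤ s.nreg 5 := by
    rw [← hI.ready.columns.card]
    exact hF.card_pos
  have hn : 0 < n := by omega
  let law : (Fin (2 * k) → ℕ) → PMF _ := fun u =>
    R.law (listedCols A (2 * k + 1) (overlay 0 u (s.narr 3))) (listedCols A n (s.narr 2))
  let Inc : (Fin (2 * k) → ℕ) → Set _ := fun u =>
    {o | RegressionCorrect g reg (listedCols A (2 * k + 1) (overlay 0 u (s.narr 3)))
      (listedCols A n (s.narr 2)) o}ᶜ
  -- Used with (b, q) equal to (a, 0) when a threshold within τ is recorded, (a, (3/4)^(L-j-1)) when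
  -- none is yet, and (a + 1, 0) when the kept list is incorrect.
  have key : ∀ b q : ℝ≥0∞,
      (∀ u ∈ Fintype.piFinset fun _ : Fin (2 * k) => F, ∀ o, ∀ l ∈ F, ∀ s',
        TrialPost n R.time k F (overlay 0 u (s.narr 3)) (writeVec o.2 fun _ => 0) l (s.tick 5) s' →
        trialPotential A g (2 * k + 1) L F τ η α (j + 1) s' ≤ b + (if o ∈ Inc u then 1 else 0) +
          (if Bad u l then q else 0) +
          (if 19 * F.card < 20 * (F.filter fun i => writeVec o.2 (fun _ => 0) l <
            writeVec o.2 (fun _ => 0) i).card then q else 0)) →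
      expect (run A R fuel trialProg (s.tick 5))
        (guarded (TrialInv n k L R.time F s₀ (j + 1))
          (trialPotential A g (2 * k + 1) L F τ η α (j + 1))) ≤ b + 1 * η + q * (3 / 4) := by
    intro b q hq
    refine (expect_trialProg_le A R (s.tick 5) hI.ready.columns hI.ready.subset hm hI.ready.size
      hI.ready.zero hI.ready.samples hkn hfuel _ _ fun u hu o l hl s' h => ?_).trans
      (average_trial_le hF law (fun o => writeVec o.2 fun _ => 0) Inc Bad b 1 q η
        (fun u => hη _ _) hBad)
    rw [guarded_of (h.trialInv hI rfl hj hu hn)]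
    convert hq u hu o l hl s' h
  by_cases hc : KeptCorrect g A (2 * k + 1) F s
  · have hc' : ∀ {u o l s'}, o ∉ Inc u →
        TrialPost n R.time k F (overlay 0 u (s.narr 3)) (writeVec o.2 fun _ => 0) l (s.tick 5) s' →
        KeptCorrect g A (2 * k + 1) F s' := fun ho h =>
      h.keptCorrect A hI.ready.subset hI.ready.targets (not_not.1 ho) hc
    by_cases hf : s.rreg 0 = 1 ∧ s.rreg 1 ≤ τ
    · rw [trialPotential_of_found A hc hf, haη]
      refine (key a 0 fun u hu o l hl s' h => ?_).trans (by simp)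
      by_cases ho : o ∈ Inc u
      · rw [if_pos ho]
        exact (trialPotential_le A _ _ _ _ _ _ _ _ _).trans (by simp [ha])
      · rw [trialPotential_of_found A (hc' ho h) (h.found hf), ← ha]
        simp [ho]
    · have : trialPotential A g (2 * k + 1) L F τ η α j s
          = a + η + (3 / 4) ^ (L - (j + 1)) * (3 / 4) := by
        unfold trialPotential
        rw [if_pos hc, if_neg hf, haη, hLj, pow_succ]
      rw [this]
      refine (key a ((3 / 4) ^ (L - (j + 1))) fun u hu o l hl s' h => ?_).trans (by simp)
      by_cases ho : o ∈ Inc u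
      · rw [if_pos ho]
        refine (trialPotential_le A _ _ _ _ _ _ _ _ _).trans ?_
        rw [← ha, add_assoc (a + 1)]
        exact le_self_add
      · by_cases hb : Bad u l
        · rw [if_pos hb]
          refine (trialPotential_le_of_keptCorrect A (hc' ho h)).trans ?_
          rw [← ha, if_neg ho, add_zero]
          exact le_self_add
        · split_ifs with hrank
          · refine (trialPotential_le_of_keptCorrect A (hc' ho h)).trans ?_
            simp [ha]
          · have hv := ((not_not.1 ho : RegressionCorrect _ _ _ _ _).bounds hI.ready.targets
              (Finset.mem_range.1 (hI.ready.subset hl))).2.trans (hτ u hu l hl hb _)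
            rw [trialPotential_of_found A (hc' ho h) (h.new_found hI.flag hrank hv), ← ha]
            simp
  · have : trialPotential A g (2 * k + 1) L F τ η α j s = a + η + 1 := by
      unfold trialPotential
      rw [if_neg hc, haη]
    rw [this]
    refine (key (a + 1) 0 fun u hu o l hl s' h => ?_).trans (le_of_eq (by ring))
    refine (trialPotential_le A _ _ _ _ _ _ _ _ _).trans ?_
    rw [← ha, add_assoc (a + 1), add_assoc (a + 1)]
    exact le_self_add

open Classical in
/-- In a round, the columns that are removed are with high probability approximated within `τ`. -/
theorem expect_roundProg_le {k L : ℕ} (R : RegressionAlg n (2 * k + 1) n) {g : ℝ → ℝ} {reg : ℝ}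
    {η : ℝ≥0∞} (hη : ∀ D B, (R.law D B).toOuterMeasure {o | RegressionCorrect g reg D B o}ᶜ ≤ η)
    {fuel : ℕ} {s : State} {F : Finset ℕ} (hs : Ready n k L F s) (hF : F.Nonempty)
    (hkn : k < n) (hfuel : 2 * n + 1 < fuel) (hL : L < fuel)
    {τ : ℝ} (Bad : (Fin (2 * k) → ℕ) → ℕ → Prop)
    (hτ : ∀ u ∈ Fintype.piFinset fun _ : Fin (2 * k) => F, ∀ l ∈ F, ¬ Bad u l →
      ∀ P, reg * colCost g A (2 * k + 1) (overlay 0 u P) l ≤ τ)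
    (hBad : 10 * ∑ u ∈ Fintype.piFinset fun _ : Fin (2 * k) => F, (F.filter (Bad u)).card
      ≤ 7 * F.card ^ (2 * k + 1)) (φ : State → ℝ≥0∞) (α : ℝ≥0∞)
    (hφ : ∀ s' F', RoundPost n k L R.time F s F' s' → φ s' ≤ α + if ∀ l ∈ F, l ∉ F' →
      colCost g A (2 * k + 1) (fun a => s'.narr 0 (s.nreg 6 + a)) l ≤ τ then 0 else 1) :
    expect (run A R fuel roundProg s) φ ≤ α + (L * η + (3 / 4) ^ L) := by
  have hmn : F.card ≤ n := by simpa using Finset.card_le_card hs.subset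
  rw [roundProg]
  simp only [run, andThen_pure]
  rw [expect_andThen]
  set s₁ := State.tick (State.setR _ 0 _) _ with hs₁
  -- Initially the kept list is empty, so a round without any accepted trial discards all columns.
  -- The sizes therefore shrink, and the program halts, even when every trial fails.
  have hI₁ : TrialInv n k L R.time F s 0 s₁ := by
    refine ⟨⟨hs.size, hs.trials, hs.zero, hs.samples, hs.columns, hs.subset, hs.targets,
      hs.sample_lt, hs.output_lt⟩, rfl, rfl, fun _ _ => rfl, rfl, Nat.zero_le _, ?_,
      ⟨∅, ?_, Finset.empty_subset _, by simp⟩, Or.inl ?_⟩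
    · simp [hs₁, State.tick, State.setN, State.setR, NExp.cost, RExp.cost]
    · simp [hs₁, State.tick, State.setN, State.setR, NExp.eval, Lists]
    · simp [hs₁, State.tick, State.setR, RExp.eval]
  have hk₁ : KeptCorrect g A (2 * k + 1) F s₁ := by
    intro h
    simp [hs₁, State.tick, State.setR, RExp.eval] at h
  clear_value s₁
  refine (expect_runLoop_le L (TrialInv n k L R.time F s)
    (trialPotential A g (2 * k + 1) L F τ η α) ?_ ?_ fuel 0 s₁ hL hI₁ (by omega)).trans ?_
  · intro j s₂ hI hb
    simp only [Test.Holds, NExp.eval, hI.counter, hI.ready.trials] at hb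
    obtain rfl : j = L := le_antisymm hI.le (by omega)
    obtain ⟨F', hl, hF'F, hcard⟩ := hI.kept
    have h11 : s₂.nreg 11 ≤ n := by
      rw [← hl.card]
      exact (Finset.card_le_card hF'F).trans hmn
    refine expect_andThen_le (surely_fillProg A R _ (by decide) (by decide) (s₂.narr 5) ?_ ?_) ?_
    · intro s' h'
      simp only [NExp.eval, h' 5 (by decide)]
      rfl
    · simp only [State.tick]
      omega
    rintro s₃ ⟨hn₃, hr₃, -, ha₃, hd₃, -, ht₃⟩
    simp only [State.tick, Test.cost, NExp.cost, hI.ready.zero, zero_add] at hn₃ hr₃ ha₃ hd₃ ht₃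
    rw [expect_pure]
    have hpost : RoundPost n k j R.time F s F'
        (((s₃.setN 5 (s₃.nreg 11)).tick 2).setN 6
          (s₃.nreg 6 + s₃.nreg 2) |>.tick 4) := by
      refine ⟨⟨?_, ?_, ?_, ?_, ?_, hF'F.trans hs.subset, ?_, ?_, ?_⟩, hF'F, hcard, ?_, ?_, ?_⟩
      · simp [State.tick, State.setN, hn₃, hI.ready.size]
      · simp [State.tick, State.setN, hn₃, hI.ready.trials]
      · simp [State.tick, State.setN, hn₃, hI.ready.zero]
      · simp [State.tick, State.setN, hn₃, hI.ready.samples]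
      · have : Lists (s₃.narr 1) (s₂.nreg 11) F' := hl.congr hd₃
        simpa [State.tick, State.setN, hn₃] using this
      · simp only [State.tick, State.setN, ha₃ 2 (by decide)]
        exact hI.ready.targets
      · simp only [State.tick, State.setN, ha₃ 3 (by decide)]
        exact hI.ready.sample_lt
      · simp only [State.tick, State.setN, ha₃ 0 (by decide)]
        exact hI.ready.output_lt
      · simp [State.tick, State.setN, hn₃, hI.offset, hI.ready.size]
      · simp only [State.tick, State.setN, ha₃ 0 (by decide)]
        exact hI.output
      · simp only [State.tick, State.setN]
        have ht := hI.time
        have : (1 : ℕ) ≤ n + R.time := by omega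
        nlinarith [Nat.mul_le_mul_left j this]
    refine le_trans (b := φ (((s₃.setN 5 (s₃.nreg 11)).tick 2).setN 6
      (s₃.nreg 6 + s₃.nreg 2) |>.tick 4)) (le_of_eq ?_) ((hφ _ F' hpost).trans ?_)
    · simp [State.tick, State.setN, NExp.eval, NExp.cost]
    · have e0 : (((s₃.setN 5 (s₃.nreg 11)).tick 2).setN 6
          (s₃.nreg 6 + s₃.nreg 2) |>.tick 4).narr 0 = s₂.narr 0 := ha₃ 0 (by decide)
      rw [e0, ← hI.offset]
      by_cases hc : KeptCorrect g A (2 * k + 1) F s₂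
      · by_cases hf : s₂.rreg 0 = 1 ∧ s₂.rreg 1 ≤ τ
        · rw [if_pos fun l hl' hl'' => (hc hf.1 F' hl l hl' hl'').trans hf.2, add_zero]
          unfold trialPotential
          rw [add_assoc]
          exact le_self_add
        · unfold trialPotential
          rw [if_pos hc, if_neg hf, Nat.sub_self]
          simp only [Nat.cast_zero, zero_mul, add_zero, pow_zero]
          gcongr
          split_ifs <;> simp
      · unfold trialPotential
        rw [if_neg hc, Nat.sub_self]
        simp only [Nat.cast_zero, zero_mul, add_zero]
        gcongr
        split_ifs <;> simp
  · intro j s₂ hI hb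
    simp only [Test.Holds, NExp.eval, hI.counter, hI.ready.trials] at hb
    exact ⟨by omega, expect_trialProg_step A R hη hI (by omega) hF hkn hfuel Bad hτ hBad α⟩
  · refine (trialPotential_le_of_keptCorrect A hk₁).trans ?_
    rw [Nat.sub_zero, add_assoc]

end

/-! ### Costs of columns -/

section

variable {n : ℕ}

/-- The loss of column `l` of `B - A`. -/
def colLoss (g : ℝ → ℝ) (A B : Matrix (Fin n) (Fin n) ℝ) (l : ℕ) : ℝ :=
  vecLoss g fun i : Fin n => entryAt B i l - entryAt A i l

theorem vecLoss_nonneg {ι : Type*} [Fintype ι] {g : ℝ → ℝ} (hg : ∀ x, 0 ≤ g x) (v : ι → ℝ) :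
    0 ≤ vecLoss g v := Finset.sum_nonneg fun _ _ => hg _

theorem matLoss_nonneg {ι κ : Type*} [Fintype ι] [Fintype κ] {g : ℝ → ℝ} (hg : ∀ x, 0 ≤ g x)
    (M : Matrix ι κ ℝ) : 0 ≤ matLoss g M :=
  Finset.sum_nonneg fun _ _ => Finset.sum_nonneg fun _ _ => hg _

theorem matLoss_eq_sum_colLoss (g : ℝ → ℝ) (A B : Matrix (Fin n) (Fin n) ℝ) :
    matLoss g (B - A) = ∑ l ∈ Finset.range n, colLoss g A B l := by
  rw [matLoss, Finset.sum_comm, Finset.sum_range]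
  simp [colLoss, vecLoss, entryAt]

theorem optReg_nonneg {d : ℕ} {g : ℝ → ℝ} (hg : ∀ x, 0 ≤ g x) (D : Matrix (Fin n) (Fin d) ℝ)
    (b : Fin n → ℝ) : 0 ≤ optReg g D b := Real.iInf_nonneg fun _ => vecLoss_nonneg hg _

theorem optReg_le {d : ℕ} {g : ℝ → ℝ} (hg : ∀ x, 0 ≤ g x) (D : Matrix (Fin n) (Fin d) ℝ)
    (b : Fin n → ℝ) (x : Fin d → ℝ) : optReg g D b ≤ vecLoss g (D *ᵥ x - b) :=
  ciInf_le (f := fun x : Fin d → ℝ => vecLoss g (D *ᵥ x - b))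
    ⟨0, by rintro _ ⟨x, rfl⟩; exact vecLoss_nonneg hg _⟩ x

/-- If a column of `B` is a bounded combination of others, then the corresponding columns of `A`
approximate each other within the loss of `B - A`. -/
theorem colCost_le_of_boundedComb {k : ℕ} {g : ℝ → ℝ} (hg : ∀ x, 0 ≤ g x) {ati mon : ℝ}
    (hati : ApproxTriangle g (2 * k + 1) ati) (hati0 : 0 ≤ ati) (hmon : ApproxMonotone g mon)
    (A B : Matrix (Fin n) (Fin n) ℝ) (z : Fin (2 * k + 1) → ℕ)
    (hz : BoundedComb ((fun l (i : Fin n) => entryAt B i l) ∘ z) (Fin.last (2 * k)))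
    {P : ℕ → ℕ} (hP : ∀ j : Fin (2 * k), P j = z j.castSucc) :
    colCost g A (2 * k + 1) P (z (Fin.last (2 * k))) ≤ ati * mon * ∑ j, colLoss g A B (z j) := by
  obtain ⟨x, hx, hxl, hcomb⟩ := hz
  refine (optReg_le hg _ _ x).trans ?_
  -- The combination of the columns of B with coefficients y is 0, so the residual is the
  -- combination of the columns of B - A with coefficients y. Since x vanishes at the last place,
  -- the filler column P (2k) does not enter.
  let y : Fin (2 * k + 1) → ℝ := fun j => if j = Fin.last (2 * k) then 1 else - x j
  have hy : ∀ j, |y j| ≤ 1 := by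
    intro j
    dsimp only [y]
    split_ifs
    · simp
    · rw [abs_neg]; exact hx j
  have hrow : ∀ i : Fin n, (listedCols A (2 * k + 1) P *ᵥ x - fun i : Fin n =>
      entryAt A i (z (Fin.last (2 * k)))) i = ∑ j, y j * (entryAt B i (z j) - entryAt A i (z j)) := by
    intro i
    have h := congrFun hcomb i
    simp only [Function.comp_apply, Finset.sum_apply, Pi.smul_apply, smul_eq_mul] at h
    simp only [Pi.sub_apply, Matrix.mulVec, dotProduct, listedCols, Matrix.of_apply]
    rw [Fin.sum_univ_castSucc] at h ⊢
    rw [Fin.sum_univ_castSucc]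
    have h1 : ∀ j : Fin (2 * k), y j.castSucc = - x j.castSucc := fun j =>
      if_neg (Fin.castSucc_lt_last j).ne
    have h2 : y (Fin.last (2 * k)) = 1 := if_pos rfl
    simp only [h1, h2, hxl, Fin.val_castSucc, hP, mul_zero, zero_mul, add_zero, one_mul] at h ⊢
    rw [h]
    simp only [neg_mul, mul_sub, Finset.sum_neg_distrib, Finset.sum_sub_distrib]
    have : ∑ j : Fin (2 * k), entryAt A i (z j.castSucc) * x j.castSucc
        = ∑ j : Fin (2 * k), x j.castSucc * entryAt A i (z j.castSucc) :=
      Finset.sum_congr rfl fun j _ => mul_comm _ _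
    rw [this]
    ring
  simp only [vecLoss, colLoss]
  rw [Finset.sum_comm, Finset.mul_sum]
  refine Finset.sum_le_sum fun i _ => ?_
  rw [hrow i, mul_assoc]
  refine (hati _).trans (mul_le_mul_of_nonneg_left ?_ hati0)
  rw [Finset.mul_sum]
  refine Finset.sum_le_sum fun j _ => hmon.2 _ _ ?_
  rw [abs_mul]
  exact mul_le_of_le_one_left (abs_nonneg _) (hy j)

theorem finrank_span_columns_le {k : ℕ} {B : Matrix (Fin n) (Fin n) ℝ} (hB : B.rank ≤ k)
    {N : ℕ} (z : Fin N → ℕ) :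
    Module.finrank ℝ (Submodule.span ℝ
      (Set.range ((fun l (i : Fin n) => entryAt B i l) ∘ z))) ≤ k := by
  refine le_trans (Submodule.finrank_mono (Submodule.span_le.2 ?_))
    (B.rank_eq_finrank_span_cols ▸ hB)
  rintro _ ⟨j, rfl⟩
  by_cases h : z j < n
  · refine Submodule.subset_span ⟨⟨z j, h⟩, ?_⟩
    ext i
    simp [entryAt, h, Matrix.col]
  · have : ((fun l (i : Fin n) => entryAt B i l) ∘ z) j = 0 := by
      ext i
      simp [entryAt, h]
    rw [this]
    exact Submodule.zero_mem _

/-! ### The threshold of a round, from the counting of bad tuples -/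

theorem exists_sorted_values_range (n : ℕ) (w : ℕ → ℝ) (hw : ∀ l, 0 ≤ w l) :
    ∃ (rk : ℕ → ℕ) (f : ℕ → ℝ), Set.InjOn rk (Finset.range n) ∧ Antitone f ∧ (∀ i, 0 ≤ f i) ∧
      (∀ i, n ≤ i → f i = 0) ∧ (∀ l < n, f (rk l) = w l) ∧
      ∑ i ∈ Finset.range n, f i = ∑ l ∈ Finset.range n, w l := by
  obtain ⟨rk, f, hrk, hf, hf0, hfn, hfw, hsum⟩ :=
    exists_sorted_values (fun l : Fin n => w l) fun l => hw l
  refine ⟨fun l => if h : l < n then rk ⟨l, h⟩ else 0, f, ?_, hf, hf0, hfn, ?_, ?_⟩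
  · intro l hl l' hl' h
    simp only [Finset.coe_range, Set.mem_Iio] at hl hl'
    simp only [hl, hl', dif_pos] at h
    exact Fin.mk.inj_iff.1 (hrk h)
  · intro l hl
    simpa [hl] using hfw ⟨l, hl⟩
  · rw [hsum, Finset.sum_range]

/-- Lets sample and pivot be counted as one tuple. -/
theorem sum_card_filter_snoc {N : ℕ} (F : Finset ℕ) (E : (Fin (N + 1) → ℕ) → Prop)
    [DecidablePred E] :
    ∑ u ∈ Fintype.piFinset fun _ : Fin N => F, (F.filter fun l => E (Fin.snoc u l)).card
      = ((Fintype.piFinset fun _ : Fin (N + 1) => F).filter E).card := by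
  simp only [Finset.card_filter]
  rw [← Finset.sum_product' (Fintype.piFinset fun _ : Fin N => F) F
    fun u l => if E (Fin.snoc u l) then 1 else 0]
  refine Finset.sum_bij' (fun p _ => (Fin.snoc p.1 p.2 : Fin (N + 1) → ℕ))
    (fun z _ => (Fin.init z, z (Fin.last N))) ?_ ?_ ?_ ?_ ?_
  · rintro ⟨u, l⟩ hp
    simp only [Finset.mem_product, Fintype.mem_piFinset] at hp ⊢
    intro j
    refine Fin.lastCases ?_ (fun j => ?_) j
    · simpa using hp.2
    · simpa using hp.1 j
  · intro z hz
    simp only [Finset.mem_product, Fintype.mem_piFinset] at hz ⊢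
    exact ⟨fun j => hz _, hz _⟩
  · rintro ⟨u, l⟩ _
    simp
  · intro z _
    simp
  · rintro ⟨u, l⟩ _
    rfl

open Classical in
/-- The unlikely event that the columns of a random sample do not approximate a random column within
the average of the losses, the largest losses being left out. -/
theorem exists_bad_event {k : ℕ} {g : ℝ → ℝ} (hg : ∀ x, 0 ≤ g x) {ati mon reg : ℝ}
    (hati : ApproxTriangle g (2 * k + 1) ati) (hati0 : 0 ≤ ati) (hmon : ApproxMonotone g mon)
    (hreg : 0 ≤ reg) (A : Matrix (Fin n) (Fin n) ℝ) {B : Matrix (Fin n) (Fin n) ℝ}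
    (hB : B.rank ≤ k) {rk : ℕ → ℕ} {f : ℕ → ℝ} (hrk : Set.InjOn rk (Finset.range n))
    (hf : Antitone f) (hf0 : ∀ i, 0 ≤ f i) (hfw : ∀ l < n, f (rk l) = colLoss g A B l)
    {F : Finset ℕ} (hFn : F ⊆ Finset.range n) (hF : F.Nonempty) :
    ∃ (Bad : (Fin (2 * k) → ℕ) → ℕ → Prop) (τ : ℝ),
      0 ≤ τ ∧
      F.card * τ ≤ reg * ati * mon * (10 * (2 * k + 1)) *
        ∑ i ∈ Finset.Ico (F.card / (10 * (2 * k + 1))) (F.card / (10 * (2 * k + 1)) + F.card), f i ∧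
      (∀ u ∈ Fintype.piFinset fun _ : Fin (2 * k) => F, ∀ l ∈ F, ¬ Bad u l →
        ∀ P, reg * colCost g A (2 * k + 1) (overlay 0 u P) l ≤ τ) ∧
      10 * ∑ u ∈ Fintype.piFinset fun _ : Fin (2 * k) => F, (F.filter (Bad u)).card
        ≤ 7 * F.card ^ (2 * k + 1) := by
  have hmon0 : 0 ≤ mon := zero_le_one.trans hmon.1
  have hm0 : (0 : ℝ) < F.card := by exact_mod_cast hF.card_pos
  set t := F.card / (10 * (2 * k + 1)) with ht
  -- Ranks are distinct, so `H` has at most t = ⌊|F|/(10(2k+1))⌋ members, few enough for a tuple to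
  -- meet it with probability at most 1/10.
  set H := F.filter fun l => rk l < t with hH
  set tail := ∑ l ∈ F with l ∉ H, colLoss g A B l with htail
  have hw : ∀ l, 0 ≤ colLoss g A B l := fun l => vecLoss_nonneg hg _
  have htail0 : 0 ≤ tail := Finset.sum_nonneg fun l _ => hw l
  have hHcard : 10 * ((2 * k + 1) * (F.filter (· ∈ H)).card) ≤ F.card := by
    have h1 : (F.filter (· ∈ H)).card ≤ t := by
      have h2 : F.filter (· ∈ H) = H := by
        rw [Finset.filter_mem_eq_inter, Finset.inter_eq_right]
        exact Finset.filter_subset _ _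
      rw [h2, ← Finset.card_range t]
      refine Finset.card_le_card_of_injOn rk
        (fun l hl => by simpa using (Finset.mem_filter.1 hl).2) (hrk.mono fun l hl => ?_)
      exact Finset.mem_coe.2 (hFn (Finset.mem_filter.1 hl).1)
    calc _ ≤ 10 * ((2 * k + 1) * t) := by gcongr
      _ = t * (10 * (2 * k + 1)) := by ring
      _ ≤ _ := Nat.div_mul_le_self _ _
  have htail_le : tail ≤ ∑ i ∈ Finset.Ico t (t + F.card), f i := by
    have h1 : tail = ∑ i ∈ (F.filter (· ∉ H)).image rk, f i := by
      rw [Finset.sum_image]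
      · exact Finset.sum_congr rfl fun l hl =>
          (hfw l (Finset.mem_range.1 (hFn (Finset.mem_filter.1 hl).1))).symm
      · exact hrk.mono fun l hl => Finset.mem_coe.2 (hFn (Finset.mem_filter.1 hl).1)
    rw [h1]
    refine sum_le_sum_Ico_of_antitone hf hf0 ?_
      (Finset.card_image_le.trans (Finset.card_filter_le _ _))
    intro i hi
    obtain ⟨l, hl, rfl⟩ := Finset.mem_image.1 hi
    obtain ⟨hlF, hlH⟩ := Finset.mem_filter.1 hl
    by_contra hlt
    exact hlH (Finset.mem_filter.2 ⟨hlF, not_le.1 hlt⟩)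
  have hcard := card_bad_tuple_le (fun l (i : Fin n) => entryAt B i l) F
    (fun z => finrank_span_columns_le hB z) (colLoss g A B) hw H hHcard
  rw [← sum_card_filter_snoc F fun z => ¬ (BoundedComb ((fun l (i : Fin n) => entryAt B i l) ∘ z)
    (Fin.last (2 * k)) ∧ F.card * ∑ j, colLoss g A B (z j) ≤ 10 * (2 * k + 1) * tail)] at hcard
  refine ⟨fun u l => ¬ (BoundedComb ((fun l (i : Fin n) => entryAt B i l) ∘ (Fin.snoc u l :
      Fin (2 * k + 1) → ℕ)) (Fin.last (2 * k)) ∧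
    F.card * ∑ j, colLoss g A B ((Fin.snoc u l : Fin (2 * k + 1) → ℕ) j)
      ≤ 10 * (2 * k + 1) * tail), reg * ati * mon * (10 * (2 * k + 1)) * tail / F.card,
    by positivity, ?_, ?_, ?_⟩
  · rw [mul_div_cancel₀ _ hm0.ne']
    exact mul_le_mul_of_nonneg_left htail_le (by positivity)
  · intro u _ l _ hgood P
    obtain ⟨hcomb, hsum⟩ := not_not.1 hgood
    have h1 := colCost_le_of_boundedComb hg hati hati0 hmon A B _ hcomb
      (P := overlay 0 u P) fun j => by
        unfold overlay
        rw [dif_pos (by omega), Fin.snoc_castSucc]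
        rfl
    rw [Fin.snoc_last] at h1
    rw [le_div_iff₀ hm0]
    calc _ ≤ reg * (ati * mon * ∑ j, colLoss g A B ((Fin.snoc u l : Fin (2 * k + 1) → ℕ) j))
          * F.card := by gcongr
      _ = reg * ati * mon *
          (F.card * ∑ j, colLoss g A B ((Fin.snoc u l : Fin (2 * k + 1) → ℕ) j)) := by ring
      _ ≤ reg * ati * mon * (10 * (2 * k + 1) * tail) := by gcongr
      _ = _ := by ring
  · convert hcard

/-! ### The quality of the output -/

/-- A correct answer has positive probability because n m > 1. -/
theorem RegressionAlg.Solves.exists_correct {d m : ℕ} {R : RegressionAlg n d m} {g : ℝ → ℝ}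
    {reg c : ℝ} (hR : R.Solves g reg c) (hc : 0 < c) (hnm : 1 < (n : ℝ) * m)
    (D : Matrix (Fin n) (Fin d) ℝ) (B : Matrix (Fin n) (Fin m) ℝ) :
    ∃ o, RegressionCorrect g reg D B o := by
  by_contra! h
  have h1 := hR D B
  rw [Set.eq_empty_of_forall_notMem (s := {o | RegressionCorrect g reg D B o}) h,
    MeasureTheory.measure_empty, nonpos_iff_eq_zero, ENNReal.ofReal_eq_zero] at h1
  have h2 : 1 / ((n : ℝ) * m) ^ c < 1 := by
    rw [div_lt_one (by positivity)]
    exact Real.one_lt_rpow hnm hc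
  linarith

/-- The infimum need not be attained in general, which costs the factor 2 when it is positive. When
it is 0, a correct answer of the regression algorithm has loss at most reg · 0 and attains it. -/
theorem exists_vecLoss_le_two_mul_optReg {d m : ℕ} {R : RegressionAlg n d m} {g : ℝ → ℝ}
    (hg : ∀ x, 0 ≤ g x) {reg c : ℝ} (hR : R.Solves g reg c) (hc : 0 < c)
    (hnm : 1 < (n : ℝ) * m) (D : Matrix (Fin n) (Fin d) ℝ) (b : Fin n → ℝ) :
    ∃ x, vecLoss g (D *ᵥ x - b) ≤ 2 * optReg g D b := by
  rcases (optReg_nonneg hg D b).eq_or_lt with h | h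
  · have hm : 0 < m := by
      rcases Nat.eq_zero_or_pos m with rfl | hm
      · norm_num at hnm
      · exact hm
    obtain ⟨o, ho⟩ := hR.exists_correct hc hnm D (Matrix.of fun i _ => b i)
    refine ⟨_, (ho ⟨0, hm⟩).1.trans ?_⟩
    have : (Matrix.of fun i (_ : Fin m) => b i).col ⟨0, hm⟩ = b := by
      ext i
      simp [Matrix.col]
    rw [this, ← h, mul_zero, mul_zero]
  · obtain ⟨x, hx⟩ := exists_lt_of_ciInf_lt (show optReg g D b < 2 * optReg g D b by linarith)
    exact ⟨x, hx.le⟩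

theorem matLoss_sub_eq_sum_vecLoss {ι : Type*} [Fintype ι] (g : ℝ → ℝ)
    (D : Matrix (Fin n) ι ℝ) (X : Matrix ι (Fin n) ℝ) (A : Matrix (Fin n) (Fin n) ℝ) :
    matLoss g (D * X - A) = ∑ l, vecLoss g ((D *ᵥ fun i => X i l) - fun i => A i l) := by
  rw [matLoss, Finset.sum_comm]
  rfl

/-- A combination of listed columns is a combination of the columns in a set that contains them. -/
theorem exists_colsOf_mulVec_eq (A : Matrix (Fin n) (Fin n) ℝ) (S : Finset (Fin n)) {d : ℕ}
    {P : ℕ → ℕ} (hP : ∀ a < d, ∃ j ∈ S, (j : ℕ) = P a) (x : Fin d → ℝ) :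
    ∃ y : S → ℝ, colsOf A S *ᵥ y = listedCols A d P *ᵥ x := by
  choose j hjS hjP using fun a : Fin d => hP a a.2
  refine ⟨fun i => ∑ a, if j a = i then x a else 0, ?_⟩
  ext i
  simp only [Matrix.mulVec, dotProduct, colsOf, Matrix.submatrix_apply, id, listedCols,
    Matrix.of_apply, Finset.mul_sum]
  rw [Finset.sum_comm]
  refine Finset.sum_congr rfl fun a _ => ?_
  rw [Finset.sum_eq_single (⟨j a, hjS a⟩ : S)]
  · rw [if_pos rfl, ← hjP a]
    simp [entryAt]
  · intro b _ hb
    rw [if_neg fun h => hb (Subtype.ext h.symm), mul_zero]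
  · intro h
    exact absurd (Finset.mem_univ _) h

/-- The columns of X are chosen independently, so each column of A may use its own list of design
columns. -/
theorem exists_matLoss_le {d m : ℕ} {R : RegressionAlg n d m} {g : ℝ → ℝ}
    (hg : ∀ x, 0 ≤ g x) {reg c : ℝ} (hR : R.Solves g reg c) (hc : 0 < c)
    (hnm : 1 < (n : ℝ) * m) (A : Matrix (Fin n) (Fin n) ℝ) (S : Finset (Fin n))
    (P : ℕ → ℕ → ℕ) (hP : ∀ l < n, ∀ a < d, ∃ j ∈ S, (j : ℕ) = P l a) :
    ∃ X : Matrix S (Fin n) ℝ,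
      matLoss g (colsOf A S * X - A) ≤ 2 * ∑ l ∈ Finset.range n, colCost g A d (P l) l := by
  have h : ∀ l : Fin n, ∃ y : S → ℝ, vecLoss g ((colsOf A S *ᵥ y) - fun i => A i l)
      ≤ 2 * colCost g A d (P l) l := by
    intro l
    obtain ⟨x, hx⟩ := exists_vecLoss_le_two_mul_optReg hg hR hc hnm (listedCols A d (P l))
      fun i => entryAt A i l
    obtain ⟨y, hy⟩ := exists_colsOf_mulVec_eq A S (hP l l.2) x
    refine ⟨y, ?_⟩
    rw [hy]
    simpa [entryAt, colCost] using hx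
  choose y hy using h
  refine ⟨Matrix.of fun i l => y l i, ?_⟩
  rw [matLoss_sub_eq_sum_vecLoss, Finset.sum_range, Finset.mul_sum]
  exact Finset.sum_le_sum fun l _ => hy l

end

/-! ### The program -/

/-- Set register `4` to eight times the binary length of register `0`. -/
def logProg : Prog :=
  .seq (.setN 14 (.const 1)) (.while (.nle (.reg 14) (.reg 0))
    (.seq (.setN 14 (.add (.reg 14) (.reg 14))) (.setN 4 (.add (.reg 4) (.const 8)))))

/-- Column selection when the number of columns is large. -/
def selectProg : Prog :=
  .seq (.setN 13 (.add (.reg 1) (.reg 1)))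
    (.seq (.setN 2 (.add (.add (.reg 1) (.reg 1)) (.const 1)))
    (.seq logProg (.seq (fillProg 1 12 0 (.reg 8)) (.seq (fillProg 2 12 0 (.reg 8))
      (.seq (.setN 5 (.reg 0)) (.seq (.while (.nle (.const 1) (.reg 5)) roundProg)
        (.setN 0 (.reg 6))))))))

/-- The program; it outputs all columns if their number exceeds `k` by at most `N`. -/
def columnProg (N : ℕ) : Prog :=
  .ite (.nle (.reg 0) (.add (.reg 1) (.const N))) (fillProg 0 12 0 (.reg 8)) selectProg

section

variable {n : ℕ} (A : Matrix (Fin n) (Fin n) ℝ)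

theorem surely_logProg {d m' : ℕ} (R : RegressionAlg n d m') {fuel : ℕ} (s : State)
    (h0 : 1 ≤ s.nreg 0) (h4 : s.nreg 4 = 0) (hfuel : s.nreg 0 < fuel) :
    Surely (run A R fuel logProg s) fun s' =>
      (∀ x, x ≠ 4 → x ≠ 14 → s'.nreg x = s.nreg x) ∧ s'.narr = s.narr ∧
      ∃ a, s'.nreg 4 = 8 * a ∧ s.nreg 0 < 2 ^ a ∧ 2 ^ a ≤ 2 * s.nreg 0 ∧
        s'.time ≤ s.time + 5 + 11 * a := by
  rw [logProg]
  simp only [run, andThen_pure]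
  refine surely_runLoop (s.nreg 0) (fun j s' =>
    (∀ x, x ≠ 4 → x ≠ 14 → s'.nreg x = s.nreg x) ∧ s'.narr = s.narr ∧
      s'.nreg 4 = 8 * j ∧ s'.nreg 14 = 2 ^ j ∧ 2 ^ j ≤ 2 * s.nreg 0 ∧
      s'.time ≤ s.time + 2 + 11 * j) ?_ ?_ hfuel ?_
  · rintro j s' ⟨hn, hna, h4, h14, hle, ht⟩ hb
    simp only [Test.Holds, NExp.eval, h14, hn 0 (by decide) (by decide)] at hb
    refine ⟨hn, hna, j, h4, not_le.1 hb, hle, ?_⟩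
    simp only [State.tick, Test.cost, NExp.cost]
    omega
  · rintro j s' ⟨hn, hna, h4, h14, hle, ht⟩ hb
    simp only [Test.Holds, NExp.eval, h14, hn 0 (by decide) (by decide)] at hb
    -- The crude bound j < 2^j ≤ n on the number of iterations is enough for the fuel; the clock is
    -- bounded through the exponent itself.
    refine ⟨lt_of_lt_of_le Nat.lt_two_pow_self hb, ?_⟩
    refine surely_pure ⟨?_, hna, ?_, ?_, ?_, ?_⟩
    · intro x h4 h14
      simp [State.tick, State.setN, h4, h14, hn x h4 h14]
    · simp [State.tick, State.setN, NExp.eval, h4]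
      ring
    · simp [State.tick, State.setN, NExp.eval, h14]
      ring
    · rw [pow_succ]
      omega
    · simp only [State.tick, State.setN, NExp.cost, Test.cost]
      omega
  · refine ⟨?_, rfl, ?_, ?_, ?_, ?_⟩
    · intro x h4 h14
      simp [State.tick, State.setN, h14]
    · simpa [State.tick, State.setN] using h4
    · simp [State.tick, State.setN, NExp.eval]
    · simpa using by omega
    · simp [State.tick, State.setN, NExp.cost]

/-! ### All rounds -/

/-- After `i` rounds, the removed columns are approximated by the output, and the sum of the costs
is bounded by the sum of the tails of the column losses. -/
def History (g : ℝ → ℝ) (k : ℕ) (f : ℕ → ℝ) (κ : ℝ) (i : ℕ) (F : Finset ℕ) (s : State) : Prop :=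
  ∃ (m : ℕ → ℕ) (b : ℕ → ℝ), (∀ r < i, 20 * m (r + 1) ≤ 19 * m r) ∧ m i = F.card ∧
    (∀ l < n, l ∉ F → ∃ r < i,
      colCost g A (2 * k + 1) (fun a => s.narr 0 (r * (2 * k + 1) + a)) l ≤ b l) ∧
    ∑ l ∈ Finset.range n with l ∉ F, b l ≤ κ * ∑ r ∈ Finset.range i,
      ∑ j ∈ Finset.Ico (m r / (10 * (2 * k + 1))) (m r / (10 * (2 * k + 1)) + m r), f j

theorem history_zero (g : ℝ → ℝ) (k : ℕ) (f : ℕ → ℝ) (κ : ℝ) (s : State) :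
    History A g k f κ 0 (Finset.range n) s := by
  refine ⟨fun _ => n, fun _ => 0, fun r hr => absurd hr (Nat.not_lt_zero r), by simp, ?_, by simp⟩
  intro l hl hl'
  exact absurd (Finset.mem_range.2 hl) hl'

-- A good round charges τ to each removed column, in total at most |F| τ, which is bounded by one
-- more tail.
variable {A} in
theorem History.step {g : ℝ → ℝ} {k L T : ℕ} {f : ℕ → ℝ} {κ : ℝ} {i : ℕ} {F F' : Finset ℕ}
    {s s' : State} (h : History A g k f κ i F s) (hr : RoundPost n k L T F s F' s')
    (hFn : F ⊆ Finset.range n) (h6 : s.nreg 6 = i * (2 * k + 1)) {τ : ℝ} (hτ0 : 0 ≤ τ)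
    (hτ : F.card * τ ≤ κ * ∑ j ∈ Finset.Ico (F.card / (10 * (2 * k + 1)))
      (F.card / (10 * (2 * k + 1)) + F.card), f j)
    (hgood : ∀ l ∈ F, l ∉ F' →
      colCost g A (2 * k + 1) (fun a => s'.narr 0 (s.nreg 6 + a)) l ≤ τ) :
    History A g k f κ (i + 1) F' s' := by
  classical
  obtain ⟨m, b, hm, hmi, hb, hsum⟩ := h
  have hm' : ∀ r ≤ i, Function.update m (i + 1) F'.card r = m r := fun r hr =>
    Function.update_of_ne (by omega) _ _
  -- Columns that survive the round also get the value τ; it is not counted, and a later good round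
  -- replaces it.
  refine ⟨Function.update m (i + 1) F'.card, fun l => if l ∈ F then τ else b l, ?_,
    Function.update_self _ _ _, ?_, ?_⟩
  · intro r hri
    rw [hm' r (by omega)]
    rcases Nat.lt_succ_iff_lt_or_eq.1 hri with hri | rfl
    · rw [hm' (r + 1) hri]
      exact hm r hri
    · rw [Function.update_self, hmi]
      exact hr.card
  · intro l hl hlF'
    by_cases hlF : l ∈ F
    · refine ⟨i, Nat.lt_succ_self i, ?_⟩
      beta_reduce
      rw [if_pos hlF, ← h6]
      exact hgood l hlF hlF'
    · obtain ⟨r, hri, hrl⟩ := hb l hl hlF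
      refine ⟨r, by omega, ?_⟩
      beta_reduce
      rw [if_neg hlF]
      -- The blocks of earlier rounds lie below the current offset and are left unchanged.
      refine le_trans (le_of_eq (colCost_congr g A (fun a ha => hr.output _ ?_) l)) hrl
      rw [h6]
      have : (r + 1) * (2 * k + 1) ≤ i * (2 * k + 1) := Nat.mul_le_mul_right _ hri
      rw [add_mul] at this
      omega
  · have hsplit : ((Finset.range n).filter (· ∉ F'))
        = ((Finset.range n).filter (· ∉ F)) ∪ (F \ F') := by
      ext l
      simp only [Finset.mem_filter, Finset.mem_union, Finset.mem_sdiff]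
      constructor
      · rintro ⟨h1, h2⟩
        by_cases h3 : l ∈ F
        · exact Or.inr ⟨h3, h2⟩
        · exact Or.inl ⟨h1, h3⟩
      · rintro (⟨h1, h2⟩ | ⟨h1, h2⟩)
        · exact ⟨h1, fun h => h2 (hr.subset h)⟩
        · exact ⟨hFn h1, h2⟩
    have hdisj : Disjoint ((Finset.range n).filter (· ∉ F)) (F \ F') :=
      Finset.disjoint_left.2 fun l h1 h2 =>
        (Finset.mem_filter.1 h1).2 (Finset.mem_sdiff.1 h2).1
    have hsum' : ∑ r ∈ Finset.range (i + 1), ∑ j ∈ Finset.Ico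
          (Function.update m (i + 1) F'.card r / (10 * (2 * k + 1)))
          (Function.update m (i + 1) F'.card r / (10 * (2 * k + 1))
            + Function.update m (i + 1) F'.card r), f j
        = ∑ r ∈ Finset.range i, ∑ j ∈ Finset.Ico (m r / (10 * (2 * k + 1)))
            (m r / (10 * (2 * k + 1)) + m r), f j
          + ∑ j ∈ Finset.Ico (F.card / (10 * (2 * k + 1)))
            (F.card / (10 * (2 * k + 1)) + F.card), f j := by
      rw [Finset.sum_range_succ, hm' i le_rfl, hmi]
      congr 1
      refine Finset.sum_congr rfl fun r hr => ?_
      rw [hm' r (Finset.mem_range.1 hr).le]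
    rw [hsum', mul_add, hsplit, Finset.sum_union hdisj]
    refine add_le_add ((le_of_eq (Finset.sum_congr rfl fun l hl => ?_)).trans hsum)
      (le_trans ?_ hτ)
    · exact if_neg (Finset.mem_filter.1 hl).2
    · calc ∑ l ∈ F \ F', (if l ∈ F then τ else b l) = ∑ l ∈ F \ F', τ :=
            Finset.sum_congr rfl fun l hl => if_pos (Finset.mem_sdiff.1 hl).1
        _ = (F \ F').card * τ := by rw [Finset.sum_const, nsmul_eq_mul]
        _ ≤ F.card * τ := by
            gcongr
            exact Finset.sdiff_subset

/-- The columns that remain. -/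
def State.remaining (s : State) : Finset ℕ := (Finset.range (s.nreg 5)).image (s.narr 1)

/-- The invariant of the rounds. -/
structure RoundInv (n k L T N : ℕ) (t₀ i : ℕ) (s : State) : Prop where
  ready : Ready n k L s.remaining s
  offset : s.nreg 6 = i * (2 * k + 1)
  le : i ≤ N
  card : 20 ^ i * s.remaining.card ≤ 19 ^ i * n
  time : s.time ≤ t₀ + i * (403 * (L + 1) * (n + T))

-- The potential prepays ε for each round still possible and adds 1 once the history is broken. By
-- `hN` a nonempty set of survivors can occur only in fewer than `N` rounds, since each round
-- shrinks it by the factor 19/20.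
open Classical in
theorem expect_rounds_le {k L : ℕ} (R : RegressionAlg n (2 * k + 1) n) {g : ℝ → ℝ}
    (hg : ∀ x, 0 ≤ g x) {ati mon reg : ℝ}
    (hati : ApproxTriangle g (2 * k + 1) ati) (hati0 : 0 ≤ ati) (hmon : ApproxMonotone g mon)
    (hreg : 0 ≤ reg) {η : ℝ≥0∞}
    (hη : ∀ D B, (R.law D B).toOuterMeasure {o | RegressionCorrect g reg D B o}ᶜ ≤ η)
    {B : Matrix (Fin n) (Fin n) ℝ} (hB : B.rank ≤ k) {rk : ℕ → ℕ} {f : ℕ → ℝ}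
    (hrk : Set.InjOn rk (Finset.range n)) (hf : Antitone f) (hf0 : ∀ i, 0 ≤ f i)
    (hfw : ∀ l < n, f (rk l) = colLoss g A B l)
    {fuel N : ℕ} (hN : ∀ i, 20 ^ i ≤ 19 ^ i * n → i < N) (hNfuel : N < fuel)
    (hkn : k < n) (hfuel : 2 * n + 1 < fuel) (hL : L < fuel) {s : State}
    (hs : Ready n k L (Finset.range n) s) (h6 : s.nreg 6 = 0) (φ : State → ℝ≥0∞)
    (hφ : ∀ i s', RoundInv n k L R.time N s.time i s' → φ (s'.tick 3) ≤
      if History A g k f (reg * ati * mon * (10 * (2 * k + 1))) i ∅ s' then 0 else 1) :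
    expect (run A R fuel (.while (.nle (.const 1) (.reg 5)) roundProg) s) φ
      ≤ N * (L * η + (3 / 4) ^ L) := by
  set ε : ℝ≥0∞ := L * η + (3 / 4) ^ L with hε
  set κ := reg * ati * mon * (10 * (2 * k + 1)) with hκ
  have hrem : s.remaining = Finset.range n := hs.columns.2
  have hI₀ : RoundInv n k L R.time N s.time 0 s := by
    refine ⟨hrem ▸ hs, by simpa using h6, Nat.zero_le _, ?_, by simp⟩
    rw [hrem]
    simp
  let pot : ℕ → State → ℝ≥0∞ := fun i s' =>
    (N - i : ℕ) * ε + if History A g k f κ i s'.remaining s' then 0 else 1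
  rw [run]
  refine (expect_runLoop_le N (RoundInv n k L R.time N s.time) pot ?_ ?_ fuel 0 s hNfuel hI₀
    (by omega)).trans ?_
  · intro i s' hI hb
    simp only [Test.Holds, NExp.eval] at hb
    have hemp : s'.remaining = ∅ := by
      rw [State.remaining, show s'.nreg 5 = 0 by omega]
      simp
    refine (hφ i s' hI).trans ?_
    dsimp only [pot]
    rw [hemp]
    exact le_add_self
  · intro i s' hI hb
    simp only [Test.Holds, NExp.eval] at hb
    have hcard := hI.ready.columns.card
    have hi : i < N := hN i (le_trans (Nat.le_mul_of_pos_right _ (by omega)) hI.card)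
    refine ⟨hi, ?_⟩
    have hne : s'.remaining.Nonempty := Finset.card_pos.1 (by omega)
    obtain ⟨Bad, τ, hτ0, hτ, hBad, hcount⟩ := exists_bad_event hg hati hati0 hmon hreg A hB hrk hf
      hf0 hfw hI.ready.subset hne
    have hready : Ready n k L s'.remaining (s'.tick 3) := ⟨hI.ready.size, hI.ready.trials,
      hI.ready.zero, hI.ready.samples, hI.ready.columns, hI.ready.subset, hI.ready.targets,
      hI.ready.sample_lt, hI.ready.output_lt⟩
    have hsplit : ((N - i : ℕ) : ℝ≥0∞) * ε = (N - (i + 1) : ℕ) * ε + ε := by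
      rw [show N - i = N - (i + 1) + 1 by omega]
      push_cast
      ring
    have hpot : pot i s' = ((N - (i + 1) : ℕ) * ε +
        if History A g k f κ i s'.remaining s' then 0 else 1) + ε := by
      dsimp only [pot]
      rw [hsplit]
      ring
    rw [hpot]
    refine expect_roundProg_le A R hη hready hne hkn hfuel hL Bad hBad hcount _ _ ?_
    intro s'' F' hpost
    have hF' : s''.remaining = F' := hpost.ready.columns.2
    have hinv : RoundInv n k L R.time N s.time (i + 1) s'' := by
      refine ⟨hF' ▸ hpost.ready, ?_, hi, ?_, ?_⟩
      · rw [hpost.offset, add_mul, one_mul]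
        exact congrArg (· + (2 * k + 1)) hI.offset
      · rw [hF']
        calc 20 ^ (i + 1) * F'.card = 20 ^ i * (20 * F'.card) := by ring
          _ ≤ 20 ^ i * (19 * s'.remaining.card) := Nat.mul_le_mul_left _ hpost.card
          _ = 19 * (20 ^ i * s'.remaining.card) := by ring
          _ ≤ 19 * (19 ^ i * n) := Nat.mul_le_mul_left _ hI.card
          _ = _ := by ring
      · have h1 := hpost.time
        have h2 := hI.time
        simp only [State.tick] at h1
        have h3 : 1 ≤ (L + 1) * (n + R.time) := Nat.mul_pos (by omega) (by omega)
        nlinarith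
    rw [guarded_of hinv]
    dsimp only [pot]
    rw [hF', add_assoc]
    gcongr
    by_cases hh : History A g k f κ i s'.remaining s'
    · rw [if_pos hh, zero_add]
      split_ifs with h1 h2 h2
      · exact le_rfl
      · exact zero_le
      · exact absurd (History.step (s := s'.tick 3) hh hpost hI.ready.subset hI.offset hτ0 hτ h2) h1
      · exact le_rfl
    · rw [if_neg hh]
      refine le_trans ?_ le_self_add
      split_ifs <;> simp
  · dsimp only [pot]
    rw [hrem, if_pos (history_zero A g k f κ s), add_zero, Nat.sub_zero]

end

/-! ### The selection program as a whole, and numerical constants -/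

section

variable {n : ℕ} (A : Matrix (Fin n) (Fin n) ℝ)

open Classical in
theorem expect_selectProg_le {k : ℕ} (R : RegressionAlg n (2 * k + 1) n) {g : ℝ → ℝ}
    (hg : ∀ x, 0 ≤ g x) {ati mon reg : ℝ}
    (hati : ApproxTriangle g (2 * k + 1) ati) (hati0 : 0 ≤ ati) (hmon : ApproxMonotone g mon)
    (hreg : 0 ≤ reg) {η : ℝ≥0∞}
    (hη : ∀ D B, (R.law D B).toOuterMeasure {o | RegressionCorrect g reg D B o}ᶜ ≤ η)
    {B : Matrix (Fin n) (Fin n) ℝ} (hB : B.rank ≤ k) {rk : ℕ → ℕ} {f : ℕ → ℝ}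
    (hrk : Set.InjOn rk (Finset.range n)) (hf : Antitone f) (hf0 : ∀ i, 0 ≤ f i)
    (hfw : ∀ l < n, f (rk l) = colLoss g A B l)
    {fuel N : ℕ} (hN : ∀ i, 20 ^ i ≤ 19 ^ i * n → i < N) (hNfuel : N < fuel)
    (hkn : k < n) (hfuel : 16 * n + 1 < fuel) {e : ℝ≥0∞}
    (he : ∀ a, n < 2 ^ a → 2 ^ a ≤ 2 * n → N * ((8 * a : ℕ) * η + (3 / 4) ^ (8 * a)) ≤ e)
    (φ : State → ℝ≥0∞)
    (hφ : ∀ i a s', n < 2 ^ a → 2 ^ a ≤ 2 * n → i ≤ N → s'.nreg 0 = i * (2 * k + 1) →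
      (∀ b, s'.narr 0 b < n) → s'.time ≤ 600 * (8 * a + 1) * (N + 1) * (n + R.time) →
      φ s' ≤ if History A g k f (reg * ati * mon * (10 * (2 * k + 1))) i ∅ s' then 0 else 1) :
    expect (run A R fuel selectProg ((initState n k).tick 5)) φ ≤ e := by
  rw [selectProg, run, run, andThen_pure, run, run, andThen_pure, run]
  set s₁ := State.tick (State.setN _ 2 _) _ with hs₁
  have hn₁ : ∀ x, x ≠ 2 → x ≠ 13 → s₁.nreg x = (initState n k).nreg x := fun x h2 h13 => by
    simp [hs₁, State.tick, State.setN, h2, h13]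
  have e2 : s₁.nreg 2 = 2 * k + 1 := by
    simp [hs₁, State.tick, State.setN, NExp.eval, initState]
    ring
  have e13 : s₁.nreg 13 = 2 * k := by
    simp [hs₁, State.tick, State.setN, NExp.eval, initState]
    ring
  have e0 : s₁.nreg 0 = n := hn₁ 0 (by decide) (by decide)
  have ha₁ : ∀ a b, s₁.narr a b = 0 := fun _ _ => rfl
  have ht₁ : s₁.time = 15 := by
    simp [hs₁, State.tick, State.setN, NExp.cost, initState]
  clear_value s₁
  refine expect_andThen_le (surely_logProg A R s₁ (by omega)
    (hn₁ 4 (by decide) (by decide)) (by omega)) ?_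
  rintro s₂ ⟨hn₂, ha₂, a, h4, hlt, hle, ht₂⟩
  rw [e0] at hlt hle
  have f0 : s₂.nreg 0 = n := (hn₂ 0 (by decide) (by decide)).trans e0
  have ha8 : a ≤ 2 * n := (Nat.lt_two_pow_self).le.trans hle
  rw [run]
  refine expect_andThen_le (surely_fillProg A R s₂ (by decide) (by decide) id (fun _ _ => rfl)
    (by omega)) ?_
  rintro s₃ ⟨hn₃, -, -, ha₃, hd₃, -, ht₃⟩
  have g0 : s₃.nreg 0 = n := (hn₃ 0 (by decide)).trans f0
  rw [run]
  refine expect_andThen_le (surely_fillProg A R s₃ (by decide) (by decide) id (fun _ _ => rfl)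
    (by omega)) ?_
  rintro s₄ ⟨hn₄, -, -, ha₄, hd₄, -, ht₄⟩
  have z₂ : s₂.nreg 12 = 0 := (hn₂ 12 (by decide) (by decide)).trans
    (hn₁ 12 (by decide) (by decide))
  have z₃ : s₃.nreg 12 = 0 := (hn₃ 12 (by decide)).trans z₂
  rw [f0, z₂] at hd₃
  rw [g0, z₃] at hd₄
  rw [f0] at ht₃
  rw [g0] at ht₄
  simp only [zero_add, id] at hd₃ hd₄
  rw [run, run, andThen_pure, run]
  set s₅ := State.tick (State.setN s₄ 5 _) _ with hs₅
  have hn₅ : ∀ x, x ≠ 4 → x ≠ 5 → x ≠ 8 → x ≠ 14 → s₅.nreg x = s₁.nreg x := by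
    intro x h4 h5 h8 h14
    simp [hs₅, State.tick, State.setN, h5, hn₄ x h8, hn₃ x h8, hn₂ x h4 h14]
  have ha₅ : ∀ b, b ≠ 1 → b ≠ 2 → s₅.narr b = s₁.narr b := by
    intro b h1 h2
    rw [← ha₂, ← ha₃ b h1]
    exact ha₄ b h2
  have hlist : ∀ b < n, s₅.narr 1 b = b := fun b hb =>
    (congrFun (ha₄ 1 (by decide)) b).trans (hd₃ b hb)
  have q5 : s₅.nreg 5 = n := by
    simp [hs₅, State.tick, State.setN, NExp.eval, hn₄ 0 (by decide), g0]
  have ht₅ : s₅.time ≤ 100 * n + 36 := by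
    simp only [hs₅, State.tick, State.setN, NExp.cost] at ht₃ ht₄ ⊢
    omega
  have hready : Ready n k (8 * a) (Finset.range n) s₅ := by
    refine ⟨(hn₅ 2 (by decide) (by decide) (by decide) (by decide)).trans e2, ?_,
      hn₅ 12 (by decide) (by decide) (by decide) (by decide) |>.trans
        (hn₁ 12 (by decide) (by decide)),
      (hn₅ 13 (by decide) (by decide) (by decide) (by decide)).trans e13, ?_,
      Finset.Subset.refl _, hd₄, ?_, ?_⟩
    · simp [hs₅, State.tick, State.setN, hn₄, hn₃, h4]
    · rw [q5]
      refine Lists.congr (arr := id) ⟨Function.injective_id.injOn, Finset.image_id⟩ hlist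
    · intro b
      rw [ha₅ 3 (by decide) (by decide), ha₁]
      omega
    · intro b
      rw [ha₅ 0 (by decide) (by decide), ha₁]
      omega
  have h6 : s₅.nreg 6 = 0 := (hn₅ 6 (by decide) (by decide) (by decide) (by decide)).trans
    (hn₁ 6 (by decide) (by decide))
  clear_value s₅
  rw [expect_andThen]
  refine (expect_rounds_le A R hg hati hati0 hmon hreg hη hB hrk hf hf0 hfw hN hNfuel hkn
    (by omega) (by omega) hready h6 _ ?_).trans (he a hlt hle)
  intro i s' hI
  rw [run, expect_pure]
  refine hφ i a _ hlt hle hI.le ?_ hI.ready.output_lt ?_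
  · simp [State.tick, State.setN, NExp.eval, hI.offset]
  · simp only [State.tick, State.setN, NExp.cost]
    have h1 := hI.time
    have h2 : i * (403 * (8 * a + 1) * (n + R.time)) ≤ N * (403 * (8 * a + 1) * (n + R.time)) :=
      Nat.mul_le_mul_right _ hI.le
    have h3 : n + R.time ≤ (8 * a + 1) * (n + R.time) := Nat.le_mul_of_pos_left _ (by omega)
    have h4 : (600 * (8 * a + 1) * (N + 1) * (n + R.time))
      = N * (403 * (8 * a + 1) * (n + R.time)) + 197 * (N * ((8 * a + 1) * (n + R.time)))
        + 600 * ((8 * a + 1) * (n + R.time)) := by ring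
    rw [h4]
    omega

/-! ### The constants -/

/-- Both a log 2 ≤ 2 log n and log 2 ≤ log n hold, so the left side is at most (17 / log 2) log n.
-/
theorem two_pow_le_imp {n a : ℕ} (hn : 2 ≤ n) (h : 2 ^ a ≤ 2 * n) :
    (8 * a + 1 : ℝ) ≤ 26 * Real.log n := by
  have hl2 := Real.log_two_gt_d9
  have hn0 : (0 : ℝ) < n := by positivity
  have hlog : Real.log 2 ≤ Real.log n := Real.log_le_log (by norm_num) (by exact_mod_cast hn)
  have h1 : Real.log ((2 : ℝ) ^ a) ≤ Real.log (2 * n) :=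
    Real.log_le_log (by positivity) (by exact_mod_cast h)
  rw [Real.log_pow, Real.log_mul (by norm_num) hn0.ne'] at h1
  have ha : (0 : ℝ) ≤ a := Nat.cast_nonneg a
  nlinarith

/-- The source of the factor 20 in `roundBound` and `tailBound`. -/
theorem log_ratio : (1 / 20 : ℝ) ≤ Real.log (20 / 19) := by
  have := Real.one_sub_inv_le_log_of_pos (show (0 : ℝ) < 20 / 19 by norm_num)
  norm_num at this ⊢
  linarith

/-- The number of rounds. -/
def roundBound (n : ℕ) : ℕ := ⌊20 * Real.log n⌋₊ + 1

theorem lt_roundBound {n i : ℕ} (hn : 2 ≤ n) (h : 20 ^ i ≤ 19 ^ i * n) : i < roundBound n := by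
  have hn0 : (0 : ℝ) < n := by positivity
  have h1 : ((20 : ℝ) / 19) ^ i ≤ n := by
    rw [div_pow, div_le_iff₀ (by positivity), mul_comm]
    exact_mod_cast h
  have h2 := Real.log_le_log (by positivity) h1
  rw [Real.log_pow] at h2
  have h3 := log_ratio
  refine Nat.lt_succ_of_le (Nat.le_floor ?_)
  have hi : (0 : ℝ) ≤ i := Nat.cast_nonneg i
  nlinarith

theorem roundBound_add_one_le {n : ℕ} (hn : 2 ≤ n) : (roundBound n + 1 : ℝ) ≤ 23 * Real.log n := by
  have hl2 := Real.log_two_gt_d9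
  have hlog : Real.log 2 ≤ Real.log n := Real.log_le_log (by norm_num) (by exact_mod_cast hn)
  have := Nat.floor_le (show (0 : ℝ) ≤ 20 * Real.log n by linarith)
  rw [roundBound]
  push_cast
  linarith

/-- The number of rounds that a column loss contributes to. -/
def tailBound (k : ℕ) : ℕ := ⌈20 * Real.log (20 * (2 * k + 1))⌉₊

/-- The hypothesis of `sum_tails_le` for q = 10(2k+1): the sizes shrink by the factor 2q within this
many rounds. -/
theorem tailBound_spec (k : ℕ) : 2 * (10 * (2 * k + 1)) * 19 ^ tailBound k ≤ 20 ^ tailBound k := by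
  have h1 : 20 * Real.log (20 * (2 * k + 1)) ≤ tailBound k := Nat.le_ceil _
  have h2 : (20 * (2 * k + 1) : ℝ) ≤ (20 / 19) ^ tailBound k := by
    rw [← Real.log_le_log_iff (by positivity) (by positivity), Real.log_pow]
    have h3 := log_ratio
    have hi : (0 : ℝ) ≤ tailBound k := Nat.cast_nonneg _
    nlinarith
  rw [div_pow, le_div_iff₀ (by positivity)] at h2
  have h3 : (2 * (10 * (2 * k + 1)) * 19 ^ tailBound k : ℝ) ≤ 20 ^ tailBound k := by
    refine le_trans (le_of_eq ?_) h2
    ring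
  exact_mod_cast h3

/-- Since 20(2k+1) ≤ 2^6 (k+1) and log 2 ≤ log(k+1), the logarithm is at most 7 log(k+1); rounding
up adds at most 1 ≤ 2 log(k+1). -/
theorem tailBound_le {k : ℕ} (hk : 1 ≤ k) : (tailBound k : ℝ) ≤ 142 * Real.log (k + 1) := by
  have hl2 := Real.log_two_gt_d9
  have hk' : (1 : ℝ) ≤ k := by exact_mod_cast hk
  have hlog : Real.log 2 ≤ Real.log (k + 1) := Real.log_le_log (by norm_num) (by linarith)
  have h1 : Real.log (20 * (2 * k + 1)) ≤ Real.log (2 ^ 6 * (k + 1)) :=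
    Real.log_le_log (by positivity) (by norm_num; linarith)
  rw [Real.log_mul (x := (2 : ℝ) ^ 6) (by norm_num) (by positivity), Real.log_pow] at h1
  have h0 : 0 ≤ Real.log (20 * (2 * k + 1)) := Real.log_nonneg (by linarith)
  have h2 := (Nat.ceil_lt_add_one (show 0 ≤ 20 * Real.log (20 * (2 * k + 1)) by linarith)).le
  rw [tailBound]
  push_cast at h1
  linarith

-- The total failure probability is of order (log n)^2 n^(-2c) + (log n)/n, which tends to 0 for
-- every c > 0.
open Filter in
theorem exists_threshold {c : ℝ} (hc : 0 < c) : ∃ N₀ : ℕ, ∀ n : ℕ, N₀ ≤ n → 2 ≤ n → ∀ a : ℕ,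
    n < 2 ^ a → 2 ^ a ≤ 2 * n →
    (roundBound n : ℝ≥0∞) * ((8 * a : ℕ) * ENNReal.ofReal (1 / ((n : ℝ) * n) ^ c)
      + (3 / 4) ^ (8 * a)) ≤ ENNReal.ofReal (1 / 100) := by
  -- With 1/5000 the final estimate is 598/5000^2 + 23/5000 < 1/100.
  have h1 := ((isLittleO_log_rpow_atTop hc).def (show (0 : ℝ) < 1 / 5000 by norm_num)).and
    ((isLittleO_log_rpow_atTop one_pos).def (show (0 : ℝ) < 1 / 5000 by norm_num))
  obtain ⟨N₀, hN₀⟩ := eventually_atTop.1 (tendsto_natCast_atTop_atTop.eventually h1)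
  refine ⟨N₀, fun n hn hn2 a ha ha' => ?_⟩
  obtain ⟨hlog1, hlog2⟩ := hN₀ n hn
  have hn0 : (0 : ℝ) < n := by positivity
  have hlogn : 0 ≤ Real.log n := Real.log_natCast_nonneg n
  rw [Real.norm_of_nonneg hlogn, Real.norm_of_nonneg (by positivity)] at hlog1 hlog2
  rw [Real.rpow_one] at hlog2
  have hq : (3 / 4 : ℝ≥0∞) = ENNReal.ofReal (3 / 4) := by
    rw [ENNReal.ofReal_div_of_pos (by norm_num)]
    simp
  have hLn := two_pow_le_imp hn2 ha'
  have hRn := roundBound_add_one_le hn2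
  set η : ℝ := 1 / ((n : ℝ) * n) ^ c with hη
  have hη0 : 0 ≤ η := by positivity
  rw [hq, ← ENNReal.ofReal_pow (by norm_num), ← ENNReal.ofReal_natCast, ← ENNReal.ofReal_natCast,
    ← ENNReal.ofReal_mul (by positivity), ← ENNReal.ofReal_add (by positivity) (by positivity),
    ← ENNReal.ofReal_mul (by positivity)]
  refine ENNReal.ofReal_le_ofReal ?_
  -- Eight trials for each binary digit of n suffice because (3/4)^8 ≤ 1/2.
  have hpow : ((3 : ℝ) / 4) ^ (8 * a) ≤ 1 / n := by
    rw [pow_mul]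
    calc (((3 : ℝ) / 4) ^ 8) ^ a ≤ (1 / 2) ^ a := by gcongr; norm_num
      _ = 1 / 2 ^ a := by rw [div_pow, one_pow]
      _ ≤ 1 / n := by
          gcongr
          exact_mod_cast ha.le
  have hηlog : Real.log n * Real.log n * η ≤ (1 / 5000) * (1 / 5000) := by
    rw [hη, mul_one_div, div_le_iff₀ (by positivity), Real.mul_rpow hn0.le hn0.le]
    calc Real.log n * Real.log n ≤ (1 / 5000 * (n : ℝ) ^ c) * (1 / 5000 * (n : ℝ) ^ c) := by
          gcongr
      _ = _ := by ring
  have hnlog : Real.log n * (1 / n) ≤ 1 / 5000 := by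
    rw [mul_one_div, div_le_iff₀ hn0]
    exact hlog2
  push_cast
  calc (roundBound n : ℝ) * (8 * a * η + (3 / 4) ^ (8 * a))
      ≤ (23 * Real.log n) * (26 * Real.log n * η + 1 / n) := by
        have h26 : 8 * (a : ℝ) * η ≤ 26 * Real.log n * η :=
          mul_le_mul_of_nonneg_right (by linarith) hη0
        exact mul_le_mul (by linarith) (add_le_add h26 hpow) (by positivity) (by positivity)
    _ = 598 * (Real.log n * Real.log n * η) + 23 * (Real.log n * (1 / n)) := by ring
    _ ≤ _ := by linarith

end

/-! ### Near-optimal matrices, and correctness for many columns -/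

section

variable {n : ℕ} (A : Matrix (Fin n) (Fin n) ℝ)

theorem exists_pos_le_of_pos {ι : Type*} [Finite ι] (f : ι → ℝ) :
    ∃ δ > 0, ∀ x, 0 < f x → δ ≤ f x := by
  classical
  have := Fintype.ofFinite ι
  rcases (Finset.univ.filter fun x => 0 < f x).eq_empty_or_nonempty with h | h
  · refine ⟨1, one_pos, fun x hx => ?_⟩
    have : x ∈ Finset.univ.filter fun x => 0 < f x := by simpa using hx
    rw [h] at this
    exact absurd this (Finset.notMem_empty x)
  · obtain ⟨y, hy, hmin⟩ := Finset.exists_min_image _ f h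
    exact ⟨f y, (Finset.mem_filter.1 hy).2, fun x hx => hmin x (by simpa using hx)⟩

theorem optRank_nonneg {g : ℝ → ℝ} (hg : ∀ x, 0 ≤ g x) (k : ℕ) : 0 ≤ optRank g A k :=
  Real.iInf_nonneg fun _ => matLoss_nonneg hg _

theorem exists_matLoss_lt {g : ℝ → ℝ} {k : ℕ} {x : ℝ} (hx : optRank g A k < x) :
    ∃ B : Matrix (Fin n) (Fin n) ℝ, B.rank ≤ k ∧ matLoss g (B - A) < x := by
  have : Nonempty {B : Matrix (Fin n) (Fin n) ℝ // B.rank ≤ k} := ⟨⟨0, by simp⟩⟩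
  obtain ⟨B, hB⟩ := exists_lt_of_ciInf_lt hx
  exact ⟨B.1, B.2, hB⟩

/-- A matrix of rank at most `k` that serves as an optimal one: since the costs of the columns take
finitely many values, this is possible even where the infimum is `0` and not attained. -/
theorem exists_near_optimal {g : ℝ → ℝ} (hg : ∀ x, 0 ≤ g x) (k d : ℕ) {Z : ℝ} (hZ : 0 ≤ Z) :
    ∃ B : Matrix (Fin n) (Fin n) ℝ, B.rank ≤ k ∧ ∀ P : ℕ → ℕ → ℕ,
      (∀ l < n, ∀ a < d, P l a < n) →
      ∑ l ∈ Finset.range n, colCost g A d (P l) l ≤ Z * matLoss g (B - A) →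
      2 * ∑ l ∈ Finset.range n, colCost g A d (P l) l ≤ 4 * Z * optRank g A k := by
  rcases (optRank_nonneg A hg k).eq_or_lt with h0 | h0
  -- A column cost is determined by a d-tuple of columns and a target, so there is a least positive
  -- value δ; a sum of costs below δ has only zero terms.
  · obtain ⟨δ, hδ, hmin⟩ := exists_pos_le_of_pos
      fun p : (Fin d → Fin n) × Fin n =>
        colCost g A d (overlay 0 (fun a => (p.1 a : ℕ)) fun _ => 0) p.2
    obtain ⟨B, hB, hlt⟩ := exists_matLoss_lt A (g := g) (k := k) (x := δ / (Z + 1))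
      (h0 ▸ by positivity)
    refine ⟨B, hB, fun P hP hsum => ?_⟩
    have hlt' : ∑ l ∈ Finset.range n, colCost g A d (P l) l < δ := by
      rw [lt_div_iff₀ (by positivity)] at hlt
      nlinarith [matLoss_nonneg hg (B - A)]
    have hzero : ∀ l ∈ Finset.range n, colCost g A d (P l) l = 0 := by
      intro l hl
      have hl' := Finset.mem_range.1 hl
      refine le_antisymm (not_lt.1 fun hpos => ?_) (optReg_nonneg hg _ _)
      have heq : colCost g A d (overlay 0 (fun a : Fin d => P l a) fun _ => 0) l
          = colCost g A d (P l) l := colCost_congr g A (fun a ha => by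
        unfold overlay
        rw [dif_pos (by omega)]
        rfl) l
      have h1 := hmin (fun a => ⟨P l a, hP l hl' a a.2⟩, ⟨l, hl'⟩)
        (by simpa only [heq] using hpos)
      simp only [heq] at h1
      have h2 := Finset.single_le_sum (f := fun l => colCost g A d (P l) l)
        (fun l _ => optReg_nonneg hg _ _) hl
      linarith
    rw [Finset.sum_eq_zero hzero, ← h0]
    simp
  -- One factor 2 comes from B, the other from the unattained regression minima.
  · obtain ⟨B, hB, hlt⟩ := exists_matLoss_lt A (g := g) (k := k) (x := 2 * optRank g A k)
      (by linarith)
    refine ⟨B, hB, fun P _ hsum => ?_⟩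
    have := mul_le_mul_of_nonneg_left hlt.le hZ
    linarith

theorem mem_outputSet {s : State} {i : ℕ} (hi : i < s.nreg 0) (hn : s.narr 0 i < n) :
    (⟨s.narr 0 i, hn⟩ : Fin n) ∈ outputSet n s := by
  rw [outputSet, Finset.mem_filter]
  exact ⟨Finset.mem_univ _, Finset.mem_image_of_mem _ (Finset.mem_range.2 hi)⟩

theorem card_outputSet_le (s : State) : (outputSet n s).card ≤ s.nreg 0 := by
  rw [outputSet]
  refine (Finset.card_le_card_of_injOn (t := (Finset.range (s.nreg 0)).image (s.narr 0)) Fin.val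
    (fun j hj => (Finset.mem_filter.1 hj).2) Fin.val_injective.injOn).trans ?_
  exact Finset.card_image_le.trans (by simp)

-- Each column is assigned the output block of the round that removed it; block r occupies the
-- positions from r(2k+1) on.
variable {A} in
theorem History.exists_assignment {g : ℝ → ℝ} {k : ℕ} {f : ℕ → ℝ}
    {κ : ℝ} {i : ℕ} {s : State} {B : Matrix (Fin n) (Fin n) ℝ} (h : History A g k f κ i ∅ s)
    (hκ : 0 ≤ κ) (hf0 : ∀ i, 0 ≤ f i) (hfn : ∀ i, n ≤ i → f i = 0)
    (hfsum : ∑ i ∈ Finset.range n, f i = ∑ l ∈ Finset.range n, colLoss g A B l)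
    (h0 : s.nreg 0 = i * (2 * k + 1)) (hlt : ∀ b, s.narr 0 b < n) :
    ∃ P : ℕ → ℕ → ℕ, (∀ l < n, ∀ a < 2 * k + 1, P l a < n) ∧
      (∀ l < n, ∀ a < 2 * k + 1, ∃ j ∈ outputSet n s, (j : ℕ) = P l a) ∧
      ∑ l ∈ Finset.range n, colCost g A (2 * k + 1) (P l) l
        ≤ κ * tailBound k * matLoss g (B - A) := by
  obtain ⟨m, b, hm, -, hb, hsum⟩ := h
  have hb' : ∀ l, ∃ r, l < n → r < i ∧
      colCost g A (2 * k + 1) (fun a => s.narr 0 (r * (2 * k + 1) + a)) l ≤ b l := by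
    intro l
    by_cases hl : l < n
    · obtain ⟨r, hr⟩ := hb l hl (Finset.notMem_empty l)
      exact ⟨r, fun _ => hr⟩
    · exact ⟨0, fun h => absurd h hl⟩
  choose r hr using hb'
  refine ⟨fun l a => s.narr 0 (r l * (2 * k + 1) + a), fun l _ a _ => hlt _, ?_, ?_⟩
  · intro l hl a ha
    refine ⟨⟨_, hlt _⟩, mem_outputSet ?_ (hlt _), rfl⟩
    rw [h0]
    have : (r l + 1) * (2 * k + 1) ≤ i * (2 * k + 1) := Nat.mul_le_mul_right _ (hr l hl).1
    rw [add_mul] at this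
    omega
  · have h1 : ∑ l ∈ Finset.range n,
        colCost g A (2 * k + 1) (fun a => s.narr 0 (r l * (2 * k + 1) + a)) l
        ≤ ∑ l ∈ Finset.range n, b l :=
      Finset.sum_le_sum fun l hl => (hr l (Finset.mem_range.1 hl)).2
    have h2 := sum_tails_le hf0 hfn (R := i) (fun r hr => hm r (by omega))
      (by positivity : 0 < 10 * (2 * k + 1)) (tailBound_spec k)
    simp only [Finset.notMem_empty, not_false_eq_true, Finset.filter_true] at hsum
    rw [hfsum, ← matLoss_eq_sum_colLoss] at h2
    calc _ ≤ _ := h1.trans hsum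
      _ ≤ κ * (tailBound k * matLoss g (B - A)) := mul_le_mul_of_nonneg_left h2 hκ
      _ = _ := by ring

/-- Column selection when `n` is large. -/
theorem columnProg_large {c : ℝ} (hc : 0 < c) {N₀ k : ℕ} (hkn : k + N₀ < n) (hn : 2 ≤ n)
    (hN₀ : ∀ a : ℕ, n < 2 ^ a → 2 ^ a ≤ 2 * n →
      (roundBound n : ℝ≥0∞) * ((8 * a : ℕ) * ENNReal.ofReal (1 / ((n : ℝ) * n) ^ c)
        + (3 / 4) ^ (8 * a)) ≤ ENNReal.ofReal (1 / 100))
    {g : ℝ → ℝ} (hg : ∀ x, 0 ≤ g x) {ati mon reg : ℝ}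
    (hati : ApproxTriangle g (2 * k + 1) ati) (hati0 : 0 ≤ ati) (hmon : ApproxMonotone g mon)
    (hreg : 0 ≤ reg) (R : RegressionAlg n (2 * k + 1) n) (hR : R.Solves g reg c) :
    ∃ fuel : ℕ,
      (∀ o ∈ (run A R fuel (columnProg N₀) (initState n k)).support, ∃ s : State, o = some s ∧
        (s.time : ℝ) ≤ 400000 * ((n : ℝ) + R.time) * Real.log n ^ 2 ∧
        ((outputSet n s).card : ℝ) ≤ 23 * (2 * k + 1) * Real.log n) ∧
      ENNReal.ofReal 0.99 ≤ (run A R fuel (columnProg N₀) (initState n k)).toOuterMeasure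
        {o | ∃ s : State, o = some s ∧ ∃ X : Matrix (outputSet n s) (Fin n) ℝ,
          matLoss g (colsOf A (outputSet n s) * X - A) ≤
            4 * (reg * ati * mon * (10 * (2 * k + 1)) * tailBound k) * optRank g A k} := by
  classical
  have hmon0 : 0 ≤ mon := zero_le_one.trans hmon.1
  set κ := reg * ati * mon * (10 * (2 * k + 1)) with hκ
  have hκ0 : 0 ≤ κ := by positivity
  have hnn : 1 < (n : ℝ) * n := by
    have : (2 : ℝ) ≤ n := by exact_mod_cast hn
    nlinarith
  obtain ⟨B, hB, hBopt⟩ := exists_near_optimal A hg k (2 * k + 1)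
    (Z := κ * tailBound k) (by positivity)
  obtain ⟨rk, f, hrk, hf, hf0, hfn, hfw, hfsum⟩ := exists_sorted_values_range n (colLoss g A B)
    fun l => vecLoss_nonneg hg _
  let Safe : State → Prop := fun s => (s.time : ℝ) ≤ 400000 * ((n : ℝ) + R.time) * Real.log n ^ 2 ∧
    ((outputSet n s).card : ℝ) ≤ 23 * (2 * k + 1) * Real.log n
  let Good : State → Prop := fun s => ∃ X : Matrix (outputSet n s) (Fin n) ℝ,
    matLoss g (colsOf A (outputSet n s) * X - A) ≤ 4 * (κ * tailBound k) * optRank g A k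
  -- A finite expectation forces `Safe` on the whole support, and its value bounds the probability
  -- that `Good` fails.
  let φ : State → ℝ≥0∞ := guarded Safe fun s => if Good s then 0 else 1
  -- The number of trials in a round is 8a ≤ 16n, and `roundBound n` covers the loop of rounds.
  set fuel := 16 * n + roundBound n + 2 with hfuel
  have hrun : run A R fuel (columnProg N₀) (initState n k)
      = run A R fuel selectProg ((initState n k).tick 5) := by
    rw [columnProg, run, if_neg]
    · rfl
    · simp only [Test.Holds, NExp.eval, initState]
      norm_num
      exact hkn
  have hmain : expect (run A R fuel (columnProg N₀) (initState n k)) φ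
      ≤ ENNReal.ofReal (1 / 100) := by
    rw [hrun]
    refine expect_selectProg_le A R hg hati hati0 hmon hreg hR.incorrect_le hB hrk hf hf0 hfw
      (fun i hi => lt_roundBound hn hi) (by omega) (by omega) (by omega) hN₀ φ ?_
    intro i a s ha ha' hi h0 hlt ht
    have hR1 := roundBound_add_one_le hn
    have hlog : 0 ≤ Real.log n := Real.log_natCast_nonneg n
    have hsafe : Safe s := by
      constructor
      · have hL := two_pow_le_imp hn ha'
        have ht' : (s.time : ℝ) ≤ 600 * (8 * a + 1) * (roundBound n + 1) * (n + R.time) := by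
          exact_mod_cast ht
        have hmul : ((8 * a + 1 : ℝ) * (roundBound n + 1))
            ≤ (26 * Real.log n) * (23 * Real.log n) := by gcongr
        have hpos : (0 : ℝ) ≤ (n : ℝ) + R.time := by positivity
        calc (s.time : ℝ) ≤ 600 * ((8 * a + 1) * (roundBound n + 1)) * (n + R.time) := by
              linarith
          _ ≤ 600 * ((26 * Real.log n) * (23 * Real.log n)) * (n + R.time) := by gcongr
          _ = 358800 * ((n + R.time) * Real.log n ^ 2) := by ring
          _ ≤ 400000 * ((n + R.time) * Real.log n ^ 2) := by gcongr; norm_num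
          _ = _ := by ring
      · have h1 : ((outputSet n s).card : ℝ) ≤ i * (2 * k + 1) := by
          have := card_outputSet_le (n := n) s
          rw [h0] at this
          exact_mod_cast this
        have h2 : (i : ℝ) ≤ 23 * Real.log n := by
          have : (i : ℝ) ≤ roundBound n := by exact_mod_cast hi
          linarith
        calc _ ≤ _ := h1
          _ ≤ 23 * Real.log n * (2 * k + 1) := by gcongr
          _ = _ := by ring
    rw [show φ s = if Good s then 0 else 1 from guarded_of hsafe]
    by_cases hh : History A g k f κ i ∅ s
    · rw [if_pos hh, if_pos]
      obtain ⟨P, hPn, hPS, hsum⟩ := hh.exists_assignment hκ0 hf0 hfn hfsum h0 hlt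
      obtain ⟨X, hX⟩ := exists_matLoss_le hg hR hc hnn A (outputSet n s) P hPS
      exact ⟨X, hX.trans (hBopt P hPn hsum)⟩
    · rw [if_neg hh]
      split_ifs <;> simp
  refine ⟨fuel, ?_, ?_⟩
  · exact support_of_expect_guarded_ne_top (ne_top_of_le_ne_top ENNReal.ofReal_ne_top hmain)
  · rw [show (0.99 : ℝ) = 1 - 1 / 100 by norm_num]
    refine le_toOuterMeasure_of_expect_le (by norm_num) hmain fun s hs => ?_
    have hg : ¬ Good s := fun ⟨X, hX⟩ => hs ⟨s, rfl, X, hX⟩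
    dsimp only [φ, guarded]
    rw [if_neg hg]
    split_ifs <;> simp

/-! ### Few columns -/

theorem colsOf_mul_eq_self (S : Finset (Fin n)) (hS : S = Finset.univ) :
    ∃ X : Matrix S (Fin n) ℝ, colsOf A S * X = A := by
  classical
  subst hS
  refine ⟨Matrix.of fun j l => if j.1 = l then 1 else 0, ?_⟩
  ext i l
  rw [Matrix.mul_apply, Finset.sum_eq_single (⟨l, Finset.mem_univ l⟩ : (Finset.univ : Finset (Fin n)))]
  · simp [colsOf]
  · intro j _ hj
    have : j.1 ≠ l := fun h => hj (Subtype.ext h)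
    simp [this]
  · intro h
    exact absurd (Finset.mem_univ _) h

/-- As g 0 may be positive, reproducing A exactly is not free; monotonicity compares g 0 with the
loss of each entry of B - A. -/
theorem matLoss_zero_le {g : ℝ → ℝ} {mon : ℝ} (hmon : ApproxMonotone g mon) (k : ℕ) :
    matLoss g (0 : Matrix (Fin n) (Fin n) ℝ) ≤ mon * optRank g A k := by
  have hmon0 : 0 < mon := zero_lt_one.trans_le hmon.1
  rw [← div_le_iff₀' hmon0]
  have : Nonempty {B : Matrix (Fin n) (Fin n) ℝ // B.rank ≤ k} := ⟨⟨0, by simp⟩⟩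
  refine le_ciInf fun B => ?_
  rw [div_le_iff₀' hmon0, matLoss, matLoss, Finset.mul_sum]
  refine Finset.sum_le_sum fun i _ => ?_
  rw [Finset.mul_sum]
  exact Finset.sum_le_sum fun j _ => hmon.2 _ _ (by simp)

theorem columnProg_small {N₀ k : ℕ} (hkn : n ≤ k + N₀) (hn : 2 ≤ n)
    {g : ℝ → ℝ} {mon : ℝ} (hmon : ApproxMonotone g mon) (R : RegressionAlg n (2 * k + 1) n) :
    ∃ fuel : ℕ,
      (∀ o ∈ (run A R fuel (columnProg N₀) (initState n k)).support, ∃ s : State, o = some s ∧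
        (s.time : ℝ) ≤ 30 * ((n : ℝ) + R.time) ∧ ((outputSet n s).card : ℝ) ≤ k + N₀) ∧
      ENNReal.ofReal 0.99 ≤ (run A R fuel (columnProg N₀) (initState n k)).toOuterMeasure
        {o | ∃ s : State, o = some s ∧ ∃ X : Matrix (outputSet n s) (Fin n) ℝ,
          matLoss g (colsOf A (outputSet n s) * X - A) ≤ mon * optRank g A k} := by
  classical
  let Safe : State → Prop := fun s => (s.time : ℝ) ≤ 30 * ((n : ℝ) + R.time) ∧
    ((outputSet n s).card : ℝ) ≤ k + N₀
  let Good : State → Prop := fun s => ∃ X : Matrix (outputSet n s) (Fin n) ℝ,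
    matLoss g (colsOf A (outputSet n s) * X - A) ≤ mon * optRank g A k
  have hrun : run A R (n + 1) (columnProg N₀) (initState n k)
      = run A R (n + 1) (fillProg 0 12 0 (.reg 8)) ((initState n k).tick 5) := by
    rw [columnProg, run, if_pos]
    · rfl
    · simp only [Test.Holds, NExp.eval, initState]
      norm_num
      exact hkn
  have hmain : expect (run A R (n + 1) (columnProg N₀) (initState n k))
      (guarded (fun s => Safe s ∧ Good s) fun _ => 0) ≤ 0 := by
    rw [hrun]
    refine surely_fillProg A R _ (by decide) (by decide) id (fun _ _ => rfl)
      (Nat.lt_succ_self _) _ _ ?_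
    rintro s ⟨hn', -, -, -, hd, -, ht⟩
    have h0 : s.nreg 0 = n := hn' 0 (by decide)
    have hd' : ∀ a < n, s.narr 0 a = a := fun a ha => by
      have := hd a ha
      simpa [State.tick, initState] using this
    have hS : outputSet n s = Finset.univ := by
      refine Finset.eq_univ_iff_forall.2 fun j => ?_
      have h1 : s.narr 0 j = j := hd' j j.2
      have h2 := mem_outputSet (n := n) (s := s) (i := j) (h0 ▸ j.2) (by rw [h1]; exact j.2)
      simpa [h1] using h2
    refine (guarded_of ⟨⟨?_, ?_⟩, ?_⟩).le
    · have h1 : s.time ≤ 30 * (n + R.time) := by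
        refine ht.trans ?_
        simp only [State.tick, initState, NExp.cost, if_true]
        omega
      exact_mod_cast h1
    · rw [hS, Finset.card_univ, Fintype.card_fin]
      exact_mod_cast hkn
    · obtain ⟨X, hX⟩ := colsOf_mul_eq_self A (outputSet n s) hS
      refine ⟨X, ?_⟩
      rw [hX, sub_self]
      exact matLoss_zero_le A hmon k
  refine ⟨n + 1, ?_, ?_⟩
  · intro o ho
    obtain ⟨s, hs, hsafe, -⟩ := support_of_expect_guarded_ne_top
      (ne_top_of_le_ne_top ENNReal.zero_ne_top hmain) o ho
    exact ⟨s, hs, hsafe⟩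
  · refine (ENNReal.ofReal_le_ofReal (by norm_num : (0.99 : ℝ) ≤ 1 - 0)).trans
      (le_toOuterMeasure_of_expect_le le_rfl (hmain.trans (by simp)) fun s hs => ?_)
    have hg : ¬ Good s := fun ⟨X, hX⟩ => hs ⟨s, rfl, X, hX⟩
    rw [guarded, if_neg fun h => hg h.2]
    exact le_top

/-! ### The parameters -/

/-- The inequality is applied to x padded with zeros. -/
theorem ApproxTriangle.pos {g : ℝ → ℝ} (hg : ∀ x, 0 ≤ g x) {k : ℕ} {ati : ℝ}
    (h : ApproxTriangle g (2 * k + 1) ati) {x : ℝ} (hx : 0 < g x) : 0 < ati := by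
  have h1 := h fun i => if i = 0 then x else 0
  rw [Finset.sum_ite_eq' Finset.univ (0 : Fin (2 * k + 1)) fun _ => x,
    if_pos (Finset.mem_univ _)] at h1
  exact pos_of_mul_pos_left (hx.trans_le h1) (Finset.sum_nonneg fun _ _ => hg _)

/-- If g 0 = 0, padding x with zeros gives 1 ≤ ati. If g 0 > 0, a sum of zeros gives only the weaker
bound with the factor 2k+1. -/
theorem ApproxTriangle.one_le {g : ℝ → ℝ} (hg : ∀ x, 0 ≤ g x) {k : ℕ} {ati : ℝ}
    (h : ApproxTriangle g (2 * k + 1) ati) {x : ℝ} (hx : 0 < g x) : 1 ≤ ati * (2 * k + 1) := by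
  rcases (hg 0).eq_or_lt with h0 | h0
  · have h1 := h fun i => if i = 0 then x else 0
    have h2 : ∀ i : Fin (2 * k + 1), g (if i = 0 then x else 0) = if i = 0 then g x else 0 := by
      intro i
      split_ifs
      exacts [rfl, h0.symm]
    simp only [h2, Finset.sum_ite_eq', Finset.mem_univ, if_true] at h1
    have h3 : 1 ≤ ati := by
      by_contra! hlt
      nlinarith
    have hk : (0 : ℝ) ≤ k := Nat.cast_nonneg k
    nlinarith
  · have h1 := h fun _ => 0
    simp only [Finset.sum_const_zero, Finset.sum_const, Finset.card_univ, Fintype.card_fin,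
      nsmul_eq_mul] at h1
    push_cast at h1
    by_contra! hlt
    nlinarith

/-- The parameters are not assumed nonnegative; passing to absolute values lets the main estimates
use nonnegative ones. -/
theorem ApproxTriangle.abs {g : ℝ → ℝ} (hg : ∀ x, 0 ≤ g x) {t : ℕ} {ati : ℝ}
    (h : ApproxTriangle g t ati) : ApproxTriangle g t |ati| := fun x =>
  (h x).trans (mul_le_mul_of_nonneg_right (le_abs_self _) (Finset.sum_nonneg fun _ _ => hg _))

theorem RegressionAlg.Solves.abs {d m : ℕ} {R : RegressionAlg n d m} {g : ℝ → ℝ} {reg c : ℝ}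
    (hg : ∀ x, 0 ≤ g x) (hR : R.Solves g reg c) : R.Solves g |reg| c := fun D B => by
  refine (hR D B).trans ((R.law D B).toOuterMeasure.mono fun o ho i => ?_)
  have h := mul_le_mul_of_nonneg_right (le_abs_self reg) (optReg_nonneg hg D (B.col i))
  exact ⟨(ho i).1.trans h, (ho i).2.1, (ho i).2.2.trans h⟩

/-- With design matrix 0 and all targets equal to -x the optimum is n g(x) > 0, and a correct
estimate lies between it and reg times it. -/
theorem RegressionAlg.Solves.one_le {d m : ℕ} {R : RegressionAlg n d m} {g : ℝ → ℝ} {reg c : ℝ}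
    (hR : R.Solves g reg c) (hc : 0 < c) (hnm : 1 < (n : ℝ) * m) {x : ℝ}
    (hx : 0 < g x) : 1 ≤ reg := by
  have hn : 0 < n := by
    rcases Nat.eq_zero_or_pos n with rfl | h
    · norm_num at hnm
    · exact h
  have hm : 0 < m := by
    rcases Nat.eq_zero_or_pos m with rfl | h
    · norm_num at hnm
    · exact h
  obtain ⟨o, ho⟩ := hR.exists_correct hc hnm 0 (Matrix.of fun _ _ => - x)
  have h1 := (ho ⟨0, hm⟩).2
  set b : Fin n → ℝ := (Matrix.of fun (_ : Fin n) (_ : Fin m) => - x).col ⟨0, hm⟩ with hb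
  have hopt : optReg g (0 : Matrix (Fin n) (Fin d) ℝ) b = n * g x := by
    have : ∀ y : Fin d → ℝ, vecLoss g ((0 : Matrix (Fin n) (Fin d) ℝ) *ᵥ y - b) = n * g x := by
      intro y
      simp [vecLoss, hb, Matrix.col]
    rw [optReg]
    simp only [this]
    exact ciInf_const
  have hpos : 0 < optReg g (0 : Matrix (Fin n) (Fin d) ℝ) b := by
    rw [hopt]
    positivity
  have h2 := h1.1.trans h1.2
  by_contra! hlt
  nlinarith

theorem optRank_eq_zero {g : ℝ → ℝ} (h : ∀ x, g x = 0) (k : ℕ) : optRank g A k = 0 := by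
  have : Nonempty {B : Matrix (Fin n) (Fin n) ℝ // B.rank ≤ k} := ⟨⟨0, by simp⟩⟩
  rw [optRank]
  simp only [matLoss, h, Finset.sum_const_zero]
  exact ciInf_const

end

end LossLowRank

end

/-! ### The main theorem: choice of the constants and the two ranges of n -/

theorem mainTheorem1 (c : ℝ) (hc : 0 < c) :
    ∃ (alg : LossLowRank.Prog) (C : ℝ) (e : ℕ),
      ∀ (k n : ℕ), 1 ≤ k → 2 ≤ n →
      ∀ (g : ℝ → ℝ), (∀ x, 0 ≤ g x) →
      ∀ (ati mon reg : ℝ),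
        LossLowRank.ApproxTriangle g (2 * k + 1) ati →
        LossLowRank.ApproxMonotone g mon →
      ∀ (R : LossLowRank.RegressionAlg n (2 * k + 1) n), R.Solves g reg c →
      ∀ (A : Matrix (Fin n) (Fin n) ℝ),
      ∃ fuel : ℕ,
        (∀ o ∈ (LossLowRank.run A R fuel alg (LossLowRank.initState n k)).support,
          ∃ s : LossLowRank.State, o = some s ∧
            (s.time : ℝ) ≤ C * ((n : ℝ) + (R.time : ℝ)) * Real.log n ^ e ∧
            ((LossLowRank.outputSet n s).card : ℝ) ≤ C * k * Real.log n) ∧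
        ENNReal.ofReal 0.99 ≤
          (LossLowRank.run A R fuel alg (LossLowRank.initState n k)).toOuterMeasure
            {o | ∃ s : LossLowRank.State, o = some s ∧
              ∃ X : Matrix (LossLowRank.outputSet n s) (Fin n) ℝ,
                LossLowRank.matLoss g (LossLowRank.colsOf A (LossLowRank.outputSet n s) * X - A) ≤
                  ati * mon * reg * (C * k * Real.log (k + 1)) *
                    LossLowRank.optRank g A k} := by
  open LossLowRank in
  obtain ⟨N₀, hN₀⟩ := exists_threshold hc
  -- 400000 comes from the running time for large n; 2 N₀ absorbs the output size k + N₀ of the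
  -- other range, because k ≥ 1 and log n ≥ 1/2.
  refine ⟨columnProg N₀, 400000 + 2 * N₀, 2, ?_⟩
  intro k n hk hn g hg ati mon reg hati hmon R hR A
  have hl2 := Real.log_two_gt_d9
  have hn' : (2 : ℝ) ≤ n := by exact_mod_cast hn
  have hk' : (1 : ℝ) ≤ k := by exact_mod_cast hk
  have hlogn : (1 / 2 : ℝ) ≤ Real.log n := by
    have := Real.log_le_log (by norm_num) hn'
    linarith
  have hlogk : (1 / 2 : ℝ) ≤ Real.log (k + 1) := by
    have := Real.log_le_log (by norm_num) (show (2 : ℝ) ≤ k + 1 by linarith)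
    linarith
  have hN0 : (0 : ℝ) ≤ N₀ := Nat.cast_nonneg _
  have hmon0 : 0 ≤ mon := zero_le_one.trans hmon.1
  have hopt0 := optRank_nonneg A hg k
  have hnn : 1 < (n : ℝ) * n := by nlinarith
  have hU : (0 : ℝ) ≤ (n : ℝ) + R.time := by positivity
  have hklog : (k : ℝ) / 2 ≤ k * Real.log (k + 1) := by nlinarith
  -- If g vanishes identically, the signs of ati and reg are unknown, but both bounds are 0;
  -- otherwise ati > 0 and reg ≥ 1.
  have hzero : (¬ ∃ x, 0 < g x) → optRank g A k = 0 := fun h =>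
    optRank_eq_zero A (fun x => le_antisymm (not_lt.1 fun hx => h ⟨x, hx⟩) (hg x)) k
  by_cases hkn : n ≤ k + N₀
  · obtain ⟨fuel, hsafe, hprob⟩ := columnProg_small A hkn hn hmon R
    refine ⟨fuel, fun o ho => ?_, hprob.trans (MeasureTheory.OuterMeasure.mono _ ?_)⟩
    · obtain ⟨s, hs, ht, hS⟩ := hsafe o ho
      refine ⟨s, hs, ht.trans ?_, hS.trans ?_⟩
      · have h1 : (1 / 4 : ℝ) ≤ Real.log n ^ 2 := by nlinarith
        have h2 := mul_le_mul_of_nonneg_left h1 hU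
        have h3 : 0 ≤ (N₀ : ℝ) * (((n : ℝ) + R.time) * Real.log n ^ 2) := by positivity
        linarith
      · have h1 : (1 / 2 : ℝ) ≤ k * Real.log n := by nlinarith
        have h2 : (k : ℝ) / 2 ≤ k * Real.log n := by nlinarith
        have h3 := mul_le_mul_of_nonneg_left h1 hN0
        linarith
    · rintro o ⟨s, hs, X, hX⟩
      refine ⟨s, hs, X, hX.trans ?_⟩
      by_cases h : ∃ x, 0 < g x
      · obtain ⟨x, hx⟩ := h
        have h1 := hati.one_le hg hx
        have h2 := hR.one_le hc hnn hx
        have h3 := hati.pos hg hx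
        have h4 : (2 * k + 1 : ℝ) ≤ (400000 + 2 * N₀) * k * Real.log (k + 1) := by
          have := mul_le_mul_of_nonneg_left hklog hN0
          have : 0 ≤ (N₀ : ℝ) * ((k : ℝ) / 2) := by positivity
          linarith
        have h5 : 1 ≤ ati * reg * ((400000 + 2 * N₀) * k * Real.log (k + 1)) := by
          calc (1 : ℝ) ≤ ati * (2 * k + 1) := h1
            _ ≤ ati * ((400000 + 2 * N₀) * k * Real.log (k + 1)) := by gcongr
            _ ≤ ati * reg * ((400000 + 2 * N₀) * k * Real.log (k + 1)) := by
              have h6 : ati ≤ ati * reg := le_mul_of_one_le_right h3.le h2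
              exact mul_le_mul_of_nonneg_right h6 (by positivity)
        have h6 := mul_le_mul_of_nonneg_left h5 (mul_nonneg hmon0 hopt0)
        linarith
      · rw [hzero h]
        simp
  · obtain ⟨fuel, hsafe, hprob⟩ := columnProg_large A hc (not_le.1 hkn) hn
      (hN₀ n (by omega) hn) hg (hati.abs hg) (abs_nonneg ati) hmon (abs_nonneg reg) R (hR.abs hg)
    refine ⟨fuel, fun o ho => ?_, hprob.trans (MeasureTheory.OuterMeasure.mono _ ?_)⟩
    · obtain ⟨s, hs, ht, hS⟩ := hsafe o ho
      refine ⟨s, hs, ht.trans ?_, hS.trans ?_⟩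
      · gcongr
        linarith
      · have h1 : (2 * k + 1 : ℝ) * Real.log n ≤ 3 * k * Real.log n := by
          gcongr
          linarith
        have h2 : 0 ≤ (N₀ : ℝ) * (k * Real.log n) := by positivity
        have h3 : 0 ≤ k * Real.log n := by positivity
        linarith
    · rintro o ⟨s, hs, X, hX⟩
      refine ⟨s, hs, X, hX.trans ?_⟩
      by_cases h : ∃ x, 0 < g x
      · obtain ⟨x, hx⟩ := h
        have h2 := hR.one_le hc hnn hx
        have h3 := hati.pos hg hx
        rw [abs_of_pos h3, abs_of_pos (show 0 < reg by linarith)]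
        have h4 : (10 * (2 * k + 1) : ℝ) * tailBound k ≤ 30 * k * (142 * Real.log (k + 1)) := by
          exact mul_le_mul (by linarith) (tailBound_le hk) (Nat.cast_nonneg _) (by positivity)
        have h5 : 4 * ((10 * (2 * k + 1) : ℝ) * tailBound k)
            ≤ (400000 + 2 * N₀) * k * Real.log (k + 1) := by
          have h6 : 0 ≤ (N₀ : ℝ) * (k * Real.log (k + 1)) := by positivity
          have h7 : 0 ≤ k * Real.log (k + 1) := by positivity
          linarith
        have h8 : 0 ≤ ati * mon * reg := by positivity
        refine mul_le_mul_of_nonneg_right ?_ hopt0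
        calc _ = ati * mon * reg * (4 * ((10 * (2 * k + 1) : ℝ) * tailBound k)) := by ring
          _ ≤ _ := mul_le_mul_of_nonneg_left h5 h8
      · rw [hzero h]
        simp
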